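/- Let $G=(V,E^+\cup E^-,w)$ be a directed graph with real edge weights $w$, where the edge set $E\subseteq V\times V$ is partitioned into *nonnegative edges* $E^+$ and *negative edges* $E^-$, such that $w(e)\ge 0$ for all $e\in E^+$ (edges in $E^-$ may have any real weight). Let $n=|V|$ and $m=|E|$, and assume $m\ge 2n$. A *negative vertex* is a vertex $u$ with an outgoing edge $(u,v)\in E^-$. A *1-hop path* is a (not necessarily simple, possibly empty) path on which negative edges occur at most once in total, and $\mathrm{dist}^1(u,v)$ is the minimum weight of a 1-hop path from $u$ to $v$ ($\infty$ if there is none). A *1-hop independent set* is a set $I$ of negative vertices such that $\mathrm{dist}^1(x,y)\ge 0$ for all $x,y\in I$ (including $x=y$). **Lemma.** There is a Las Vegas randomized algorithm (on a Real RAM, i.e. a RAM with $O(\log n)$-bit words and additional real-valued cells, in which word operations, drawing a uniformly random integer below a given word, and addition, subtraction, negation and comparison of reals take unit time) that takes as input such a graph $G$, a set $U_0$ of negative vertices with $\hat k=|U_0|$, and an integer $\rho$ with $1\le\rho\le\hat k$, halts with probability one, and whenever it halts has done one of the following: 1. correctly determined that $G$ contains a negative-weight cycle; 2. returned a set $U\subseteq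 U_0$ with $|U|=\Omega(\hat k/\rho)$ and a vertex $y\in V$ such that $\mathrm{dist}^1(u,y)<0$ for all $u\in U$; 3. returned a 1-hop independent set $I$ with $|I|=\Omega(\rho)$. Its running time is $O(m\log^2 n)$ with high probability: for every $\alpha>0$ there is a constant $C$, depending only on $\alpha$, such that on every input the running time exceeds $C\,m\log^2 n$ with probability at most $n^{-\alpha}$. The constants hidden in $\Omega(\cdot)$ are universal. -/

import Mathlib

/-! ## Weighted digraphs with classified edges, and hop-limited distances -/

/-- A weighted digraph on the vertices `0, …, n - 1` whose edge set, a set of `m` ordered pairs of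
vertices, is listed in an arbitrary order.  The edges in `neg` are classified as negative edges
(`E⁻`), the others as nonnegative edges (`E⁺`); the classification is part of the data. -/
structure HopGraph (n m : ℕ) where
  src : Fin m → Fin n
  tgt : Fin m → Fin n
  wt : Fin m → ℝ
  neg : Finset (Fin m)
  edge_inj : Function.Injective fun e => (src e, tgt e)

namespace HopGraph

variable {n m : ℕ} (G : HopGraph n m)

/-- The list of edges `p` is a (not necessarily simple, possibly empty) path from `u` to `v`. -/
def IsPath : Fin n → List (Fin m) → Fin n → Prop
  | u, [], v => u = v
  | u, e :: p, v => G.src e = u ∧ IsPath (G.tgt e) p v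

/-- The total weight of a path. -/
def weight (p : List (Fin m)) : ℝ := (p.map G.wt).sum

/-- The number of occurrences of negative edges on a path. -/
def hops (p : List (Fin m)) : ℕ := p.countP (fun e => decide (e ∈ G.neg))

/-- The `h`-hop distance: the smallest weight of a path from `u` to `v` with at most `h` hops,
and `⊤` if there is no such path. -/
noncomputable def hopDist (h : ℕ) (u v : Fin n) : EReal :=
  ⨅ (p : List (Fin m)) (_ : G.IsPath u p v ∧ G.hops p ≤ h), ((G.weight p : ℝ) : EReal)

/-- The graph contains a cycle of negative weight. -/
def HasNegCycle : Prop := ∃ v p, G.IsPath v p v ∧ G.weight p < 0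

/-- A negative vertex is the tail of a negative edge. -/
def IsNegVertex (v : Fin n) : Prop := ∃ e ∈ G.neg, G.src e = v

/-- `u` and `v` are `h`-hop related. -/
def HopRelated (h : ℕ) (u v : Fin n) : Prop := G.hopDist h u v < 0 ∨ G.hopDist h v u < 0

/-- A `1`-hop independent set: a set of negative vertices no two of which (equal or not) are
`1`-hop related. -/
def IsOneHopIndep (I : Finset (Fin n)) : Prop :=
  (∀ x ∈ I, G.IsNegVertex x) ∧ ∀ x ∈ I, ∀ y ∈ I, ¬ G.HopRelated 1 x y

end HopGraph

/-! ## A randomized Real RAM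

The memory consists of arrays of machine words and arrays of reals.  Arrays have fixed numbers as
names, and the cells are addressed by words, so indirect addressing is available; a scalar
variable is a cell with a constant address.  Words have `b` bits.  Real numbers can only be moved,
added, subtracted, negated and compared.  Every execution of an elementary command takes one step;
the expressions in a program are of constant size. -/

namespace RealRAM

/-- The memory: `words a i` and `reals a i` are the `i`-th cells of the `a`-th arrays. -/
structure Store where
  words : ℕ → ℕ → ℕ
  reals : ℕ → ℕ → ℝ

/-- Expressions for machine words. -/
inductive WExp
  | const (c : ℕ)
  | get (a : ℕ) (i : WExp)
  | add (x y : WExp)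
  | sub (x y : WExp)
  | mul (x y : WExp)
  | div (x y : WExp)

/-- The value of a word expression on a machine with `b`-bit words.  Results are reduced
modulo `2 ^ b`; subtraction is truncated at `0`, and division rounds down. -/
def WExp.eval (b : ℕ) (s : Store) : WExp → ℕ
  | const c => c % 2 ^ b
  | get a i => s.words a (i.eval b s) % 2 ^ b
  | add x y => (x.eval b s + y.eval b s) % 2 ^ b
  | sub x y => x.eval b s - y.eval b s
  | mul x y => (x.eval b s * y.eval b s) % 2 ^ b
  | div x y => x.eval b s / y.eval b s

/-- Expressions for real numbers. -/
inductive RExp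
  | get (a : ℕ) (i : WExp)
  | add (x y : RExp)
  | sub (x y : RExp)
  | neg (x : RExp)

/-- The value of a real expression. -/
noncomputable def RExp.eval (b : ℕ) (s : Store) : RExp → ℝ
  | get a i => s.reals a (i.eval b s)
  | add x y => x.eval b s + y.eval b s
  | sub x y => x.eval b s - y.eval b s
  | neg x => - x.eval b s

/-- Conditions: comparisons of words and of reals, and their Boolean combinations. -/
inductive BExp
  | weq (x y : WExp)
  | wlt (x y : WExp)
  | rlt (x y : RExp)
  | not (c : BExp)
  | and (c d : BExp)

/-- The condition holds in the given memory. -/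
def BExp.Holds (b : ℕ) (s : Store) : BExp → Prop
  | weq x y => x.eval b s = y.eval b s
  | wlt x y => x.eval b s < y.eval b s
  | rlt x y => x.eval b s < y.eval b s
  | not c => ¬ c.Holds b s
  | and c d => c.Holds b s ∧ d.Holds b s

/-- Programs.  `wset a i x` and `rset a i x` store the value of `x` in the cell `a[i]`;
`rand a i x` stores in `a[i]` a fresh uniformly random word among `0, …, x - 1`. -/
inductive Prog
  | skip
  | wset (a : ℕ) (i x : WExp)
  | rset (a : ℕ) (i : WExp) (x : RExp)
  | rand (a : ℕ) (i x : WExp)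
  | seq (p q : Prog)
  | cond (c : BExp) (p q : Prog)
  | loop (c : BExp) (p : Prog)

/-- Write a word into the memory. -/
def Store.setWord (s : Store) (a i x : ℕ) : Store :=
  { s with words := Function.update s.words a (Function.update (s.words a) i x) }

/-- Write a real into the memory. -/
noncomputable def Store.setReal (s : Store) (a i : ℕ) (x : ℝ) : Store :=
  { s with reals := Function.update s.reals a (Function.update (s.reals a) i x) }

/-- The uniform distribution on `{0, …, k - 1}`; for `k = 0` the result is `0`. -/
noncomputable def uniformBelow : ℕ → PMF ℕ
  | 0 => PMF.pure 0
  | k + 1 => PMF.uniformOfFinset (Finset.range (k + 1)) ⟨0, Finset.mem_range.2 k.succ_pos⟩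

/-- A configuration: the stack of programs that remain to be executed, and the memory. -/
structure Config where
  todo : List Prog
  store : Store

/-- The machine has halted. -/
def Config.Halted (c : Config) : Prop := c.todo = []

open Classical in
/-- One step of the machine with `b`-bit words; a halted machine does not move. -/
noncomputable def step (b : ℕ) : Config → PMF Config
  | ⟨[], s⟩ => PMF.pure ⟨[], s⟩
  | ⟨.skip :: k, s⟩ => PMF.pure ⟨k, s⟩
  | ⟨.wset a i x :: k, s⟩ => PMF.pure ⟨k, s.setWord a (i.eval b s) (x.eval b s)⟩
  | ⟨.rset a i x :: k, s⟩ => PMF.pure ⟨k, s.setReal a (i.eval b s) (x.eval b s)⟩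
  | ⟨.rand a i x :: k, s⟩ =>
      (uniformBelow (x.eval b s)).map fun r => ⟨k, s.setWord a (i.eval b s) r⟩
  | ⟨.seq p q :: k, s⟩ => PMF.pure ⟨p :: q :: k, s⟩
  | ⟨.cond c p q :: k, s⟩ => PMF.pure (if c.Holds b s then ⟨p :: k, s⟩ else ⟨q :: k, s⟩)
  | ⟨.loop c p :: k, s⟩ =>
      PMF.pure (if c.Holds b s then ⟨p :: .loop c p :: k, s⟩ else ⟨k, s⟩)

/-- The distribution of the configuration after `t` steps. -/
noncomputable def runFor (b : ℕ) : ℕ → Config → PMF Config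
  | 0, c => PMF.pure c
  | t + 1, c => (step b c).bind (runFor b t)

/-- The probability that the machine has not halted within `t` steps, that is, that its running
time exceeds `t`. -/
noncomputable def probRunningAfter (b t : ℕ) (c : Config) : ENNReal :=
  (runFor b t c).toOuterMeasure {c' | ¬ c'.Halted}

/-- Word length `κ (⌊log₂ N⌋ + 1) = Θ(log N)` for inputs of size `N`. -/
def wordLength (κ N : ℕ) : ℕ := κ * (Nat.log 2 N + 1)

/-- The cells of an array that holds the given finite sequence, followed by zeros. -/
def cells {α : Type} [Zero α] {l : ℕ} (f : Fin l → α) (i : ℕ) : α :=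
  if h : i < l then f ⟨i, h⟩ else 0

/-- The memory that holds the input `G`, `U₀`, `ρ`: word array `0` contains `n`, `m`, `ρ`; word
arrays `1`, `2`, `3` list the tails and heads of the edges and the flags of the negative edges;
word array `4` contains the flags of the vertices in `U₀`; real array `0` lists the weights of the
edges.  All other cells are `0`. -/
noncomputable def inputStore {n m : ℕ} (G : HopGraph n m) (U₀ : Finset (Fin n)) (ρ : ℕ) : Store where
  words a :=
    match a with
    | 0 => cells ![n, m, ρ]
    | 1 => cells fun e => (G.src e : ℕ)
    | 2 => cells fun e => (G.tgt e : ℕ)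
    | 3 => cells fun e => if e ∈ G.neg then 1 else 0
    | 4 => cells fun v => if v ∈ U₀ then 1 else 0
    | _ => fun _ => 0
  reals a :=
    match a with
    | 0 => cells G.wt
    | _ => fun _ => 0

/-- The kind of answer that was returned: cell `0` of word array `5`. -/
def Store.answerKind (s : Store) : ℕ := s.words 5 0

/-- The returned vertex: cell `1` of word array `5`. -/
def Store.answerVertex (s : Store) : ℕ := s.words 5 1

/-- The returned set of vertices, whose flags are in word array `6`. -/
def Store.answerSet (n : ℕ) (s : Store) : Finset (Fin n) :=
  Finset.univ.filter fun v => s.words 6 v = 1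

end RealRAM

set_option linter.unusedSimpArgs false

/-! The algorithm repeats independent rounds. Write `k = |U₀|` and `q = ⌊k/ρ⌋`, and cut a list of
`U₀` into `ρ` blocks of size `q`. A round draws a pivot `y ∈ U₀` and, independently, one vertex from
each block. It computes the set of `u ∈ U₀` with `dist¹(u, y) < 0`. If `y` lies in it, there is a
negative closed walk; if it has at least `k/(16ρ)` members, it is answer 2. Otherwise the round
keeps the sampled vertices that no sampled vertex reaches at negative one-hop distance. These are
1-hop independent, and they are answer 3 when there are at least `ρ/2` of them.

A round fails with probability at most `15/16`. Call a pivot good if it triggers one of the first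
two answers. If more than `k/16` pivots are good, the pivot alone suffices. Otherwise, since `k ≤
2ρq`, the expected number of good vertices in the sample is at most `ρ/8`; every other vertex has
fewer than `k/(16ρ)` negative in-neighbours and none at itself, so the expected number of ordered
sampled pairs spoiling such a vertex is also at most `ρ/8`. By Markov's inequality at least half of
the sample survives with probability at least `1/2`. This is `sixteen_mul_card_failures_le`.

Only the signs of one-hop distances from a source set matter, and two runs of Dijkstra's algorithm
on the nonnegative edges give them, with one relaxation of the negative edges in between
(`HopGraph.oneHop_neg_iff`). With a tournament tree as priority queue a round takes `O((n + m) log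
n)` steps, and `O(α log n)` rounds push the failure probability below `n^(-α)`.

All code except the draws is verified by deterministic big-step execution (`Ends`). Randomness
enters through `failProb`, the probability of not having halted correctly by time `t`. Its geometric
decay (`failProb_mainLoop`, `failProb_algorithm`) yields the time bound, almost sure halting, and,
since halted configurations keep their mass, correctness of every possible halted outcome. -/

/-! ## Deterministic executions -/

namespace RealRAM

/-- The word arrays that a program writes to. -/
def Prog.wmods : Prog → List ℕ
  | .skip => []
  | .wset a _ _ => [a]
  | .rset _ _ _ => []
  | .rand a _ _ => [a]
  | .seq p q => p.wmods ++ q.wmods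
  | .cond _ p q => p.wmods ++ q.wmods
  | .loop _ p => p.wmods

/-- The real arrays that a program writes to. -/
def Prog.rmods : Prog → List ℕ
  | .skip => []
  | .wset _ _ _ => []
  | .rset a _ _ => [a]
  | .rand _ _ _ => []
  | .seq p q => p.rmods ++ q.rmods
  | .cond _ p q => p.rmods ++ q.rmods
  | .loop _ p => p.rmods

/-- All words in the memory have `b` bits. -/
def Store.Bounded (b : ℕ) (s : Store) : Prop := ∀ a i, s.words a i < 2 ^ b

theorem WExp.eval_lt (b : ℕ) (s : Store) (x : WExp) : x.eval b s < 2 ^ b := by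
  induction x with
  | const c => exact Nat.mod_lt _ (by positivity)
  | get a i => exact Nat.mod_lt _ (by positivity)
  | add x y => exact Nat.mod_lt _ (by positivity)
  | sub x y ihx => exact (Nat.sub_le _ _).trans_lt ihx
  | mul x y => exact Nat.mod_lt _ (by positivity)
  | div x y ihx => exact (Nat.div_le_self _ _).trans_lt ihx

theorem Store.Bounded.setWord {b : ℕ} {s : Store} (h : s.Bounded b) (a i : ℕ) {x : ℕ}
    (hx : x < 2 ^ b) : (s.setWord a i x).Bounded b := by
  intro a' i'
  have := h a' i'
  have := h a i'
  simp only [Store.setWord, Function.update_apply]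
  split_ifs
  · rw [Function.update_apply]; split_ifs <;> assumption
  · assumption

/-- The arrays that the program does not write to agree in both memories, and the word length is
respected. -/
structure Prog.Frame (b : ℕ) (p : Prog) (s s' : Store) : Prop where
  words : ∀ a, a ∉ p.wmods → s'.words a = s.words a
  reals : ∀ a, a ∉ p.rmods → s'.reals a = s.reals a
  bounded : s.Bounded b → s'.Bounded b

theorem Prog.Frame.refl (b : ℕ) (p : Prog) (s : Store) : p.Frame b s s :=
  ⟨fun _ _ => rfl, fun _ _ => rfl, id⟩

theorem Prog.Frame.trans {b : ℕ} {p : Prog} {s s' s'' : Store} (h : p.Frame b s s')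
    (h' : p.Frame b s' s'') : p.Frame b s s'' :=
  ⟨fun a ha => (h'.1 a ha).trans (h.1 a ha), fun a ha => (h'.2 a ha).trans (h.2 a ha),
    h'.3 ∘ h.3⟩

theorem Prog.Frame.mono {b : ℕ} {p q : Prog} {s s' : Store} (h : p.Frame b s s')
    (hw : ∀ a ∈ p.wmods, a ∈ q.wmods) (hr : ∀ a ∈ p.rmods, a ∈ q.rmods) : q.Frame b s s' :=
  ⟨fun a ha => h.1 a fun h => ha (hw a h), fun a ha => h.2 a fun h => ha (hr a h), h.3⟩

/-- Deterministic big-step execution with running time. -/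
inductive Exec (b : ℕ) : Prog → Store → Store → ℕ → Prop
  | skip (s) : Exec b .skip s s 1
  | wset (a i x s) : Exec b (.wset a i x) s (s.setWord a (i.eval b s) (x.eval b s)) 1
  | rset (a i x s) : Exec b (.rset a i x) s (s.setReal a (i.eval b s) (x.eval b s)) 1
  | seq {p q s s₁ s₂ t₁ t₂} : Exec b p s s₁ t₁ → Exec b q s₁ s₂ t₂ →
      Exec b (.seq p q) s s₂ (t₁ + t₂ + 1)
  | condT {c p q s s₁ t} : c.Holds b s → Exec b p s s₁ t → Exec b (.cond c p q) s s₁ (t + 1)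
  | condF {c p q s s₁ t} : ¬ c.Holds b s → Exec b q s s₁ t → Exec b (.cond c p q) s s₁ (t + 1)
  | loopT {c p s s₁ s₂ t₁ t₂} : c.Holds b s → Exec b p s s₁ t₁ → Exec b (.loop c p) s₁ s₂ t₂ →
      Exec b (.loop c p) s s₂ (t₁ + t₂ + 1)
  | loopF {c p s} : ¬ c.Holds b s → Exec b (.loop c p) s s 1

/-- Links the big-step relation to the machine. The arbitrary continuation `k` is what makes the
induction pass through sequences and loops. -/
theorem Exec.runFor_eq {b : ℕ} {p : Prog} {s s' : Store} {t : ℕ} (h : Exec b p s s' t)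
    (k : List Prog) (j : ℕ) : runFor b (t + j) ⟨p :: k, s⟩ = runFor b j ⟨k, s'⟩ := by
  induction h generalizing k j with
  | skip s => rw [Nat.add_comm]; simp [runFor, step]
  | wset a i x s => rw [Nat.add_comm]; simp [runFor, step]
  | rset a i x s => rw [Nat.add_comm]; simp [runFor, step]
  | @seq p q s s₁ s₂ t₁ t₂ _ _ ih₁ ih₂ =>
    rw [show t₁ + t₂ + 1 + j = (t₁ + (t₂ + j)) + 1 by omega, ← ih₂ k j, ← ih₁]
    simp [runFor, step]
  | @condT c p q s s₁ t hc _ ih =>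
    rw [show t + 1 + j = (t + j) + 1 by omega, ← ih k j]
    simp [runFor, step, hc]
  | @condF c p q s s₁ t hc _ ih =>
    rw [show t + 1 + j = (t + j) + 1 by omega, ← ih k j]
    simp [runFor, step, hc]
  | @loopT c p s s₁ s₂ t₁ t₂ hc _ _ ih₁ ih₂ =>
    rw [show t₁ + t₂ + 1 + j = (t₁ + (t₂ + j)) + 1 by omega, ← ih₂ k j, ← ih₁]
    simp [runFor, step, hc]
  | @loopF c p s hc =>
    rw [Nat.add_comm]; simp [runFor, step, hc]

/-- The footprint is syntactic, so preservation of an untouched array reduces to a membership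
question that `decide` settles for a concrete program. -/
theorem Exec.frame {b : ℕ} {p : Prog} {s s' : Store} {t : ℕ} (h : Exec b p s s' t) :
    p.Frame b s s' := by
  induction h with
  | skip s => exact .refl _ _ _
  | wset a i x s =>
    refine ⟨fun c hc => ?_, fun _ _ => rfl, fun h => h.setWord _ _ (x.eval_lt b s)⟩
    simp only [Prog.wmods, List.mem_singleton] at hc
    simp [Store.setWord, hc]
  | rset a i x s =>
    refine ⟨fun _ _ => rfl, fun c hc => ?_, id⟩
    simp only [Prog.rmods, List.mem_singleton] at hc
    simp [Store.setReal, hc]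
  | seq _ _ ih₁ ih₂ =>
    exact (ih₁.mono (by simp +contextual [Prog.wmods]) (by simp +contextual [Prog.rmods])).trans
      (ih₂.mono (by simp +contextual [Prog.wmods]) (by simp +contextual [Prog.rmods]))
  | condT _ _ ih =>
    exact ih.mono (by simp +contextual [Prog.wmods]) (by simp +contextual [Prog.rmods])
  | condF _ _ ih =>
    exact ih.mono (by simp +contextual [Prog.wmods]) (by simp +contextual [Prog.rmods])
  | loopT _ _ _ ih₁ ih₂ => exact Prog.Frame.trans (ih₁.mono (fun _ h => h) (fun _ h => h)) ih₂
  | loopF _ => exact .refl _ _ _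

/-- Started in the memory `s`, the program halts within `T` steps in a memory satisfying `Q`. -/
def Ends (b : ℕ) (p : Prog) (s : Store) (T : ℕ) (Q : Store → Prop) : Prop :=
  ∃ s' t, Exec b p s s' t ∧ t ≤ T ∧ Q s'

section Ends

variable {b : ℕ} {p q : Prog} {c : BExp} {s : Store} {T T₁ T₂ : ℕ} {Q Q' : Store → Prop}

theorem Ends.imp (h : Ends b p s T Q) (hQ : ∀ s', p.Frame b s s' → Q s' → Q' s') :
    Ends b p s T Q' := by
  obtain ⟨s', t, h1, h2, h3⟩ := h
  exact ⟨s', t, h1, h2, hQ s' h1.frame h3⟩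

theorem Ends.le (h : Ends b p s T₁ Q) (hT : T₁ ≤ T) : Ends b p s T Q := by
  obtain ⟨s', t, h1, h2, h3⟩ := h
  exact ⟨s', t, h1, h2.trans hT, h3⟩

theorem Ends.seq (h : Ends b p s T₁ fun s' => Ends b q s' T₂ Q) :
    Ends b (.seq p q) s (T₁ + T₂ + 1) Q := by
  obtain ⟨s', t, h1, h2, s'', t', h3, h4, h5⟩ := h
  exact ⟨s'', _, .seq h1 h3, by omega, h5⟩

theorem Ends.cond (h1 : c.Holds b s → Ends b p s T Q) (h2 : ¬ c.Holds b s → Ends b q s T Q) :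
    Ends b (.cond c p q) s (T + 1) Q := by
  by_cases hc : c.Holds b s
  · obtain ⟨s', t, h1, h2, h3⟩ := h1 hc
    exact ⟨s', _, .condT hc h1, by omega, h3⟩
  · obtain ⟨s', t, h1, h2, h3⟩ := h2 hc
    exact ⟨s', _, .condF hc h1, by omega, h3⟩

/-- The time budget `N` is an argument of the invariant rather than a function of the memory, so it
may depend on ghost data such as the list of pending edges in Dijkstra's algorithm. -/
theorem Ends.loop_potential (I : ℕ → Store → Prop) {s₀ : Store} {N₀ : ℕ}
    (h : ∀ N s, p.Frame b s₀ s → I N s → c.Holds b s →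
      ∃ T, Ends b p s T fun s' => ∃ N', I N' s' ∧ N' + T + 1 ≤ N) (h₀ : I N₀ s₀) :
    Ends b (.loop c p) s₀ (N₀ + 1) fun s' => (∃ N, I N s') ∧ ¬ c.Holds b s' := by
  suffices ∀ N s, p.Frame b s₀ s → I N s →
      Ends b (.loop c p) s (N + 1) fun s' => (∃ N, I N s') ∧ ¬ c.Holds b s' from
    this _ s₀ (.refl _ _ _) h₀
  intro N
  induction N using Nat.strong_induction_on with
  | _ N ih =>
    intro s hf hI
    by_cases hc : c.Holds b s
    · obtain ⟨T, s', t, h1, h2, N', h3, h4⟩ := h N s hf hI hc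
      obtain ⟨s'', t', h5, h6, h7⟩ := ih N' (by omega) s' (hf.trans h1.frame) h3
      exact ⟨s'', _, .loopT hc h1 h5, by omega, h7⟩
    · exact ⟨s, _, .loopF hc, by omega, ⟨N, hI⟩, hc⟩

theorem Ends.loop (I : Store → Prop) (Φ : Store → ℕ) {s₀ : Store}
    (h : ∀ s, p.Frame b s₀ s → I s → c.Holds b s →
      ∃ T, Ends b p s T fun s' => I s' ∧ Φ s' + T + 1 ≤ Φ s) (h₀ : I s₀) :
    Ends b (.loop c p) s₀ (Φ s₀ + 1) fun s' => I s' ∧ ¬ c.Holds b s' := by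
  refine (Ends.loop_potential (fun N s => I s ∧ Φ s = N) (fun N s hf hI hc => ?_)
    ⟨h₀, rfl⟩).imp fun s' _ hs => ⟨hs.1.choose_spec.1, hs.2⟩
  obtain ⟨T, hT⟩ := h s hf hI.1 hc
  exact ⟨T, hT.imp fun s' _ hs => ⟨_, ⟨hs.1, rfl⟩, hI.2 ▸ hs.2⟩⟩

end Ends

/-! ### Straight-line programs -/

/-- A scalar variable: cell `0` of an array. -/
abbrev WExp.var (a : ℕ) : WExp := .get a (.const 0)

/-- The program contains no loop and no random choice. -/
def Prog.straight : Prog → Bool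
  | .skip => true
  | .wset _ _ _ => true
  | .rset _ _ _ => true
  | .rand _ _ _ => false
  | .seq p q => p.straight && q.straight
  | .cond _ p q => p.straight && q.straight
  | .loop _ _ => false

/-- A bound for the running time of a straight-line program. -/
def Prog.cost : Prog → ℕ
  | .skip => 1
  | .wset _ _ _ => 1
  | .rset _ _ _ => 1
  | .rand _ _ _ => 0
  | .seq p q => p.cost + q.cost + 1
  | .cond _ p q => max p.cost q.cost + 1
  | .loop _ _ => 0

open Classical in
/-- The effect of a straight-line program. -/
noncomputable def Prog.effect (b : ℕ) : Prog → Store → Store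
  | .skip, s => s
  | .wset a i x, s => s.setWord a (i.eval b s) (x.eval b s)
  | .rset a i x, s => s.setReal a (i.eval b s) (x.eval b s)
  | .rand _ _ _, s => s
  | .seq p q, s => q.effect b (p.effect b s)
  | .cond c p q, s => if c.Holds b s then p.effect b s else q.effect b s
  | .loop _ _, s => s

theorem Prog.exec_effect {b : ℕ} (p : Prog) (hp : p.straight = true) (s : Store) :
    Ends b p s p.cost fun s' => s' = p.effect b s := by
  induction p generalizing s with
  | skip => exact ⟨_, _, .skip s, le_rfl, rfl⟩
  | wset a i x => exact ⟨_, _, .wset a i x s, le_rfl, rfl⟩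
  | rset a i x => exact ⟨_, _, .rset a i x s, le_rfl, rfl⟩
  | rand => simp [straight] at hp
  | loop => simp [straight] at hp
  | seq p q ihp ihq =>
    simp only [straight, Bool.and_eq_true] at hp
    refine Ends.seq ((ihp hp.1 s).imp fun s' _ h' => ?_)
    subst h'
    exact ihq hp.2 _
  | cond c p q ihp ihq =>
    simp only [straight, Bool.and_eq_true] at hp
    refine Ends.cond (fun hc => ?_) (fun hc => ?_)
    · exact ((ihp hp.1 s).le (le_max_left _ _)).imp fun s' _ h => by simp [effect, hc, h]
    · exact ((ihq hp.2 s).le (le_max_right _ _)).imp fun s' _ h => by simp [effect, hc, h]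

/-- Turns the verification of loop-free code into simplification of `Prog.effect`. -/
theorem Ends.straight {b : ℕ} {p : Prog} {s : Store} {T : ℕ} {Q : Store → Prop}
    (hp : p.straight = true) (hT : p.cost ≤ T) (h : Q (p.effect b s)) : Ends b p s T Q :=
  ((p.exec_effect hp s).le hT).imp fun _ _ hs => hs ▸ h

@[simp] theorem Store.setWord_words (s : Store) (a i x a' : ℕ) :
    (s.setWord a i x).words a' =
      if a' = a then Function.update (s.words a) i x else s.words a' := by
  by_cases h : a' = a
  · subst h; simp [Store.setWord]
  · simp [Store.setWord, h]

@[simp] theorem Store.setWord_reals (s : Store) (a i x : ℕ) :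
    (s.setWord a i x).reals = s.reals := rfl

@[simp] theorem Store.setReal_words (s : Store) (a i : ℕ) (x : ℝ) :
    (s.setReal a i x).words = s.words := rfl

@[simp] theorem Store.setReal_reals (s : Store) (a i : ℕ) (x : ℝ) (a' : ℕ) :
    (s.setReal a i x).reals a' =
      if a' = a then Function.update (s.reals a) i x else s.reals a' := by
  by_cases h : a' = a
  · subst h; simp [Store.setReal]
  · simp [Store.setReal, h]

/-- `for i < a[c] do p`, where the counter is the scalar variable `i`. -/
def Prog.forLoop (i a c : ℕ) (p : Prog) : Prog :=
  .seq (.wset i (.const 0) (.const 0))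
    (.loop (.wlt (.var i) (.get a (.const c)))
      (.seq p (.wset i (.const 0) (.add (.var i) (.const 1)))))

/-- The body is followed by the counter update, so its postcondition speaks of the memory with the
counter already set to `j + 1`. The bound `N < 2 ^ b` excludes wrap-around. -/
theorem Ends.forLoop {b i a c N T : ℕ} {p : Prog} {s₀ : Store} (I : ℕ → Store → Prop)
    (ha : a ∉ (Prog.forLoop i a c p).wmods) (hi : i ∉ p.wmods) (hc : c < 2 ^ b)
    (hN : s₀.words a c = N) (hNb : N < 2 ^ b)
    (h₀ : I 0 (s₀.setWord i 0 0))
    (h : ∀ j s, j < N → (Prog.forLoop i a c p).Frame b s₀ s → s.words i 0 = j → I j s →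
      Ends b p s T fun s' => I (j + 1) (s'.setWord i 0 (j + 1))) :
    Ends b (.forLoop i a c p) s₀ ((T + 4) * N + 3) (I N) := by
  have hb : 0 < 2 ^ b := by omega
  refine (Ends.seq (T₁ := 1) (T₂ := (T + 4) * N + 1) ?_).le (by omega)
  refine Ends.straight rfl le_rfl ?_
  simp only [Prog.effect, WExp.eval, Nat.zero_mod]
  set s₁ := s₀.setWord i 0 0 with hs₁
  have hf₁ : (Prog.forLoop i a c p).Frame b s₀ s₁ := by
    refine ⟨fun d hd => ?_, fun d _ => rfl, fun h => h.setWord _ _ (by positivity)⟩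
    simp only [Prog.forLoop, Prog.wmods, List.mem_append, List.mem_singleton, not_or] at hd
    simp [hs₁, hd.1]
  have key := Ends.loop (b := b) (c := .wlt (.var i) (.get a (.const c)))
    (p := .seq p (.wset i (.const 0) (.add (.var i) (.const 1)))) (s₀ := s₁)
    (fun s => s.words i 0 ≤ N ∧ I (s.words i 0) s) (fun s => (T + 4) * (N - s.words i 0)) ?_ ?_
  · refine (key.le ?_).imp fun s' hf hs' => ?_
    · simp [hs₁]
    · obtain ⟨⟨h1, h2⟩, h3⟩ := hs'
      have hf' : s'.words a c = N := by
        rw [hf.1 a fun hm => ha (List.mem_append_right _ hm), hf₁.1 a ha, hN]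
      simp only [BExp.Holds, WExp.eval, Nat.zero_mod, Nat.mod_eq_of_lt hc, hf',
        Nat.mod_eq_of_lt hNb, Nat.mod_eq_of_lt (h1.trans_lt hNb)] at h3
      rwa [show s'.words i 0 = N by omega] at h2
  · intro s hf hI hcond
    obtain ⟨h1, h2⟩ := hI
    have hF : (Prog.forLoop i a c p).Frame b s₀ s :=
      hf₁.trans (hf.mono (fun a h => List.mem_append_right _ h)
        (fun a h => List.mem_append_right _ h))
    have hf' : s.words a c = N := by rw [hF.1 a ha, hN]
    simp only [BExp.Holds, WExp.eval, Nat.zero_mod, Nat.mod_eq_of_lt hc, hf',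
      Nat.mod_eq_of_lt hNb, Nat.mod_eq_of_lt (h1.trans_lt hNb)] at hcond
    refine ⟨T + 2, Ends.seq (T₁ := T) (T₂ := 1) ((h _ s hcond hF rfl h2).imp fun s' hf2 hs' => ?_)⟩
    refine Ends.straight rfl le_rfl ?_
    have e : s'.words i 0 = s.words i 0 := by rw [hf2.1 i hi]
    have h1b : 1 % 2 ^ b = 1 := Nat.mod_eq_of_lt (by omega)
    simp only [Prog.effect, WExp.eval, Nat.zero_mod, e, Nat.mod_eq_of_lt (h1.trans_lt hNb), h1b,
      Nat.mod_eq_of_lt (show s.words i 0 + 1 < 2 ^ b by omega)]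
    simp only [Store.setWord_words, if_true, Function.update_self]
    refine ⟨⟨hcond, hs'⟩, ?_⟩
    have : N - s.words i 0 = (N - (s.words i 0 + 1)) + 1 := by omega
    rw [this, Nat.mul_add]; omega
  · simpa [hs₁] using h₀

/-! ## Random executions -/

/-- The probability that the machine has not halted after `t` steps in a memory satisfying
`Q`. -/
noncomputable def failProb (b : ℕ) (Q : Store → Prop) (t : ℕ) (c : Config) : ENNReal :=
  (runFor b t c).toOuterMeasure {c' | ¬ (c'.Halted ∧ Q c'.store)}

section failProb

variable {b : ℕ} {Q : Store → Prop}

theorem failProb_le_one (t : ℕ) (c : Config) : failProb b Q t c ≤ 1 := by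
  classical
  rw [failProb, PMF.toOuterMeasure_apply, ← (runFor b t c).tsum_coe]
  exact ENNReal.tsum_le_tsum fun x => Set.indicator_le_self _ _ _

theorem failProb_succ (t : ℕ) (c : Config) :
    failProb b Q (t + 1) c = ∑' c', step b c c' * failProb b Q t c' := by
  simp only [failProb, runFor, PMF.toOuterMeasure_bind_apply]

theorem failProb_halted (t : ℕ) {s : Store} (h : Q s) : failProb b Q t ⟨[], s⟩ = 0 := by
  have : runFor b t ⟨[], s⟩ = PMF.pure ⟨[], s⟩ := by
    induction t with
    | zero => rfl
    | succ t ih => simp [runFor, step, ih]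
  classical
  rw [failProb, this, PMF.toOuterMeasure_pure_apply, if_neg]
  simp [Config.Halted, h]

theorem failProb_zero_eq_one {c : Config} (h : ¬ (c.Halted ∧ Q c.store)) :
    failProb b Q 0 c = 1 := by
  classical
  rw [failProb, runFor, PMF.toOuterMeasure_pure_apply, if_pos]
  exact h

theorem failProb_antitone (c : Config) : Antitone fun t => failProb b Q t c := by
  refine antitone_nat_of_succ_le fun t => ?_
  induction t generalizing c with
  | zero =>
    by_cases h : c.Halted ∧ Q c.store
    · obtain ⟨k, s⟩ := c
      obtain ⟨h1, h2⟩ := h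
      simp only [Config.Halted] at h1
      subst h1
      rw [failProb_halted _ h2]; exact zero_le
    · rw [failProb_zero_eq_one h]; exact failProb_le_one _ _
  | succ t ih =>
    rw [failProb_succ, failProb_succ]
    exact ENNReal.tsum_le_tsum fun c' => by gcongr; exact ih c'

theorem Exec.failProb_eq {p : Prog} {s s' : Store} {t : ℕ} (h : Exec b p s s' t)
    (k : List Prog) (j : ℕ) : failProb b Q (t + j) ⟨p :: k, s⟩ = failProb b Q j ⟨k, s'⟩ := by
  rw [failProb, failProb, h.runFor_eq]

theorem Ends.failProb_le {p : Prog} {s : Store} {T : ℕ} {R : Store → Prop} (h : Ends b p s T R)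
    (k : List Prog) (j : ℕ) {x : ENNReal} (hx : ∀ s', p.Frame b s s' → R s' →
      failProb b Q j ⟨k, s'⟩ ≤ x) : failProb b Q (T + j) ⟨p :: k, s⟩ ≤ x := by
  obtain ⟨s', t, h1, h2, h3⟩ := h
  calc _ ≤ failProb b Q (t + j) ⟨p :: k, s⟩ := failProb_antitone _ (by omega)
    _ = _ := h1.failProb_eq k j
    _ ≤ x := hx s' h1.frame h3

theorem failProb_seq (p q : Prog) (k : List Prog) (s : Store) (t : ℕ) :
    failProb b Q (t + 1) ⟨.seq p q :: k, s⟩ = failProb b Q t ⟨p :: q :: k, s⟩ := by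
  simp [failProb, runFor, step]

theorem failProb_loop {c : BExp} (p : Prog) (k : List Prog) {s : Store} (t : ℕ)
    (h : c.Holds b s) :
    failProb b Q (t + 1) ⟨.loop c p :: k, s⟩ = failProb b Q t ⟨p :: .loop c p :: k, s⟩ := by
  simp [failProb, runFor, step, h]

theorem uniformBelow_succ_apply (N r : ℕ) :
    uniformBelow (N + 1) r = if r < N + 1 then ((N + 1 : ℕ) : ENNReal)⁻¹ else 0 := by
  have hne : (Finset.range (N + 1)).Nonempty := ⟨0, Finset.mem_range.2 N.succ_pos⟩
  have h : uniformBelow (N + 1) = PMF.uniformOfFinset (Finset.range (N + 1)) hne := rfl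
  rw [h, PMF.uniformOfFinset_apply, Finset.card_range]
  simp only [Finset.mem_range]

/-- The law of total probability for a uniform draw, multiplied by `N` so that later estimates
become integer counts of outcomes without division in `ENNReal`. -/
theorem failProb_rand {a : ℕ} {i x : WExp} {s : Store} (k : List Prog) (t N j : ℕ)
    (hN : x.eval b s = N) (hj : i.eval b s = j) (hN0 : 0 < N) :
    N * failProb b Q (t + 1) ⟨.rand a i x :: k, s⟩ =
      ∑ r : Fin N, failProb b Q t ⟨k, s.setWord a j r⟩ := by
  obtain ⟨N, rfl⟩ : ∃ M, N = M + 1 := ⟨N - 1, by omega⟩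
  have h1 : failProb b Q (t + 1) ⟨.rand a i x :: k, s⟩ =
      ∑' r, uniformBelow (N + 1) r * failProb b Q t ⟨k, s.setWord a j r⟩ := by
    simp only [failProb, runFor, step, hN, hj, PMF.map, PMF.bind_bind,
      PMF.toOuterMeasure_bind_apply, Function.comp, PMF.pure_bind]
  rw [h1, tsum_eq_sum (s := Finset.range (N + 1))]
  · rw [Finset.mul_sum, Finset.sum_range]
    refine Finset.sum_congr rfl fun r _ => ?_
    rw [uniformBelow_succ_apply, if_pos r.2, ← mul_assoc,
      ENNReal.mul_inv_cancel (by simp) (by simp), one_mul]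
  · intro r hr
    rw [uniformBelow_succ_apply, if_neg (by simpa using hr), zero_mul]

theorem runFor_apply_mono {c₀ c : Config} (hc : c.Halted) :
    Monotone fun t => runFor b t c₀ c := by
  refine monotone_nat_of_le_succ fun t => ?_
  induction t generalizing c₀ with
  | zero =>
    obtain ⟨k, s⟩ := c
    simp only [Config.Halted] at hc
    subst hc
    by_cases h : c₀ = ⟨[], s⟩
    · subst h; simp [runFor, step]
    · simp [runFor, PMF.pure_apply, Ne.symm h]
  | succ t ih =>
    change ((step b c₀).bind (runFor b t)) c ≤ ((step b c₀).bind (runFor b (t + 1))) c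
    rw [PMF.bind_apply, PMF.bind_apply]
    exact ENNReal.tsum_le_tsum fun c' => by gcongr; exact ih

/-- Halted configurations are absorbing, so the mass of one never decreases. A wrong halted
configuration of positive mass would therefore bound `failProb` away from `0`. -/
theorem post_of_failProb_tendsto {c₀ : Config}
    (h : Filter.Tendsto (fun t => failProb b Q t c₀) Filter.atTop (nhds 0)) (t : ℕ) (c : Config)
    (hc : c ∈ (runFor b t c₀).support) (hh : c.Halted) : Q c.store := by
  by_contra hQ
  have hpos : 0 < runFor b t c₀ c := (PMF.apply_pos_iff _ _).2 hc
  have hle : ∀ᶠ j in Filter.atTop, runFor b t c₀ c ≤ failProb b Q j c₀ := by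
    filter_upwards [Filter.eventually_ge_atTop t] with j hj
    refine (runFor_apply_mono (b := b) (c₀ := c₀) hh hj).trans ?_
    rw [failProb, PMF.toOuterMeasure_apply]
    refine le_trans (le_of_eq ?_) (ENNReal.le_tsum c)
    rw [Set.indicator_of_mem]
    exact fun h => hQ h.2
  exact absurd (ge_of_tendsto h hle) (not_le.2 hpos)

theorem probRunningAfter_le_failProb (t : ℕ) (c : Config) :
    probRunningAfter b t c ≤ failProb b Q t c :=
  MeasureTheory.measure_mono fun _ h h' => h h'.1

end failProb

end RealRAM

/-! ## One-hop distances from shortest paths on nonnegative edges -/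

namespace HopGraph

variable {n m : ℕ} (G : HopGraph n m)

theorem isPath_append {u v : Fin n} {p q : List (Fin m)} :
    G.IsPath u (p ++ q) v ↔ ∃ x, G.IsPath u p x ∧ G.IsPath x q v := by
  induction p generalizing u with
  | nil => simp [IsPath]
  | cons e p ih => simp [IsPath, ih]; grind

@[simp] theorem weight_nil : G.weight [] = 0 := rfl

@[simp] theorem weight_cons (e : Fin m) (p : List (Fin m)) :
    G.weight (e :: p) = G.wt e + G.weight p := by simp [weight]

@[simp] theorem weight_append (p q : List (Fin m)) :
    G.weight (p ++ q) = G.weight p + G.weight q := by simp [weight]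

@[simp] theorem hops_nil : G.hops [] = 0 := rfl

theorem hops_cons (e : Fin m) (p : List (Fin m)) :
    G.hops (e :: p) = G.hops p + if e ∈ G.neg then 1 else 0 := by simp [hops, List.countP_cons]

@[simp] theorem hops_append (p q : List (Fin m)) : G.hops (p ++ q) = G.hops p + G.hops q := by
  simp [hops]

theorem hopDist_neg_iff {h : ℕ} {u v : Fin n} :
    G.hopDist h u v < 0 ↔ ∃ p, G.IsPath u p v ∧ G.hops p ≤ h ∧ G.weight p < 0 := by
  simp only [hopDist, iInf_lt_iff, exists_prop, and_assoc]
  refine exists_congr fun p => and_congr_right fun _ => and_congr_right fun _ => ?_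
  exact_mod_cast Iff.rfl

/-- The graph with all edges reversed. -/
def rev : HopGraph n m where
  src := G.tgt
  tgt := G.src
  wt := G.wt
  neg := G.neg
  edge_inj e e' h := G.edge_inj (by simpa [and_comm] using h)

theorem isPath_rev {u v : Fin n} {p : List (Fin m)} (h : G.IsPath u p v) :
    G.rev.IsPath v p.reverse u := by
  induction p generalizing u with
  | nil => exact (show u = v from h).symm
  | cons e p ih =>
    rw [List.reverse_cons, isPath_append]
    exact ⟨_, ih h.2, rfl, h.1⟩

theorem hopDist_rev_neg_iff {h : ℕ} {u v : Fin n} :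
    G.rev.hopDist h u v < 0 ↔ G.hopDist h v u < 0 := by
  rw [hopDist_neg_iff, hopDist_neg_iff]
  have hops_rev : ∀ p, G.rev.hops p = G.hops p := fun _ => rfl
  have weight_rev : ∀ p, G.rev.weight p = G.weight p := fun _ => rfl
  have h1 : ∀ p : List (Fin m), G.hops p.reverse = G.hops p := by simp [hops]
  have h2 : ∀ p : List (Fin m), G.weight p.reverse = G.weight p := fun p => by
    simp [weight, List.map_reverse, List.sum_reverse]
  constructor
  · rintro ⟨p, hp, hh, hw⟩
    exact ⟨p.reverse, isPath_rev G.rev hp, by rw [h1, ← hops_rev]; exact hh, by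
      rw [h2, ← weight_rev]; exact hw⟩
  · rintro ⟨p, hp, hh, hw⟩
    exact ⟨p.reverse, isPath_rev G hp, by rw [hops_rev, h1]; exact hh, by
      rw [weight_rev, h2]; exact hw⟩

/-- `d v` is the minimum over `u` of `f u` plus the distance from `u` to `v` along nonnegative
edges. -/
structure IsPotential (f d : Fin n → ℝ) : Prop where
  le : ∀ v, d v ≤ f v
  relaxed : ∀ e, e ∉ G.neg → d (G.tgt e) ≤ d (G.src e) + G.wt e
  attained : ∀ v, ∃ u p, G.IsPath u p v ∧ G.hops p = 0 ∧ d v = f u + G.weight p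

variable {G}

theorem weight_nonneg (hpos : ∀ e, e ∉ G.neg → 0 ≤ G.wt e) {p : List (Fin m)}
    (hp : G.hops p = 0) : 0 ≤ G.weight p := by
  induction p with
  | nil => simp
  | cons e p ih =>
    rw [hops_cons] at hp
    have he : e ∉ G.neg := by intro h; simp [h] at hp
    rw [weight_cons]
    exact add_nonneg (hpos e he) (ih (by omega))

theorem IsPotential.le_add_weight {f d : Fin n → ℝ} (h : G.IsPotential f d) {u v : Fin n}
    {p : List (Fin m)} (hp : G.IsPath u p v) (hh : G.hops p = 0) : d v ≤ d u + G.weight p := by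
  induction p generalizing u with
  | nil => obtain rfl : u = v := hp; simp
  | cons e p ih =>
    rw [hops_cons] at hh
    have he : e ∉ G.neg := by intro h; simp [h] at hh
    have h1 := ih hp.2 (by omega)
    have h2 := h.relaxed e he
    rw [hp.1] at h2
    rw [weight_cons]; linarith

theorem exists_split_of_hops_eq_one {p : List (Fin m)} (hp : G.hops p = 1) :
    ∃ p₁ e p₂, p = p₁ ++ e :: p₂ ∧ e ∈ G.neg ∧ G.hops p₁ = 0 ∧ G.hops p₂ = 0 := by
  induction p with
  | nil => simp at hp
  | cons e p ih =>
    rw [hops_cons] at hp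
    by_cases he : e ∈ G.neg
    · exact ⟨[], e, p, rfl, he, rfl, by simpa [he] using hp⟩
    · obtain ⟨p₁, e', p₂, rfl, h1, h2, h3⟩ := ih (by simpa [he] using hp)
      exact ⟨e :: p₁, e', p₂, rfl, h1, by simp [hops_cons, he, h2], h3⟩

/-- The large finite label `M` replaces infinity off the source set, and the middle labels `z` are
capped at `0`. Neither affects signs: a path without hops has nonnegative weight, so a negative
final label can only come from a source through exactly one negative edge. -/
theorem oneHop_neg_iff (hpos : ∀ e, e ∉ G.neg → 0 ≤ G.wt e) {S : Fin n → Prop} {M : ℝ}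
    {f d₀ z d : Fin n → ℝ} (hM : ∀ e ∈ G.neg, 0 ≤ M + G.wt e)
    (hf : ∀ u, S u → f u = 0) (hf' : ∀ u, ¬ S u → f u = M)
    (h₀ : G.IsPotential f d₀)
    (hz₁ : ∀ e ∈ G.neg, z (G.tgt e) ≤ d₀ (G.src e) + G.wt e)
    (hz₂ : ∀ v, z v = 0 ∨ ∃ e ∈ G.neg, G.tgt e = v ∧ z v = d₀ (G.src e) + G.wt e)
    (h : G.IsPotential z d) (v : Fin n) :
    d v < 0 ↔ ∃ u, S u ∧ G.hopDist 1 u v < 0 := by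
  constructor
  · intro hv
    obtain ⟨u, p, hp, hp0, hd⟩ := h.attained v
    have hw := weight_nonneg hpos hp0
    obtain h0 | ⟨e, he, rfl, hze⟩ := hz₂ u
    · linarith
    obtain ⟨x, p', hp', hp0', hd'⟩ := h₀.attained (G.src e)
    have hw' := weight_nonneg hpos hp0'
    -- From a non-source the path would start with label `M`, and `M + G.wt e ≥ 0` would make the
    -- final label nonnegative.
    have hx : S x := by
      by_contra hx
      have := hM e he
      rw [hf' x hx] at hd'
      linarith
    rw [hf x hx] at hd'
    refine ⟨x, hx, G.hopDist_neg_iff.2 ⟨p' ++ e :: p, ?_, ?_, ?_⟩⟩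
    · rw [isPath_append]; exact ⟨_, hp', rfl, hp⟩
    · simp [hops_cons, he, hp0, hp0']
    · rw [weight_append, weight_cons]; linarith
  · rintro ⟨u, hu, hd⟩
    obtain ⟨p, hp, hh, hw⟩ := G.hopDist_neg_iff.1 hd
    have h1 : G.hops p = 1 := by
      rcases Nat.le_one_iff_eq_zero_or_eq_one.1 hh with h0 | h1
      · linarith [weight_nonneg hpos h0]
      · exact h1
    obtain ⟨p₁, e, p₂, rfl, he, h2, h3⟩ := exists_split_of_hops_eq_one h1
    obtain ⟨x, hx1, rfl, hx2⟩ := (G.isPath_append).1 hp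
    have e1 := h₀.le_add_weight hx1 h2
    have e2 := h.le_add_weight hx2 h3
    have e3 := hz₁ e he
    have e4 := h₀.le u
    have e5 := h.le (G.tgt e)
    rw [hf u hu] at e4
    rw [weight_append, weight_cons] at hw
    linarith

/-- The state of Dijkstra's algorithm: `A` is the set of unfinished vertices, `d` are the labels,
and the edges in `pend` out of the vertex finished last have not yet been relaxed. -/
structure DijkstraInv (G : HopGraph n m) (f d : Fin n → ℝ) (A : Fin n → Prop)
    (pend : List (Fin m)) : Prop where
  le : ∀ v, d v ≤ f v
  attained : ∀ v, ∃ u p, G.IsPath u p v ∧ G.hops p = 0 ∧ d v = f u + G.weight p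
  mono : ∀ x y, ¬ A x → A y → d x ≤ d y
  relaxed : ∀ e, e ∉ G.neg → ¬ A (G.src e) → e ∉ pend → d (G.tgt e) ≤ d (G.src e) + G.wt e
  pend_neg : ∀ e ∈ pend, e ∉ G.neg
  pend_src : ∀ e ∈ pend, ¬ A (G.src e) ∧ ∀ x, ¬ A x → d x ≤ d (G.src e)

theorem DijkstraInv.init (f : Fin n → ℝ) : G.DijkstraInv f f (fun _ => True) [] where
  le _ := le_rfl
  attained v := ⟨v, [], rfl, rfl, by simp⟩
  mono _ _ h := absurd trivial h
  relaxed _ _ h := absurd trivial h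
  pend_neg := by simp
  pend_src := by simp

theorem DijkstraInv.isPotential {f d : Fin n → ℝ} {A : Fin n → Prop}
    (h : G.DijkstraInv f d A []) (hA : ∀ v, ¬ A v) : G.IsPotential f d :=
  ⟨h.le, fun e he => h.relaxed e he (hA _) (by simp), h.attained⟩

/-- The new vertex has the least unfinished label and, by `mono`, the greatest finished one; the
second fact becomes `pend_src` for its outgoing edges. -/
theorem DijkstraInv.extract {f d : Fin n → ℝ} {A A' : Fin n → Prop} {l : List (Fin m)}
    (h : G.DijkstraInv f d A []) {v : Fin n} (hv : A v) (hmin : ∀ y, A y → d v ≤ d y)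
    (hA' : ∀ x, A' x ↔ A x ∧ x ≠ v)
    (hl : ∀ e, e ∈ l ↔ G.src e = v ∧ e ∉ G.neg) : G.DijkstraInv f d A' l where
  le := h.le
  attained := h.attained
  mono x y hx hy := by
    rw [hA'] at hx hy
    by_cases hxv : x = v
    · subst hxv; exact hmin y hy.1
    · exact h.mono x y (fun hx' => hx ⟨hx', hxv⟩) hy.1
  relaxed e he hs hel := by
    rw [hl] at hel
    rw [hA'] at hs
    exact h.relaxed e he (fun hx => hs ⟨hx, fun hx' => hel ⟨hx', he⟩⟩) (by simp)
  pend_neg e he := ((hl e).1 he).2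
  pend_src e he := by
    obtain ⟨rfl, -⟩ := (hl e).1 he
    refine ⟨by simp [hA'], fun x hx => ?_⟩
    by_cases hxv : x = G.src e
    · rw [hxv]
    · exact h.mono _ _ (fun hx' => hx ((hA' x).2 ⟨hx', hxv⟩)) hv

/-- Every candidate label is at least the label of the vertex finished last, which dominates all
finished labels. This needs nonnegative edge weights only, so the initial labels may be negative. -/
theorem DijkstraInv.relax (hpos : ∀ e, e ∉ G.neg → 0 ≤ G.wt e) {f d d' : Fin n → ℝ}
    {A A' : Fin n → Prop} {e : Fin m} {l : List (Fin m)}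
    (h : G.DijkstraInv f d A (e :: l)) (hA : ∀ x, A' x ↔ A x)
    (hd' : ∀ x, x ≠ G.tgt e → d' x = d x)
    (hd'e : d' (G.tgt e) = min (d (G.tgt e)) (d (G.src e) + G.wt e)) :
    G.DijkstraInv f d' A' l := by
  obtain rfl : A' = A := funext fun x => propext (hA x)
  have he := h.pend_neg e (by simp)
  obtain ⟨hs, hsm⟩ := h.pend_src e (by simp)
  have hle : ∀ x, d' x ≤ d x := fun x => by
    by_cases hx : x = G.tgt e
    · subst hx; rw [hd'e]; exact min_le_left _ _
    · rw [hd' x hx]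
  -- An edge into a finished vertex cannot improve its label, so the edges relaxed from it earlier
  -- stay relaxed.
  have hfin : ∀ x, ¬ A' x → d' x = d x := fun x hx => by
    by_cases hx' : x = G.tgt e
    · subst hx'
      rw [hd'e, min_eq_left]
      linarith [hsm _ hx, hpos e he]
    · exact hd' x hx'
  have hge : ∀ x, min (d x) (d (G.src e)) ≤ d' x := fun x => by
    by_cases hx : x = G.tgt e
    · subst hx; rw [hd'e]
      exact min_le_min le_rfl (by linarith [hpos e he])
    · rw [hd' x hx]; exact min_le_left _ _
  constructor
  · exact fun v => (hle v).trans (h.le v)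
  · intro v
    by_cases hv : v = G.tgt e
    · subst hv
      rw [hd'e]
      rcases min_choice (d (G.tgt e)) (d (G.src e) + G.wt e) with hm | hm
      · rw [hm]; exact h.attained _
      · rw [hm]
        obtain ⟨u, p, hp, hp0, hd⟩ := h.attained (G.src e)
        refine ⟨u, p ++ [e], ?_, ?_, ?_⟩
        · rw [isPath_append]; exact ⟨_, hp, rfl, rfl⟩
        · simp [hops_cons, hp0, he]
        · simp [hd]; ring
    · rw [hd' v hv]; exact h.attained v
  · intro x y hx hy
    rw [hfin x hx]
    exact le_trans (le_min (h.mono x y hx hy) (hsm x hx)) (hge y)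
  · intro e' he' hs' hl
    rw [hfin _ hs']
    by_cases hee : e' = e
    · subst hee; rw [hd'e]; exact min_le_right _ _
    · exact (hle _).trans (h.relaxed e' he' hs' (by simp [hee, hl]))
  · exact fun e' he' => h.pend_neg e' (by simp [he'])
  · intro e' he'
    obtain ⟨h1, h2⟩ := h.pend_src e' (by simp [he'])
    refine ⟨h1, fun x hx => ?_⟩
    rw [hfin x hx, hfin _ h1]; exact h2 x hx

end HopGraph

/-! ## Random representatives of blocks -/

section Counting

variable {ι β : Type*} [Fintype ι] [DecidableEq ι] [Fintype β]

/-- One coordinate of a uniform random function is uniform; stated without division. -/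
theorem card_mul_sum_apply (i : ι) (h : β → ℕ) :
    Fintype.card β * ∑ R : ι → β, h (R i) = Fintype.card β ^ Fintype.card ι * ∑ a, h a := by
  classical
  have e1 : ∑ R : ι → β, h (R i) = ∑ p : β × ({j // j ≠ i} → β), h p.1 :=
    Fintype.sum_equiv (Equiv.funSplitAt i β) _ _ fun R => rfl
  have hc : Fintype.card {j // j ≠ i} + 1 = Fintype.card ι := by
    rw [Fintype.card_subtype_compl, Fintype.card_subtype_eq]
    have : 0 < Fintype.card ι := Fintype.card_pos_iff.2 ⟨i⟩
    omega
  rw [e1, Fintype.sum_prod_type]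
  simp only [Finset.sum_const, Finset.card_univ, smul_eq_mul, ← Finset.mul_sum, Fintype.card_fun]
  rw [← mul_assoc, ← pow_succ', hc]

/-- Two distinct coordinates of a uniform random function are independent and uniform. -/
theorem card_sq_mul_sum_apply {i j : ι} (hij : j ≠ i) (h : β → β → ℕ) :
    Fintype.card β ^ 2 * ∑ R : ι → β, h (R i) (R j) =
      Fintype.card β ^ Fintype.card ι * ∑ a, ∑ b, h a b := by
  classical
  have e1 : ∑ R : ι → β, h (R i) (R j) =
      ∑ p : β × ({j // j ≠ i} → β), h p.1 (p.2 ⟨j, hij⟩) :=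
    Fintype.sum_equiv (Equiv.funSplitAt i β) _ _ fun R => rfl
  have hc : Fintype.card {j // j ≠ i} + 1 = Fintype.card ι := by
    rw [Fintype.card_subtype_compl, Fintype.card_subtype_eq]
    have : 0 < Fintype.card ι := Fintype.card_pos_iff.2 ⟨i⟩
    omega
  rw [e1, Fintype.sum_prod_type, sq, mul_assoc, Finset.mul_sum]
  simp only [card_mul_sum_apply]
  rw [← Finset.mul_sum, ← mul_assoc, ← pow_succ', hc]

end Counting

section Sampling

-- First-moment argument. `N R` counts the sampled good vertices plus the ordered pairs of distinct
-- blocks whose first representative spoils a non-good second one. Each part has mean at most `ρ/8`,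
-- and every sampled vertex that is not kept contributes to `N R`.
open Classical in
theorem two_mul_card_bad_samples_le {k ρ q : ℕ} (hρ : 0 < ρ) (hq : 0 < q) (hk : k ≤ 2 * (ρ * q))
    {x : Fin ρ → Fin q → Fin k} (hx : ∀ i a j b, x i a = x j b → i = j ∧ a = b)
    (A : Fin k → Fin k → Prop) (good : Fin k → Prop)
    (hgood : ∀ y, ¬ good y → ¬ A y y ∧ 16 * ρ * (Finset.univ.filter fun u => A u y).card ≤ k)
    (hfew : 16 * (Finset.univ.filter good).card ≤ k) :
    2 * (Finset.univ.filter fun R : Fin ρ → Fin q => 2 * (Finset.univ.filter fun i =>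
      ∀ j, ¬ A (x j (R j)) (x i (R i))).card < ρ).card ≤ q ^ ρ := by
  set g : Fin k → ℕ := fun y => if good y then 1 else 0 with hg
  set B : Fin k → Fin k → ℕ := fun u y => if ¬ good y ∧ A u y then 1 else 0 with hB
  set N : (Fin ρ → Fin q) → ℕ := fun R =>
    ∑ i, (g (x i (R i)) + ∑ j ∈ Finset.univ.erase i, B (x j (R j)) (x i (R i))) with hN
  have hsumN : ∑ R, N R = ∑ i, ∑ R : Fin ρ → Fin q, g (x i (R i)) +
      ∑ i, ∑ j ∈ Finset.univ.erase i, ∑ R : Fin ρ → Fin q, B (x j (R j)) (x i (R i)) := by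
    simp only [hN]
    rw [Finset.sum_comm, ← Finset.sum_add_distrib]
    refine Finset.sum_congr rfl fun i _ => ?_
    rw [Finset.sum_add_distrib]
    congr 1
    exact Finset.sum_comm
  have hxsum : ∀ F : Fin k → ℕ, ∑ i, ∑ a, F (x i a) ≤ ∑ y, F y := fun F => by
    rw [← Fintype.sum_prod_type' fun i a => F (x i a)]
    have hinj : Function.Injective fun p : Fin ρ × Fin q => x p.1 p.2 := fun p p' h =>
      Prod.ext (hx _ _ _ _ h).1 (hx _ _ _ _ h).2
    rw [← Finset.sum_image (f := F) (g := fun p : Fin ρ × Fin q => x p.1 p.2)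
      (fun a _ b _ h => hinj h)]
    exact Finset.sum_le_sum_of_subset (Finset.subset_univ _)
  have h1 : 16 * (q * ∑ i, ∑ R : Fin ρ → Fin q, g (x i (R i))) ≤ q ^ ρ * k := by
    have : ∀ i, q * ∑ R : Fin ρ → Fin q, g (x i (R i)) = q ^ ρ * ∑ a, g (x i a) := fun i => by
      simpa using card_mul_sum_apply i fun a => g (x i a)
    rw [Finset.mul_sum, Finset.sum_congr rfl fun i _ => this i, ← Finset.mul_sum]
    have h2 := hxsum g
    have h3 : ∑ y, g y = (Finset.univ.filter good).card := by simp [hg]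
    calc _ = q ^ ρ * (16 * ∑ i, ∑ a, g (x i a)) := by ring
      _ ≤ q ^ ρ * k := by gcongr; omega
  have h2 : 16 * (q * ∑ i, ∑ j ∈ Finset.univ.erase i, ∑ R : Fin ρ → Fin q,
      B (x j (R j)) (x i (R i))) ≤ q ^ ρ * k := by
    have e : ∀ i, ∀ j ∈ Finset.univ.erase i, q ^ 2 * ∑ R : Fin ρ → Fin q,
        B (x j (R j)) (x i (R i)) = q ^ ρ * ∑ a, ∑ b, B (x j b) (x i a) := fun i j hj => by
      simpa using card_sq_mul_sum_apply (Finset.ne_of_mem_erase hj) fun a b => B (x j b) (x i a)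
    have e2 : q ^ 2 * ∑ i, ∑ j ∈ Finset.univ.erase i, ∑ R : Fin ρ → Fin q,
        B (x j (R j)) (x i (R i)) ≤ q ^ ρ * ∑ i : Fin ρ, ∑ a : Fin q, ∑ u, B u (x i a) := by
      rw [Finset.mul_sum, Finset.mul_sum]
      refine Finset.sum_le_sum fun i _ => ?_
      rw [Finset.mul_sum, Finset.sum_congr rfl (e i), ← Finset.mul_sum, Finset.sum_comm]
      gcongr with a
      refine le_trans ?_ (hxsum fun u => B u (x i a))
      exact Finset.sum_le_sum_of_subset (Finset.subset_univ _)
    have e3 : ∀ y, 16 * ρ * ∑ u, B u y ≤ k := fun y => by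
      by_cases hy : good y
      · simp [hB, hy]
      · have : ∑ u, B u y = (Finset.univ.filter fun u => A u y).card := by simp [hB, hy]
        rw [this]; exact (hgood y hy).2
    have e4 : 16 * ρ * ∑ i : Fin ρ, ∑ a : Fin q, ∑ u, B u (x i a) ≤ ρ * q * k := by
      rw [Finset.mul_sum]
      calc _ ≤ ∑ i : Fin ρ, ∑ a : Fin q, k := by
            refine Finset.sum_le_sum fun i _ => ?_
            rw [Finset.mul_sum]
            exact Finset.sum_le_sum fun a _ => e3 _
        _ = ρ * q * k := by simp [mul_assoc]
    refine Nat.le_of_mul_le_mul_left ?_ (Nat.mul_pos hρ hq)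
    calc _ = 16 * ρ * (q ^ 2 * ∑ i, ∑ j ∈ Finset.univ.erase i, ∑ R : Fin ρ → Fin q,
            B (x j (R j)) (x i (R i))) := by ring
      _ ≤ 16 * ρ * (q ^ ρ * ∑ i : Fin ρ, ∑ a : Fin q, ∑ u, B u (x i a)) := by gcongr
      _ = q ^ ρ * (16 * ρ * ∑ i : Fin ρ, ∑ a : Fin q, ∑ u, B u (x i a)) := by ring
      _ ≤ q ^ ρ * (ρ * q * k) := by gcongr
      _ = _ := by ring
  have h3 : 4 * ∑ R, N R ≤ q ^ ρ * ρ := by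
    refine Nat.le_of_mul_le_mul_left ?_ (show 0 < 4 * q by omega)
    calc 4 * q * (4 * ∑ R, N R) ≤ 2 * (q ^ ρ * k) := by rw [hsumN]; linarith
      _ ≤ 2 * (q ^ ρ * (2 * (ρ * q))) := by gcongr
      _ = _ := by ring
  have h4 : ∀ R : Fin ρ → Fin q, ρ ≤ (Finset.univ.filter fun i =>
      ∀ j, ¬ A (x j (R j)) (x i (R i))).card + N R := fun R => by
    have : ∀ i, 1 ≤ (if ∀ j, ¬ A (x j (R j)) (x i (R i)) then 1 else 0) +
        (g (x i (R i)) + ∑ j ∈ Finset.univ.erase i, B (x j (R j)) (x i (R i))) := fun i => by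
      by_cases hi : ∀ j, ¬ A (x j (R j)) (x i (R i))
      · simp [hi]
      · by_cases hgi : good (x i (R i))
        · have : g (x i (R i)) = 1 := by simp [hg, hgi]
          omega
        · push Not at hi
          obtain ⟨j, hj⟩ := hi
          -- A non-good vertex is not related to itself, so only pairs from distinct blocks, whose
          -- coordinates are independent, have to be counted.
          have hji : j ≠ i := by rintro rfl; exact (hgood _ hgi).1 hj
          have : B (x j (R j)) (x i (R i)) ≤
              ∑ j ∈ Finset.univ.erase i, B (x j (R j)) (x i (R i)) :=
            Finset.single_le_sum (f := fun j => B (x j (R j)) (x i (R i)))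
              (fun _ _ => Nat.zero_le _) (by simp [hji])
          have h1 : B (x j (R j)) (x i (R i)) = 1 := by simp [hB, hgi, hj]
          omega
    calc ρ = ∑ i : Fin ρ, 1 := by simp
      _ ≤ _ := Finset.sum_le_sum fun i _ => this i
      _ = _ := by rw [Finset.sum_add_distrib]; simp [hN]
  set F := Finset.univ.filter fun R : Fin ρ → Fin q => 2 * (Finset.univ.filter fun i =>
      ∀ j, ¬ A (x j (R j)) (x i (R i))).card < ρ with hF
  -- Markov's inequality: on `F` fewer than `ρ/2` representatives are kept, hence `N R` exceeds
  -- `ρ/2`.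
  have h5 : ρ * F.card ≤ 2 * ∑ R, N R := by
    calc ρ * F.card = ∑ R ∈ F, ρ := by simp [mul_comm]
      _ ≤ ∑ R ∈ F, 2 * N R := Finset.sum_le_sum fun R hR => by
          have := h4 R
          rw [hF, Finset.mem_filter] at hR
          omega
      _ ≤ ∑ R, 2 * N R := Finset.sum_le_sum_of_subset (Finset.subset_univ _)
      _ = _ := by rw [Finset.mul_sum]
  refine Nat.le_of_mul_le_mul_left ?_ hρ
  linarith

-- Pivot and sample are independent, so the failures form a product set. Either the pivot factor is
-- at most `15/16`, or good pivots are rare and the sample factor is at most `1/2`.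
open Classical in
theorem sixteen_mul_card_failures_le {k ρ q : ℕ} (hρ : 0 < ρ) (hq : 0 < q)
    (hk : k ≤ 2 * (ρ * q))
    {x : Fin ρ → Fin q → Fin k} (hx : ∀ i a j b, x i a = x j b → i = j ∧ a = b)
    (A : Fin k → Fin k → Prop) (good : Fin k → Prop)
    (hgood : ∀ y, ¬ good y → ¬ A y y ∧ 16 * ρ * (Finset.univ.filter fun u => A u y).card ≤ k) :
    16 * (Finset.univ.filter fun p : Fin k × (Fin ρ → Fin q) => ¬ good p.1 ∧
      2 * (Finset.univ.filter fun i => ∀ j, ¬ A (x j (p.2 j)) (x i (p.2 i))).card < ρ).card ≤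
      15 * (k * q ^ ρ) := by
  have hprod : (Finset.univ.filter fun p : Fin k × (Fin ρ → Fin q) => ¬ good p.1 ∧
      2 * (Finset.univ.filter fun i => ∀ j, ¬ A (x j (p.2 j)) (x i (p.2 i))).card < ρ).card =
      (Finset.univ.filter fun y => ¬ good y).card * (Finset.univ.filter fun R : Fin ρ → Fin q =>
        2 * (Finset.univ.filter fun i => ∀ j, ¬ A (x j (R j)) (x i (R i))).card < ρ).card := by
    rw [← Finset.card_product]
    congr 1
    ext p
    simp
  rw [hprod]
  have hsplit := Finset.card_filter_add_card_filter_not (s := Finset.univ) good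
  rw [Finset.card_univ, Fintype.card_fin] at hsplit
  by_cases hfew : 16 * (Finset.univ.filter good).card ≤ k
  · have h1 := two_mul_card_bad_samples_le hρ hq hk hx A good hgood hfew
    have h2 : (Finset.univ.filter fun y => ¬ good y).card ≤ k := by omega
    have := Nat.mul_le_mul h2 h1
    nlinarith [Nat.zero_le (k * q ^ ρ)]
  · have h1 : (Finset.univ.filter fun R : Fin ρ → Fin q =>
        2 * (Finset.univ.filter fun i => ∀ j, ¬ A (x j (R j)) (x i (R i))).card < ρ).card ≤
        q ^ ρ := by
      refine (Finset.card_le_univ _).trans ?_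
      simp
    have h2 : 16 * (Finset.univ.filter fun y => ¬ good y).card ≤ 15 * k := by omega
    have := Nat.mul_le_mul h2 h1
    linarith

end Sampling

/-! ## Tournament trees -/

/-- Node `i` of a tournament tree holds the better one of the entries of its children; the entry
`W = 0` stands for an absent competitor. -/
def IsWinner (W : ℕ → ℕ) (K : ℕ → ℝ) (i : ℕ) : Prop :=
  if W (2 * i) ≠ 0 ∧ ¬ (W (2 * i + 1) ≠ 0 ∧ K (2 * i + 1) < K (2 * i)) then
    W i = W (2 * i) ∧ K i = K (2 * i)
  else W i = W (2 * i + 1) ∧ K i = K (2 * i + 1)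

/-- The entry `j` takes part only in the conditions at `j` itself and at its parent `j / 2`. -/
theorem IsWinner.congr {W W' : ℕ → ℕ} {K K' : ℕ → ℝ} {i j : ℕ} (h : IsWinner W K i)
    (hW : ∀ i ≠ j, W' i = W i) (hK : ∀ i ≠ j, K' i = K i) (h₁ : i ≠ j) (h₂ : i ≠ j / 2) :
    IsWinner W' K' i := by
  unfold IsWinner at *
  rw [hW i h₁, hK i h₁, hW (2 * i) (by omega), hK (2 * i) (by omega), hW (2 * i + 1) (by omega),
    hK (2 * i + 1) (by omega)]
  exact h

/-- Climb from `i` to the root. Nodes `1, …, n - 1` are inner and `n, …, 2n - 1` are leaves; the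
layout works for every `n`, not just powers of two. -/
theorem root_le_of_isWinner {W : ℕ → ℕ} {K : ℕ → ℝ} {n : ℕ}
    (h : ∀ i, 1 ≤ i → i < n → IsWinner W K i) (i : ℕ) (h1 : 1 ≤ i) (h2 : i < 2 * n)
    (hi : W i ≠ 0) : W 1 ≠ 0 ∧ K 1 ≤ K i := by
  induction i using Nat.strong_induction_on with
  | _ i ih =>
    obtain rfl | h1' : i = 1 ∨ 1 < i := by omega
    · exact ⟨hi, le_rfl⟩
    · have hp := h (i / 2) (by omega) (by omega)
      have key : W (i / 2) ≠ 0 ∧ K (i / 2) ≤ K i := by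
        unfold IsWinner at hp
        obtain e | e : i = 2 * (i / 2) ∨ i = 2 * (i / 2) + 1 := by omega
        · rw [← e] at hp
          split_ifs at hp with hc
          · exact ⟨hp.1 ▸ hi, hp.2.le⟩
          · have : W (i + 1) ≠ 0 ∧ K (i + 1) < K i := by tauto
            exact ⟨hp.1 ▸ this.1, hp.2 ▸ this.2.le⟩
        · rw [← e] at hp
          split_ifs at hp with hc
          · have : ¬ K i < K (2 * (i / 2)) := by tauto
            exact ⟨hp.1 ▸ hc.1, hp.2 ▸ not_lt.1 this⟩
          · exact ⟨hp.1 ▸ hi, hp.2.le⟩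
      obtain ⟨h3, h4⟩ := ih (i / 2) (by omega) (by omega) (by omega) key.1
      exact ⟨h3, h4.trans key.2⟩

/-- Descend from `i`, following the child that was copied upwards. -/
theorem exists_leaf_of_isWinner {W : ℕ → ℕ} {K : ℕ → ℝ} {n : ℕ}
    (h : ∀ i, 1 ≤ i → i < n → IsWinner W K i) (i : ℕ) (h1 : 1 ≤ i) (h2 : i < 2 * n) :
    ∃ v < n, W (n + v) = W i ∧ K (n + v) = K i := by
  obtain ⟨d, hd⟩ : ∃ d, d = 2 * n - i := ⟨_, rfl⟩
  induction d using Nat.strong_induction_on generalizing i with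
  | _ d ih =>
    by_cases hi : n ≤ i
    · exact ⟨i - n, by omega, by rw [Nat.add_sub_cancel' hi], by rw [Nat.add_sub_cancel' hi]⟩
    · have hp := h i h1 (by omega)
      unfold IsWinner at hp
      split_ifs at hp with hc
      · rw [hp.1, hp.2]
        exact ih _ (by omega) (2 * i) (by omega) (by omega) rfl
      · rw [hp.1, hp.2]
        exact ih _ (by omega) (2 * i + 1) (by omega) (by omega) rfl

namespace RealRAM

/-- Recompute the node `j` (word array `16`) of the tournament tree with winners in word array `12`
and keys in real array `1`. -/
def pull : Prog :=
  .cond (.and (.not (.weq (.get 12 (.mul (.const 2) (.var 16))) (.const 0)))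
      (.not (.and (.not (.weq (.get 12 (.add (.mul (.const 2) (.var 16)) (.const 1))) (.const 0)))
        (.rlt (.get 1 (.add (.mul (.const 2) (.var 16)) (.const 1)))
          (.get 1 (.mul (.const 2) (.var 16)))))))
    (.seq (.wset 12 (.var 16) (.get 12 (.mul (.const 2) (.var 16))))
      (.rset 1 (.var 16) (.get 1 (.mul (.const 2) (.var 16)))))
    (.seq (.wset 12 (.var 16) (.get 12 (.add (.mul (.const 2) (.var 16)) (.const 1))))
      (.rset 1 (.var 16) (.get 1 (.add (.mul (.const 2) (.var 16)) (.const 1)))))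

theorem ends_pull {b j : ℕ} {s : Store} (hs : s.Bounded b) (hj : s.words 16 0 = j) (hj0 : 1 ≤ j)
    (hb : 2 * j + 2 < 2 ^ b) :
    Ends b pull s 4 fun s' => IsWinner (s'.words 12) (s'.reals 1) j ∧
      (∀ i ≠ j, s'.words 12 i = s.words 12 i) ∧ ∀ i ≠ j, s'.reals 1 i = s.reals 1 i := by
  have hm : ∀ a i, s.words a i % 2 ^ b = s.words a i := fun a i => Nat.mod_eq_of_lt (hs a i)
  refine Ends.straight rfl le_rfl ?_
  simp (disch := omega) [pull, Prog.effect, BExp.Holds, WExp.eval, RExp.eval, hm, hj,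
    Nat.mod_eq_of_lt]
  split_ifs with hc
  all_goals simp only [Store.setReal_words, Store.setWord_words, Store.setWord_reals,
    Store.setReal_reals, if_true]
  all_goals
    refine ⟨?_, fun i hi => Function.update_of_ne hi _ _, fun i hi => Function.update_of_ne hi _ _⟩
    simp (disch := omega) only [IsWinner, Function.update_of_ne, Function.update_self]
  · rw [if_pos (by simpa using hc)]; simp
  · rw [if_neg (by simpa using hc)]; simp

/-- Recompute the nodes on the path from the node `j` (exclusive) to the root. -/
def fixPath : Prog :=
  .loop (.wlt (.const 1) (.var 16))
    (.seq (.wset 16 (.const 0) (.div (.var 16) (.const 2))) pull)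

/-- At any time at most one inner node, the parent of the current node, violates the winner
condition; repairing it moves the possible violation one level up. -/
theorem ends_fixPath {b n : ℕ} {s₀ : Store} (hs : s₀.Bounded b) (hj0 : 1 ≤ s₀.words 16 0)
    (hjn : s₀.words 16 0 < 2 * n) (hb : 2 * n + 2 < 2 ^ b)
    (hw : ∀ i, 1 ≤ i → i < n → i ≠ s₀.words 16 0 / 2 →
      IsWinner (s₀.words 12) (s₀.reals 1) i) :
    Ends b fixPath s₀ (7 * (Nat.log 2 n + 1) + 1) fun s' =>
      (∀ i, 1 ≤ i → i < n → IsWinner (s'.words 12) (s'.reals 1) i) ∧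
      (∀ i, n ≤ i → s'.words 12 i = s₀.words 12 i) ∧
      ∀ i, n ≤ i → s'.reals 1 i = s₀.reals 1 i := by
  have key := Ends.loop (b := b) (c := .wlt (.const 1) (.var 16))
    (p := .seq (.wset 16 (.const 0) (.div (.var 16) (.const 2))) pull) (s₀ := s₀)
    (fun s => 1 ≤ s.words 16 0 ∧ s.words 16 0 < 2 * n ∧
      (∀ i, 1 ≤ i → i < n → i ≠ s.words 16 0 / 2 → IsWinner (s.words 12) (s.reals 1) i) ∧
      (∀ i, n ≤ i → s.words 12 i = s₀.words 12 i) ∧ ∀ i, n ≤ i → s.reals 1 i = s₀.reals 1 i)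
    (fun s => 7 * Nat.log 2 (s.words 16 0)) ?_ ⟨hj0, hjn, hw, fun _ _ => rfl, fun _ _ => rfl⟩
  · refine (key.le ?_).imp fun s' hf h => ?_
    · have h1 : Nat.log 2 (s₀.words 16 0) ≤ Nat.log 2 (n * 2) := Nat.log_mono_right (by omega)
      rw [Nat.log_mul_base (by norm_num) (by omega)] at h1
      omega
    · obtain ⟨⟨h1, h2, h3, h4⟩, h5⟩ := h
      have hm := hf.bounded hs 16 0
      refine ⟨fun i hi hin => h3 i hi hin ?_, h4⟩
      simp (disch := omega) [BExp.Holds, WExp.eval, Nat.mod_eq_of_lt] at h5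
      omega
  · rintro s hf ⟨h1, h2, h3, h4, h5⟩ hc
    have hsb := hf.bounded hs
    obtain ⟨j, hj⟩ : ∃ j, s.words 16 0 = j := ⟨_, rfl⟩
    rw [hj] at h1 h2 h3
    simp (disch := omega) [BExp.Holds, WExp.eval, Nat.mod_eq_of_lt, hj] at hc
    refine ⟨6, Ends.seq (T₁ := 1) (T₂ := 4) (Ends.straight rfl le_rfl ?_)⟩
    simp (disch := omega) only [Prog.effect, WExp.eval, hj, Nat.mod_eq_of_lt]
    refine (ends_pull (j := j / 2) (hsb.setWord _ _ (by omega)) (by simp) (by omega)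
      (by omega)).imp fun s' hf' h => ?_
    obtain ⟨e1, e2, e3⟩ := h
    simp only [Store.setWord_words, Store.setWord_reals] at e2 e3
    simp only [show (12 = 16) = False by simp, if_false] at e2
    have hj' : s'.words 16 0 = j / 2 := by
      rw [hf'.words 16 (by decide)]; simp
    rw [hj']
    refine ⟨⟨by omega, by omega, fun i hi hin hne => ?_, fun i hi => ?_, fun i hi => ?_⟩, ?_⟩
    · by_cases hij : i = j / 2
      · rw [hij]; exact e1
      · exact (h3 i hi hin hij).congr e2 e3 hij hne
    · rw [e2 i (by omega), h4 i hi]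
    · rw [e3 i (by omega), h5 i hi]
    · rw [Nat.log_of_one_lt_of_le (n := j) (by norm_num) (by omega)]
      omega

/-- Recompute all inner nodes. -/
def heapify : Prog :=
  .seq (.wset 16 (.const 0) (.get 0 (.const 0)))
    (.loop (.wlt (.const 1) (.var 16))
      (.seq (.wset 16 (.const 0) (.sub (.var 16) (.const 1))) pull))

/-- Nodes are repaired in decreasing order, so children are final before their parent is computed.
-/
theorem ends_heapify {b n : ℕ} {s₀ : Store} (hs : s₀.Bounded b) (hn : s₀.words 0 0 = n)
    (hb : 2 * n + 2 < 2 ^ b) :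
    Ends b heapify s₀ (7 * n + 3) fun s' =>
      (∀ i, 1 ≤ i → i < n → IsWinner (s'.words 12) (s'.reals 1) i) ∧
      (∀ i, n ≤ i → s'.words 12 i = s₀.words 12 i) ∧
      ∀ i, n ≤ i → s'.reals 1 i = s₀.reals 1 i := by
  refine (Ends.seq (T₁ := 1) (T₂ := 7 * n + 1) (Ends.straight rfl le_rfl ?_)).le (by omega)
  simp (disch := omega) only [Prog.effect, WExp.eval, hn, Nat.mod_eq_of_lt]
  set s₁ := s₀.setWord 16 0 n with hs₁
  have hs₁b : s₁.Bounded b := hs.setWord _ _ (by omega)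
  have key := Ends.loop (b := b) (c := .wlt (.const 1) (.var 16))
    (p := .seq (.wset 16 (.const 0) (.sub (.var 16) (.const 1))) pull) (s₀ := s₁)
    (fun s => s.words 16 0 ≤ n ∧
      (∀ i, 1 ≤ i → i < n → s.words 16 0 ≤ i → IsWinner (s.words 12) (s.reals 1) i) ∧
      (∀ i, n ≤ i → s.words 12 i = s₀.words 12 i) ∧ ∀ i, n ≤ i → s.reals 1 i = s₀.reals 1 i)
    (fun s => 7 * s.words 16 0) ?_ ?_
  · refine (key.le ?_).imp fun s' hf h => ?_
    · simp [hs₁]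
    · obtain ⟨⟨h1, h2, h3⟩, h5⟩ := h
      have hm := hf.bounded hs₁b 16 0
      refine ⟨fun i hi hin => h2 i hi hin ?_, h3⟩
      simp (disch := omega) [BExp.Holds, WExp.eval, Nat.mod_eq_of_lt] at h5
      omega
  · rintro s hf ⟨h1, h3, h4, h5⟩ hc
    have hsb := hf.bounded hs₁b
    obtain ⟨j, hj⟩ : ∃ j, s.words 16 0 = j := ⟨_, rfl⟩
    rw [hj] at h1 h3
    simp (disch := omega) [BExp.Holds, WExp.eval, Nat.mod_eq_of_lt, hj] at hc
    refine ⟨6, Ends.seq (T₁ := 1) (T₂ := 4) (Ends.straight rfl le_rfl ?_)⟩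
    simp (disch := omega) only [Prog.effect, WExp.eval, hj, Nat.mod_eq_of_lt]
    refine (ends_pull (j := j - 1) (hsb.setWord _ _ (by omega)) (by simp) (by omega)
      (by omega)).imp fun s' hf' h => ?_
    obtain ⟨e1, e2, e3⟩ := h
    simp only [Store.setWord_words, Store.setWord_reals] at e2 e3
    simp only [show (12 = 16) = False by simp, if_false] at e2
    have hj' : s'.words 16 0 = j - 1 := by
      rw [hf'.words 16 (by decide)]; simp
    rw [hj']
    refine ⟨⟨by omega, fun i hi hin hne => ?_, fun i hi => ?_, fun i hi => ?_⟩, ?_⟩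
    · by_cases hij : i = j - 1
      · rw [hij]; exact e1
      · exact (h3 i hi hin (by omega)).congr e2 e3 hij (by omega)
    · rw [e2 i (by omega), h4 i hi]
    · rw [e3 i (by omega), h5 i hi]
    · omega
  · simp [hs₁]
    omega

end RealRAM

/-! ## Dijkstra's algorithm -/

/-- The list `l` is stored as a linked list with head `h` and successor function `nx`; the item `e`
is referred to as `e + 1`, and `0` ends the list. -/
def IsLinkedList {m : ℕ} (nx : ℕ → ℕ) : ℕ → List (Fin m) → Prop
  | h, [] => h = 0
  | h, e :: l => h = e + 1 ∧ IsLinkedList nx (nx e) l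

theorem IsLinkedList.congr {m : ℕ} {nx nx' : ℕ → ℕ} {h : ℕ} {l : List (Fin m)}
    (hl : IsLinkedList nx h l) (hnx : ∀ e ∈ l, nx' e = nx e) : IsLinkedList nx' h l := by
  induction l generalizing h with
  | nil => exact hl
  | cons e l ih =>
    refine ⟨hl.1, ?_⟩
    rw [hnx e (by simp)]
    exact ih hl.2 fun e' he' => hnx e' (by simp [he'])

namespace RealRAM

/-- The graph is stored with the tails and heads of its edges in the word arrays `10`, `11`. -/
structure GraphIn {n m : ℕ} (G : HopGraph n m) (s : Store) : Prop where
  n_eq : s.words 0 0 = n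
  m_eq : s.words 0 1 = m
  src : ∀ e : Fin m, s.words 10 e = G.src e
  tgt : ∀ e : Fin m, s.words 11 e = G.tgt e
  neg : ∀ e : Fin m, s.words 3 e = if e ∈ G.neg then 1 else 0
  wt : ∀ e : Fin m, s.reals 0 e = G.wt e

theorem GraphIn.of_frame {n m : ℕ} {G : HopGraph n m} {b : ℕ} {p : Prog} {s s' : Store}
    (h : GraphIn G s) (hf : p.Frame b s s') (hw : ∀ a ∈ [0, 3, 10, 11], a ∉ p.wmods)
    (hr : 0 ∉ p.rmods) : GraphIn G s' := by
  have h0 := hf.words 0 (hw 0 (by simp))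
  have h3 := hf.words 3 (hw 3 (by simp))
  have h10 := hf.words 10 (hw 10 (by simp))
  have h11 := hf.words 11 (hw 11 (by simp))
  have hr0 := hf.reals 0 hr
  constructor
  · rw [h0, h.n_eq]
  · rw [h0, h.m_eq]
  · intro e; rw [h10, h.src]
  · intro e; rw [h11, h.tgt]
  · intro e; rw [h3, h.neg]
  · intro e; rw [hr0, h.wt]

/-- Adjacency lists of the nonnegative edges, with heads `hd` and successors `nx`. -/
def AdjLists {n m : ℕ} (G : HopGraph n m) (hd nx : ℕ → ℕ) (k : ℕ) : Prop :=
  ∀ v : Fin n, ∃ l : List (Fin m), IsLinkedList nx (hd v) l ∧ l.Nodup ∧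
    ∀ e, e ∈ l ↔ (e : ℕ) < k ∧ G.src e = v ∧ e ∉ G.neg

/-- Build the adjacency lists, with heads in word array `8` and successors in word array `9`. -/
def buildAdj : Prog :=
  .forLoop 13 0 1 (.cond (.weq (.get 3 (.var 13)) (.const 0))
    (.seq (.wset 9 (.var 13) (.get 8 (.get 10 (.var 13))))
      (.wset 8 (.get 10 (.var 13)) (.add (.var 13) (.const 1)))) .skip)

/-- Edge `i` is pushed at the front of the list of its tail. Its successor cell belongs to no
earlier list, so the existing lists are undisturbed. -/
theorem ends_buildAdj {n m b : ℕ} {G : HopGraph n m} {s₀ : Store} (hs : s₀.Bounded b)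
    (hG : GraphIn G s₀) (hb : 4 * (n + m) + 16 < 2 ^ b) (hhd : ∀ v : Fin n, s₀.words 8 v = 0) :
    Ends b buildAdj s₀ (8 * m + 3) fun s' => AdjLists G (s'.words 8) (s'.words 9) m := by
  refine Ends.forLoop (T := 4) (N := m) (fun i s => AdjLists G (s.words 8) (s.words 9) i)
    (by decide) (by decide) (by omega) hG.m_eq (by omega) ?_ ?_
  · exact fun v => ⟨[], by simpa [IsLinkedList] using hhd v, by simp, by simp⟩
  · intro i s hi hf h13 hI
    have hsb := hf.bounded hs
    have hG' : GraphIn G s := hG.of_frame hf (by decide) (by decide)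
    have hm : ∀ a i, s.words a i % 2 ^ b = s.words a i := fun a i => Nat.mod_eq_of_lt (hsb a i)
    have hsrc := hG'.src ⟨i, hi⟩
    have hneg := hG'.neg ⟨i, hi⟩
    simp only at hsrc hneg
    have hb0 : b ≠ 0 := by rintro rfl; omega
    refine Ends.straight rfl le_rfl ?_
    by_cases he : (⟨i, hi⟩ : Fin m) ∈ G.neg
    · simp (disch := omega) [Prog.effect, BExp.Holds, WExp.eval, hm, h13, Nat.mod_eq_of_lt, hsrc,
        hneg, hb0, he]
      intro v
      obtain ⟨l, h1, h2, h3⟩ := hI v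
      refine ⟨l, by simpa using h1, h2, fun e => ?_⟩
      rw [h3]
      constructor
      · exact fun h => ⟨by omega, h.2⟩
      · rintro ⟨h4, h5, h6⟩
        refine ⟨?_, h5, h6⟩
        by_contra h7
        exact h6 (by rwa [show e = ⟨i, hi⟩ from Fin.ext (by simp; omega)])
    · simp (disch := omega) [Prog.effect, BExp.Holds, WExp.eval, hm, h13, Nat.mod_eq_of_lt, hsrc,
        hneg, hb0, he]
      intro v
      obtain ⟨l, h1, h2, h3⟩ := hI v
      have h1' : IsLinkedList (Function.update (s.words 9) i (s.words 8 (G.src ⟨i, hi⟩)))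
          (s.words 8 v) l :=
        h1.congr fun e he => Function.update_of_ne (((h3 e).1 he).1.ne) _ _
      by_cases hv : G.src ⟨i, hi⟩ = v
      · refine ⟨⟨i, hi⟩ :: l, ?_, ?_, ?_⟩
        · simp (disch := omega) [hm, h13, Nat.mod_eq_of_lt, IsLinkedList, hsrc, hv]
          rw [hv] at h1'
          simpa using h1'
        · rw [List.nodup_cons]
          refine ⟨fun h => ?_, h2⟩
          have := ((h3 _).1 h).1
          simp at this
        · intro e
          rw [List.mem_cons, h3]
          constructor
          · rintro (rfl | h)
            · exact ⟨by simp, hv, he⟩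
            · exact ⟨by omega, h.2⟩
          · rintro ⟨h4, h5⟩
            by_cases h6 : (e : ℕ) = i
            · exact Or.inl (Fin.ext h6)
            · exact Or.inr ⟨by omega, h5⟩
      · refine ⟨l, ?_, h2, ?_⟩
        · have : (v : ℕ) ≠ G.src ⟨i, hi⟩ := fun h => hv (Fin.ext h.symm)
          simp (disch := omega) [hm, h13, Nat.mod_eq_of_lt, hsrc, this]
          simpa using h1'
        · intro e
          rw [h3]
          constructor
          · exact fun h => ⟨by omega, h.2⟩
          · rintro ⟨h4, h5, h6⟩
            refine ⟨?_, h5, h6⟩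
            by_contra h7
            exact hv (by rwa [show e = ⟨i, hi⟩ from Fin.ext (by simp; omega)] at h5)

/-- Finish the vertex with the least label. -/
def extractMin : Prog :=
  .seq (.wset 16 (.const 0) (.add (.get 0 (.const 0)) (.sub (.get 12 (.const 1)) (.const 1))))
    (.seq (.wset 14 (.const 0) (.get 8 (.sub (.get 12 (.const 1)) (.const 1))))
      (.wset 12 (.var 16) (.const 0)))

/-- Relax the edge under the cursor (word array `14`) and advance the cursor. -/
def relaxEdge : Prog :=
  .seq (.wset 17 (.const 0) (.sub (.var 14) (.const 1)))
    (.seq (.wset 16 (.const 0) (.add (.get 0 (.const 0)) (.get 11 (.var 17))))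
      (.seq (.cond (.rlt (.add (.get 1 (.add (.get 0 (.const 0)) (.get 10 (.var 17))))
            (.get 0 (.var 17))) (.get 1 (.var 16)))
          (.rset 1 (.var 16) (.add (.get 1 (.add (.get 0 (.const 0)) (.get 10 (.var 17))))
            (.get 0 (.var 17)))) .skip)
        (.wset 14 (.const 0) (.get 9 (.var 17)))))

def dijkstraStep : Prog :=
  .seq (.cond (.weq (.var 14) (.const 0)) extractMin relaxEdge) fixPath

def dijkstraLoop : Prog :=
  .loop (.not (.and (.weq (.var 14) (.const 0)) (.weq (.get 12 (.const 1)) (.const 0))))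
    dijkstraStep

/-- Dijkstra's algorithm on the nonnegative edges; the label of the vertex `v` is the `(n + v)`-th
cell of real array `1`. -/
def dijkstra : Prog := .seq heapify (.seq (.wset 14 (.const 0) (.const 0)) dijkstraLoop)

/-- The memory represents a state of Dijkstra's algorithm. -/
structure DijkstraState {n m : ℕ} (G : HopGraph n m) (f : Fin n → ℝ) (pend : List (Fin m))
    (s : Store) : Prop where
  tree : ∀ i, 1 ≤ i → i < n → IsWinner (s.words 12) (s.reals 1) i
  leaf : ∀ v : Fin n, s.words 12 (n + v) = 0 ∨ s.words 12 (n + v) = v + 1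
  list : IsLinkedList (s.words 9) (s.words 14 0) pend
  inv : G.DijkstraInv f (fun v => s.reals 1 (n + v)) (fun v => s.words 12 (n + v) ≠ 0) pend

/-- The number of vertices still to be finished and edges still to be relaxed. -/
noncomputable def remaining {n m : ℕ} (adj : Fin n → List (Fin m)) (pend : List (Fin m))
    (s : Store) : ℕ :=
  pend.length + ∑ v : Fin n, if s.words 12 (n + v) ≠ 0 then 1 + (adj v).length else 0

section DijkstraStep

variable {n m b : ℕ} {G : HopGraph n m} {f : Fin n → ℝ} {adj : Fin n → List (Fin m)} {s : Store}

/-- The root names its leaf `v` because leaf `n + v` stores `v + 1`. Clearing that leaf finishes `v`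
but leaves its key, the label, in place. The potential loses `1 + deg v` and regains `deg v` as
pending edges. -/
theorem ends_extractMin_fixPath (hs : s.Bounded b) (hG : GraphIn G s)
    (hb : 4 * (n + m) + 16 < 2 ^ b)
    (hadj : ∀ v : Fin n, IsLinkedList (s.words 9) (s.words 8 v) (adj v) ∧
      ∀ e, e ∈ adj v ↔ G.src e = v ∧ e ∉ G.neg)
    (h : DijkstraState G f [] s) (h1 : s.words 12 1 ≠ 0) (hn : 1 ≤ n) :
    Ends b extractMin s 5 fun s₁ => Ends b fixPath s₁ (7 * (Nat.log 2 n + 1) + 1) fun s' =>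
      ∃ l, DijkstraState G f l s' ∧ remaining adj l s' + 1 ≤ remaining adj [] s := by
  have hm : ∀ a i, s.words a i % 2 ^ b = s.words a i := fun a i => Nat.mod_eq_of_lt (hs a i)
  obtain ⟨v, hvn, hWv, hKv⟩ := exists_leaf_of_isWinner h.tree 1 le_rfl (by omega)
  obtain ⟨v, rfl⟩ : ∃ v' : Fin n, (v' : ℕ) = v := ⟨⟨v, hvn⟩, rfl⟩
  have hW1 : s.words 12 1 = v + 1 := by
    rcases h.leaf v with h' | h'
    · exact absurd (hWv ▸ h') h1
    · rw [← hWv, h']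
  refine Ends.straight rfl le_rfl ?_
  simp (disch := omega) only [extractMin, Prog.effect, WExp.eval, hm, hG.n_eq, hW1,
    Nat.mod_eq_of_lt, Nat.add_sub_cancel, Store.setWord_words, if_true, if_false,
    Function.update_self, Nat.reduceEqDiff]
  set s₁ := ((s.setWord 16 0 (n + v)).setWord 14 0 (s.words 8 v)).setWord 12 (n + v) 0 with hs₁
  have hW₁ : ∀ i ≠ n + (v : ℕ), s₁.words 12 i = s.words 12 i := fun i hi => by simp [hs₁, hi]
  have hK₁ : s₁.reals = s.reals := rfl
  have h16 : s₁.words 16 0 = n + v := by simp [hs₁]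
  have hs₁b : s₁.Bounded b :=
    ((hs.setWord _ _ (by omega)).setWord _ _ (hs _ _)).setWord _ _ (by omega)
  refine (ends_fixPath hs₁b (by omega) (by omega) (by omega) fun i hi hin hne => ?_).imp
    fun s' hf hs' => ?_
  · rw [h16] at hne
    exact (h.tree i hi hin).congr hW₁ (fun _ _ => by rw [hK₁]) (by omega) hne
  obtain ⟨e1, e2, e3⟩ := hs'
  have hWv' : s'.words 12 (n + v) = 0 := by rw [e2 _ (by omega)]; simp [hs₁]
  have hWx : ∀ x : Fin n, x ≠ v → s'.words 12 (n + x) = s.words 12 (n + x) := fun x hx => by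
    rw [e2 _ (by omega), hW₁ _ (by omega)]
  refine ⟨adj v, ⟨e1, fun x => ?_, ?_, ?_⟩, ?_⟩
  · by_cases hx : x = v
    · rw [hx, hWv']; simp
    · rw [hWx x hx]; exact h.leaf x
  · have : s'.words 9 = s.words 9 := by rw [hf.words 9 (by decide)]; simp [hs₁]
    rw [this, hf.words 14 (by decide)]
    simpa [hs₁] using (hadj v).1
  · have hK : (fun v : Fin n => s'.reals 1 (n + v)) = fun v : Fin n => s.reals 1 (n + v) :=
      funext fun x => by rw [e3 _ (by omega), hK₁]
    rw [hK]
    refine h.inv.extract (v := v) (by omega) (fun y hy => ?_) (fun x => ?_) (hadj v).2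
    · rw [hKv]; exact (root_le_of_isWinner h.tree _ (by omega) (by omega) hy).2
    · by_cases hx : x = v
      · simp [hx, hWv']
      · simp [hx, hWx x hx]
  · have hsum : (∑ x : Fin n, if s.words 12 (n + x) ≠ 0 then 1 + (adj x).length else 0) =
        (∑ x : Fin n, if s'.words 12 (n + x) ≠ 0 then 1 + (adj x).length else 0) +
          (1 + (adj v).length) := by
      have h3 := Finset.add_sum_erase Finset.univ
        (fun x : Fin n => if s.words 12 (n + x) ≠ 0 then 1 + (adj x).length else 0)
        (Finset.mem_univ v)
      have h4 := Finset.add_sum_erase Finset.univ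
        (fun x : Fin n => if s'.words 12 (n + x) ≠ 0 then 1 + (adj x).length else 0)
        (Finset.mem_univ v)
      have h5 : ∑ x ∈ Finset.univ.erase v,
            (if s.words 12 (n + x) ≠ 0 then 1 + (adj x).length else 0) =
          ∑ x ∈ Finset.univ.erase v,
            if s'.words 12 (n + x) ≠ 0 then 1 + (adj x).length else 0 :=
        Finset.sum_congr rfl fun x hx => by rw [hWx x (Finset.ne_of_mem_erase hx)]
      rw [← h3, ← h4, if_pos (by omega), if_neg (by omega), h5]
      omega
    simp only [remaining, List.length_nil]
    omega

theorem ends_relaxEdge_fixPath (hs : s.Bounded b) (hG : GraphIn G s)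
    (hpos : ∀ e, e ∉ G.neg → 0 ≤ G.wt e) (hb : 4 * (n + m) + 16 < 2 ^ b)
    {e : Fin m} {l : List (Fin m)} (h : DijkstraState G f (e :: l) s) :
    Ends b relaxEdge s 8 fun s₁ => Ends b fixPath s₁ (7 * (Nat.log 2 n + 1) + 1) fun s' =>
      DijkstraState G f l s' ∧ remaining adj l s' + 1 ≤ remaining adj (e :: l) s := by
  have hm : ∀ a i, s.words a i % 2 ^ b = s.words a i := fun a i => Nat.mod_eq_of_lt (hs a i)
  obtain ⟨h14, hl⟩ := h.list
  refine Ends.straight rfl le_rfl ?_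
  simp (disch := omega) only [relaxEdge, Prog.effect, WExp.eval, RExp.eval, BExp.Holds, hm,
    hG.n_eq, h14, hG.src, hG.tgt, hG.wt,
    Nat.mod_eq_of_lt, Nat.add_sub_cancel, Store.setWord_words, Store.setWord_reals, if_true,
    if_false, Function.update_self, Nat.reduceEqDiff]
  -- Both branches of the comparison are treated as storing the minimum; not writing is the same as
  -- rewriting the old value.
  have hK₁ : ∀ s₁ : Store, s₁ = (((s.setWord 17 0 e).setWord 16 0 (n + G.tgt e)).setReal 1
      (n + G.tgt e) (min (s.reals 1 (n + G.tgt e))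
        (s.reals 1 (n + G.src e) + G.wt e))).setWord 14 0 (s.words 9 e) →
      Ends b fixPath s₁ (7 * (Nat.log 2 n + 1) + 1) fun s' =>
      DijkstraState G f l s' ∧ remaining adj l s' + 1 ≤ remaining adj (e :: l) s := by
    intro s₁ hs₁
    have hW₁ : s₁.words 12 = s.words 12 := by simp [hs₁]
    have hK₁ : ∀ i ≠ n + (G.tgt e : ℕ), s₁.reals 1 i = s.reals 1 i := fun i hi => by
      simp [hs₁, hi]
    have h16 : s₁.words 16 0 = n + G.tgt e := by simp [hs₁]
    have hs₁b : s₁.Bounded b := by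
      rw [hs₁]
      exact Store.Bounded.setWord (s := Store.setReal _ _ _ _)
        ((hs.setWord _ _ (by omega)).setWord _ _ (by omega)) _ _ (hs _ _)
    refine (ends_fixPath hs₁b (by omega) (by omega) (by omega) fun i hi hin hne => ?_).imp
      fun s' hf hs' => ?_
    · rw [h16] at hne
      exact (h.tree i hi hin).congr (fun _ _ => by rw [hW₁]) hK₁ (by omega) hne
    obtain ⟨e1, e2, e3⟩ := hs'
    have hWx : ∀ x : Fin n, s'.words 12 (n + x) = s.words 12 (n + x) := fun x => by
      rw [e2 _ (by omega), hW₁]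
    refine ⟨⟨e1, fun x => ?_, ?_, ?_⟩, ?_⟩
    · rw [hWx x]; exact h.leaf x
    · have : s'.words 9 = s.words 9 := by rw [hf.words 9 (by decide)]; simp [hs₁]
      rw [this, hf.words 14 (by decide)]
      simpa [hs₁] using hl
    · refine h.inv.relax hpos (fun x => by rw [hWx x]) (fun x hx => ?_) ?_
      · rw [e3 _ (by omega), hK₁]
        intro h'
        exact hx (Fin.ext (by omega))
      · rw [e3 _ (by omega)]; simp [hs₁]
    · simp only [remaining, List.length_cons, hWx]
      omega
  split_ifs with hlt
  · refine hK₁ _ ?_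
    rw [min_eq_right hlt.le]
    simp (disch := omega) [hm, Nat.mod_eq_of_lt]
  · refine hK₁ _ ?_
    rw [min_eq_left (not_lt.1 hlt)]
    have hself : ((s.setWord 17 0 e).setWord 16 0 (n + G.tgt e)).setReal 1 (n + G.tgt e)
        (s.reals 1 (n + G.tgt e)) = (s.setWord 17 0 e).setWord 16 0 (n + G.tgt e) := by
      simp [Store.setReal, Store.setWord]
    rw [hself]
    simp (disch := omega) [hm, Nat.mod_eq_of_lt]

theorem ends_dijkstraLoop (hs : s.Bounded b) (hG : GraphIn G s)
    (hpos : ∀ e, e ∉ G.neg → 0 ≤ G.wt e) (hb : 4 * (n + m) + 16 < 2 ^ b) (hn : 1 ≤ n)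
    (hadj : ∀ v : Fin n, IsLinkedList (s.words 9) (s.words 8 v) (adj v) ∧
      ∀ e, e ∈ adj v ↔ G.src e = v ∧ e ∉ G.neg)
    (h : DijkstraState G f [] s) :
    Ends b dijkstraLoop s ((7 * (Nat.log 2 n + 1) + 12) * remaining adj [] s + 1) fun s' =>
      G.IsPotential f fun v => s'.reals 1 (n + v) := by
  refine (Ends.loop_potential (fun N s => ∃ l, DijkstraState G f l s ∧
    (7 * (Nat.log 2 n + 1) + 12) * remaining adj l s = N) (fun N s' hf hI hc => ?_)
    ⟨[], h, rfl⟩).imp fun s' hf hI => ?_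
  · obtain ⟨l, hI, rfl⟩ := hI
    have hsb := hf.bounded hs
    have hG' : GraphIn G s' := hG.of_frame hf (by decide) (by decide)
    have hadj' : ∀ v : Fin n, IsLinkedList (s'.words 9) (s'.words 8 v) (adj v) ∧
        ∀ e, e ∈ adj v ↔ G.src e = v ∧ e ∉ G.neg := by
      rw [hf.words 8 (by decide), hf.words 9 (by decide)]; exact hadj
    have hm : ∀ a i, s'.words a i % 2 ^ b = s'.words a i := fun a i => Nat.mod_eq_of_lt (hsb a i)
    have hstep : Ends b dijkstraStep s' (7 * (Nat.log 2 n + 1) + 11) fun s'' =>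
        ∃ l', DijkstraState G f l' s'' ∧ remaining adj l' s'' + 1 ≤ remaining adj l s' := by
      refine (Ends.seq (T₁ := 8 + 1) (T₂ := 7 * (Nat.log 2 n + 1) + 1)
        (Ends.cond (fun h0 => ?_) fun h0 => ?_)).le (by omega)
      · simp (disch := omega) only [BExp.Holds, WExp.eval, hm, Nat.mod_eq_of_lt] at h0 hc
        have hl := hI.list
        cases l with
        | nil =>
          exact (ends_extractMin_fixPath hsb hG' hb hadj' hI (by tauto) hn).le (by omega)
        | cons e l => exact absurd hl.1 (by omega)
      · simp (disch := omega) only [BExp.Holds, WExp.eval, hm, Nat.mod_eq_of_lt] at h0 hc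
        have hl := hI.list
        cases l with
        | nil => exact absurd hl h0
        | cons e l =>
          exact (ends_relaxEdge_fixPath (adj := adj) hsb hG' hpos hb hI).imp
            fun _ _ h => h.imp fun _ _ h => ⟨l, h⟩
    refine ⟨_, hstep.imp fun s'' _ hs'' => ?_⟩
    obtain ⟨l', h1, h2⟩ := hs''
    refine ⟨_, ⟨l', h1, rfl⟩, ?_⟩
    calc _ = (7 * (Nat.log 2 n + 1) + 12) * (remaining adj l' s'' + 1) := by ring
      _ ≤ _ := Nat.mul_le_mul_left _ h2
  · obtain ⟨⟨N, l, hI, -⟩, hc⟩ := hI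
    have hsb := hf.bounded hs
    have hm : ∀ a i, s'.words a i % 2 ^ b = s'.words a i := fun a i => Nat.mod_eq_of_lt (hsb a i)
    simp (disch := omega) only [BExp.Holds, WExp.eval, hm, Nat.mod_eq_of_lt, not_not] at hc
    have hl := hI.list
    cases l with
    | cons e l => exact absurd hl.1 (by omega)
    | nil =>
      refine hI.inv.isPotential fun v hv => ?_
      exact (root_le_of_isWinner hI.tree _ (by omega) (by omega) hv).1 hc.2

theorem ends_dijkstra (hs : s.Bounded b) (hG : GraphIn G s)
    (hpos : ∀ e, e ∉ G.neg → 0 ≤ G.wt e) (hb : 4 * (n + m) + 16 < 2 ^ b) (hn : 1 ≤ n)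
    (hadj : AdjLists G (s.words 8) (s.words 9) m) (hW : ∀ v : Fin n, s.words 12 (n + v) = v + 1) :
    Ends b dijkstra s ((7 * Nat.log 2 n + 26) * (n + m) + 7) fun s' =>
      G.IsPotential (fun v => s.reals 1 (n + v)) fun v => s'.reals 1 (n + v) := by
  choose adj h1 h2 h3 using hadj
  -- The lists have no repetitions and partition the nonnegative edges by tail, so the loop makes at
  -- most `n + m` steps.
  have hlen : ∑ v, (adj v).length ≤ m := by
    classical
    calc ∑ v, (adj v).length ≤ ∑ v, (Finset.univ.filter fun e => G.src e = v).card := by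
          refine Finset.sum_le_sum fun v _ => ?_
          rw [← List.toFinset_card_of_nodup (h2 v)]
          refine Finset.card_le_card fun e he => ?_
          rw [List.mem_toFinset, h3] at he
          simp [he.2.1]
      _ = (Finset.univ : Finset (Fin m)).card :=
          (Finset.card_eq_sum_card_fiberwise fun _ _ => Finset.mem_univ _).symm
      _ = m := by simp
  refine (Ends.seq (T₁ := 7 * n + 3) (T₂ := (7 * (Nat.log 2 n + 1) + 12) * (n + m) + 3)
    ((ends_heapify hs hG.n_eq (by omega)).imp fun s₁ hf₁ h₁ => ?_)).le (by nlinarith)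
  obtain ⟨e1, e2, e3⟩ := h₁
  refine (Ends.seq (T₁ := 1) (T₂ := (7 * (Nat.log 2 n + 1) + 12) * (n + m) + 1)
    (Ends.straight rfl le_rfl ?_)).le (by omega)
  simp (disch := omega) only [Prog.effect, WExp.eval, Nat.mod_eq_of_lt]
  set s₂ := s₁.setWord 14 0 0 with hs₂
  have hs₂b : s₂.Bounded b := (hf₁.bounded hs).setWord _ _ (by omega)
  have hW₂ : s₂.words 12 = s₁.words 12 := by simp [hs₂]
  have hK₂ : s₂.reals 1 = s₁.reals 1 := by simp [hs₂]
  have h8 : s₂.words 8 = s.words 8 := by simp [hs₂, hf₁.words 8 (by decide)]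
  have h9 : s₂.words 9 = s.words 9 := by simp [hs₂, hf₁.words 9 (by decide)]
  have hG₁ : GraphIn G s₁ := hG.of_frame hf₁ (by decide) (by decide)
  have hG₂ : GraphIn G s₂ := by
    constructor <;> simp only [hs₂, Store.setWord_words, Store.setWord_reals, Nat.reduceEqDiff,
      if_false, OfNat.zero_ne_ofNat]
    · exact hG₁.n_eq
    · exact hG₁.m_eq
    · exact hG₁.src
    · exact hG₁.tgt
    · exact hG₁.neg
    · exact hG₁.wt
  have hWv : ∀ v : Fin n, s₂.words 12 (n + v) = v + 1 := fun v => by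
    rw [hW₂, e2 _ (by omega), hW]
  have hrem : remaining adj [] s₂ ≤ n + m := by
    simp only [remaining, hWv]
    simp only [List.length_nil, ne_eq, Nat.add_eq_zero_iff, one_ne_zero, and_false,
      not_false_eq_true, if_true, zero_add]
    rw [Finset.sum_add_distrib]
    simp only [Finset.sum_const, Finset.card_univ, Fintype.card_fin, smul_eq_mul, mul_one]
    omega
  refine (ends_dijkstraLoop hs₂b hG₂ hpos hb hn (adj := adj) (fun v => ?_) ?_).le
    (Nat.add_le_add_right (Nat.mul_le_mul_left _ hrem) 1)
  · rw [h8, h9]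
    exact ⟨h1 v, fun e => by rw [h3]; simp⟩
  · refine ⟨?_, fun v => Or.inr (hWv v), ?_, ?_⟩
    · rw [hW₂, hK₂]; exact e1
    · simp [hs₂, IsLinkedList]
    · have hA : (fun v : Fin n => s₂.words 12 (n + v) ≠ 0) = fun _ => True :=
        funext fun v => by rw [hWv]; simp
      have hK : (fun v : Fin n => s₂.reals 1 (n + v)) = fun v : Fin n => s.reals 1 (n + v) :=
        funext fun v => by rw [hK₂, e3 _ (by omega)]
      rw [hA, hK]
      exact .init _

end DijkstraStep

end RealRAM

/-! ## One-hop distances -/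

namespace RealRAM

/-- Set the labels to `0` on the source set (flags in word array `7`) and to `M` elsewhere, and
clear the adjacency lists and real array `3`. -/
def initLabels : Prog :=
  .forLoop 13 0 0
    (.seq (.wset 8 (.var 13) (.const 0))
    (.seq (.wset 12 (.add (.get 0 (.const 0)) (.var 13)) (.add (.var 13) (.const 1)))
    (.seq (.rset 3 (.var 13) (.sub (.get 2 (.const 0)) (.get 2 (.const 0))))
    (.cond (.weq (.get 7 (.var 13)) (.const 1))
      (.rset 1 (.add (.get 0 (.const 0)) (.var 13)) (.sub (.get 2 (.const 0)) (.get 2 (.const 0))))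
      (.rset 1 (.add (.get 0 (.const 0)) (.var 13)) (.get 2 (.const 0)))))))

section

variable {n m b : ℕ} {G : HopGraph n m} {s₀ : Store}

/-- The machine has no real literals, so the program forms zero as the difference of a cell with
itself. -/
theorem ends_initLabels (hs : s₀.Bounded b) (hG : GraphIn G s₀) (hb : 4 * (n + m) + 16 < 2 ^ b) :
    Ends b initLabels s₀ (13 * n + 3) fun s' => ∀ v < n, s'.words 8 v = 0 ∧
      s'.words 12 (n + v) = v + 1 ∧ s'.reals 3 v = 0 ∧
      s'.reals 1 (n + v) = if s₀.words 7 v = 1 then 0 else s₀.reals 2 0 := by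
  refine (Ends.forLoop (T := 9) (N := n) (fun i s => ∀ v < i, s.words 8 v = 0 ∧
      s.words 12 (n + v) = v + 1 ∧ s.reals 3 v = 0 ∧
      s.reals 1 (n + v) = if s₀.words 7 v = 1 then 0 else s₀.reals 2 0)
    (by decide) (by decide) (by omega) hG.n_eq (by omega) ?_ ?_)
  · simp
  · intro i s hi hf h13 hI
    have hsb := hf.bounded hs
    have h00 : s.words 0 0 = n := by rw [hf.words 0 (by decide), hG.n_eq]
    have h7 : s.words 7 = s₀.words 7 := hf.words 7 (by decide)
    have hr2 : s.reals 2 = s₀.reals 2 := hf.reals 2 (by decide)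
    have hm : ∀ a i, s.words a i % 2 ^ b = s.words a i := fun a i => Nat.mod_eq_of_lt (hsb a i)
    have hm7 : ∀ i, s₀.words 7 i % 2 ^ b = s₀.words 7 i := fun i => Nat.mod_eq_of_lt (hs 7 i)
    refine Ends.straight rfl (by decide) ?_
    simp (disch := omega) only [Prog.effect, BExp.Holds, WExp.eval, RExp.eval, hm, h13,
      Nat.mod_eq_of_lt, h00, Store.setWord_words, Store.setWord_reals, Store.setReal_reals,
      Store.setReal_words, if_true, if_false, Function.update_self, Nat.reduceEqDiff,
      OfNat.zero_ne_ofNat, h7, hr2, hm7, sub_self]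
    intro v hv
    by_cases hvi : v = i
    · subst hvi
      split_ifs with h <;>
      simp (disch := omega) [h, h13, h00, Nat.mod_eq_of_lt, hm, h7, hr2]
    · have hv' : n + v ≠ n + i := by omega
      have := hI v (by omega)
      by_cases h : s₀.words 7 i = 1 <;>
      simpa (disch := omega) [h13, h00, Nat.mod_eq_of_lt, hm, h7, hr2, hvi, h] using this

/-- Relax the negative edges into real array `3`. -/
def relaxNeg : Prog :=
  .forLoop 13 0 1
    (.cond (.and (.not (.weq (.get 3 (.var 13)) (.const 0)))
        (.rlt (.add (.get 1 (.add (.get 0 (.const 0)) (.get 10 (.var 13)))) (.get 0 (.var 13)))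
          (.get 3 (.get 11 (.var 13)))))
      (.rset 3 (.get 11 (.var 13))
        (.add (.get 1 (.add (.get 0 (.const 0)) (.get 10 (.var 13)))) (.get 0 (.var 13)))) .skip)

/-- The result is kept apart from the labels being read, so a path gains at most one hop. The two
clauses are `hz₁` and `hz₂` of `HopGraph.oneHop_neg_iff`. -/
theorem ends_relaxNeg (hs : s₀.Bounded b) (hG : GraphIn G s₀) (hb : 4 * (n + m) + 16 < 2 ^ b)
    (h3 : ∀ v < n, s₀.reals 3 v = 0) :
    Ends b relaxNeg s₀ (6 * m + 3) fun s' =>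
      (∀ e ∈ G.neg, s'.reals 3 (G.tgt e) ≤ s₀.reals 1 (n + G.src e) + G.wt e) ∧
      ∀ v : Fin n, s'.reals 3 v = 0 ∨
        ∃ e ∈ G.neg, G.tgt e = v ∧ s'.reals 3 v = s₀.reals 1 (n + G.src e) + G.wt e := by
  refine (Ends.forLoop (T := 2) (N := m) (fun i s =>
      (∀ e ∈ G.neg, (e : ℕ) < i → s.reals 3 (G.tgt e) ≤ s₀.reals 1 (n + G.src e) + G.wt e) ∧
      ∀ v : Fin n, s.reals 3 v = 0 ∨
        ∃ e ∈ G.neg, G.tgt e = v ∧ s.reals 3 v = s₀.reals 1 (n + G.src e) + G.wt e)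
    (by decide) (by decide) (by omega) hG.m_eq (by omega) ?_ ?_).imp fun s' _ h =>
      ⟨fun e he => h.1 e he e.2, h.2⟩
  · exact ⟨by simp, fun v => Or.inl (h3 v v.2)⟩
  · intro i s hi hf h13 hI
    have hsb := hf.bounded hs
    have hG' : GraphIn G s := hG.of_frame hf (by decide) (by decide)
    have hm : ∀ a i, s.words a i % 2 ^ b = s.words a i := fun a i => Nat.mod_eq_of_lt (hsb a i)
    have hr1 : s.reals 1 = s₀.reals 1 := hf.reals 1 (by decide)
    obtain ⟨e, rfl⟩ : ∃ e : Fin m, (e : ℕ) = i := ⟨⟨i, hi⟩, rfl⟩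
    have hb0 : b ≠ 0 := by rintro rfl; omega
    obtain ⟨hI1, hI2⟩ := hI
    refine Ends.straight rfl (by decide) ?_
    by_cases he : e ∈ G.neg
    · by_cases hlt : s₀.reals 1 (n + G.src e) + G.wt e < s.reals 3 (G.tgt e)
      · simp (disch := omega) only [Prog.effect, BExp.Holds, WExp.eval, RExp.eval, hm, h13,
          Nat.mod_eq_of_lt, hG'.n_eq, hG'.neg, hG'.src, hG'.tgt, hG'.wt, he, if_true, hr1, hlt]
        simp only [one_ne_zero, not_false_eq_true, and_self, if_true, Store.setWord_reals,
          Store.setReal_reals]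
        refine ⟨fun e' he' hei => ?_, fun v => ?_⟩
        · by_cases ht : G.tgt e' = G.tgt e
          · rw [ht, Function.update_self]
            by_cases hee : e' = e
            · rw [hee]
            · have := hI1 e' he' (by have := fun h => hee (Fin.ext h); omega)
              rw [ht] at this
              linarith
          · have ht' : (G.tgt e' : ℕ) ≠ G.tgt e := fun h => ht (Fin.ext h)
            rw [Function.update_of_ne ht']
            refine hI1 e' he' ?_
            have : (e' : ℕ) ≠ e := fun h => ht (by rw [Fin.ext h])
            omega
        · by_cases ht : G.tgt e = v
          · refine Or.inr ⟨e, he, ht, ?_⟩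
            rw [← ht, Function.update_self]
          · have ht' : (v : ℕ) ≠ G.tgt e := fun h => ht (Fin.ext h.symm)
            rw [Function.update_of_ne ht']
            exact hI2 v
      · simp (disch := omega) only [Prog.effect, BExp.Holds, WExp.eval, RExp.eval, hm, h13,
          Nat.mod_eq_of_lt, hG'.n_eq, hG'.neg, hG'.src, hG'.tgt, hG'.wt, he, if_true, hr1, hlt,
          and_false, if_false, Store.setWord_reals]
        refine ⟨fun e' he' hei => ?_, hI2⟩
        by_cases hee : e' = e
        · rw [hee]; exact not_lt.1 hlt
        · exact hI1 e' he' (by have := fun h => hee (Fin.ext h); omega)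
    · simp (disch := omega) only [Prog.effect, BExp.Holds, WExp.eval, RExp.eval, hm, h13,
        Nat.mod_eq_of_lt, hG'.neg, he, if_false, not_true, false_and, Store.setWord_reals]
      refine ⟨fun e' he' hei => hI1 e' he' ?_, hI2⟩
      have : (e' : ℕ) ≠ e := fun h => he (Fin.ext h ▸ he')
      omega

/-- Reset the labels to real array `3`. -/
def reloadLabels : Prog :=
  .forLoop 13 0 0
    (.seq (.wset 12 (.add (.get 0 (.const 0)) (.var 13)) (.add (.var 13) (.const 1)))
      (.rset 1 (.add (.get 0 (.const 0)) (.var 13)) (.get 3 (.var 13))))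

theorem ends_reloadLabels (hs : s₀.Bounded b) (hG : GraphIn G s₀)
    (hb : 4 * (n + m) + 16 < 2 ^ b) :
    Ends b reloadLabels s₀ (7 * n + 3) fun s' => ∀ v < n,
      s'.words 12 (n + v) = v + 1 ∧ s'.reals 1 (n + v) = s₀.reals 3 v := by
  refine (Ends.forLoop (T := 3) (N := n) (fun i s => ∀ v < i,
      s.words 12 (n + v) = v + 1 ∧ s.reals 1 (n + v) = s₀.reals 3 v)
    (by decide) (by decide) (by omega) hG.n_eq (by omega) ?_ ?_)
  · simp
  · intro i s hi hf h13 hI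
    have hsb := hf.bounded hs
    have h00 : s.words 0 0 = n := by rw [hf.words 0 (by decide), hG.n_eq]
    have hr3 : s.reals 3 = s₀.reals 3 := hf.reals 3 (by decide)
    have hm : ∀ a i, s.words a i % 2 ^ b = s.words a i := fun a i => Nat.mod_eq_of_lt (hsb a i)
    refine Ends.straight rfl (by decide) ?_
    simp (disch := omega) only [Prog.effect, BExp.Holds, WExp.eval, RExp.eval, hm, h13,
      Nat.mod_eq_of_lt, h00, Store.setWord_words, Store.setWord_reals, Store.setReal_reals,
      Store.setReal_words, if_true, if_false, Function.update_self, Nat.reduceEqDiff,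
      OfNat.zero_ne_ofNat, hr3]
    intro v hv
    by_cases hvi : v = i
    · subst hvi; simp
    · simpa [hvi] using hI v (by omega)

/-- Compute labels whose signs are those of the one-hop distances from the source set. -/
def oneHop : Prog :=
  .seq initLabels (.seq buildAdj (.seq dijkstra (.seq relaxNeg (.seq reloadLabels dijkstra))))

theorem ends_oneHop (hs : s₀.Bounded b) (hG : GraphIn G s₀)
    (hpos : ∀ e, e ∉ G.neg → 0 ≤ G.wt e) (hb : 4 * (n + m) + 16 < 2 ^ b) (hn : 1 ≤ n)
    (hM : ∀ e ∈ G.neg, 0 ≤ s₀.reals 2 0 + G.wt e) :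
    Ends b oneHop s₀ ((14 * Nat.log 2 n + 110) * (n + m)) fun s' => ∀ v : Fin n,
      s'.reals 1 (n + v) < 0 ↔ ∃ u : Fin n, s₀.words 7 u = 1 ∧ G.hopDist 1 u v < 0 := by
  have hnm : 1 ≤ n + m := by omega
  refine (Ends.seq (T₂ := 8 * m + 3 + ((7 * Nat.log 2 n + 26) * (n + m) + 7 +
    (6 * m + 3 + (7 * n + 3 + ((7 * Nat.log 2 n + 26) * (n + m) + 7) + 1) + 1) + 1) + 1)
    ((ends_initLabels hs hG hb).imp fun s₁ hf₁ h₁ => ?_)).le ?_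
  swap
  · have : (14 * Nat.log 2 n + 110) * (n + m) =
      2 * ((7 * Nat.log 2 n + 26) * (n + m)) + 58 * n + 58 * m := by ring
    omega
  have hs₁ := hf₁.bounded hs
  have hG₁ : GraphIn G s₁ := hG.of_frame hf₁ (by decide) (by decide)
  refine Ends.seq ((ends_buildAdj hs₁ hG₁ hb fun v => (h₁ v v.2).1).imp fun s₂ hf₂ h₂ => ?_)
  have hs₂ := hf₂.bounded hs₁
  have hG₂ : GraphIn G s₂ := hG₁.of_frame hf₂ (by decide) (by decide)
  refine Ends.seq ((ends_dijkstra hs₂ hG₂ hpos hb hn h₂ fun v => ?_).imp fun s₃ hf₃ h₃ => ?_)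
  · rw [hf₂.words 12 (by decide)]; exact (h₁ v v.2).2.1
  have hs₃ := hf₃.bounded hs₂
  have hG₃ : GraphIn G s₃ := hG₂.of_frame hf₃ (by decide) (by decide)
  refine Ends.seq ((ends_relaxNeg hs₃ hG₃ hb fun v hv => ?_).imp fun s₄ hf₄ h₄ => ?_)
  · rw [hf₃.reals 3 (by decide), hf₂.reals 3 (by decide)]; exact (h₁ v hv).2.2.1
  have hs₄ := hf₄.bounded hs₃
  have hG₄ : GraphIn G s₄ := hG₃.of_frame hf₄ (by decide) (by decide)
  refine Ends.seq ((ends_reloadLabels hs₄ hG₄ hb).imp fun s₅ hf₅ h₅ => ?_)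
  have hs₅ := hf₅.bounded hs₄
  have hG₅ : GraphIn G s₅ := hG₄.of_frame hf₅ (by decide) (by decide)
  refine (ends_dijkstra hs₅ hG₅ hpos hb hn ?_ fun v => (h₅ v v.2).1).imp fun s₆ hf₆ h₆ => ?_
  · rw [hf₅.words 8 (by decide), hf₅.words 9 (by decide), hf₄.words 8 (by decide),
      hf₄.words 9 (by decide), hf₃.words 8 (by decide), hf₃.words 9 (by decide)]
    exact h₂
  have e₂ : (fun v : Fin n => s₂.reals 1 (n + v)) = fun v : Fin n =>
      if s₀.words 7 v = 1 then 0 else s₀.reals 2 0 := funext fun v => by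
    rw [hf₂.reals 1 (by decide)]; exact (h₁ v v.2).2.2.2
  have e₅ : (fun v : Fin n => s₅.reals 1 (n + v)) = fun v : Fin n => s₄.reals 3 v :=
    funext fun v => (h₅ v v.2).2
  rw [e₂] at h₃
  rw [e₅] at h₆
  exact HopGraph.oneHop_neg_iff hpos (S := fun u => s₀.words 7 u = 1) hM
    (fun u hu => by simp [hu]) (fun u hu => by simp [hu]) h₃ h₄.1 h₄.2 h₆

end

end RealRAM

/-! ## One round of the algorithm -/

namespace RealRAM

/-- The memory after preprocessing: the input, the list `lu` of the vertices of `U₀` (word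
array `20`) and its length (word array `21`), the block size (word array `22`), and an upper bound
for the absolute values of the weights (real array `2`). -/
structure Ready {n m : ℕ} (G : HopGraph n m) (U₀ : Finset (Fin n)) (ρ : ℕ)
    (lu : Fin U₀.card → Fin n) (s : Store) : Prop where
  n_eq : s.words 0 0 = n
  m_eq : s.words 0 1 = m
  rho : s.words 0 2 = ρ
  src : ∀ e : Fin m, s.words 1 e = G.src e
  tgt : ∀ e : Fin m, s.words 2 e = G.tgt e
  neg : ∀ e : Fin m, s.words 3 e = if e ∈ G.neg then 1 else 0
  mem : ∀ v : Fin n, s.words 4 v = if v ∈ U₀ then 1 else 0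
  wt : ∀ e : Fin m, s.reals 0 e = G.wt e
  list : ∀ j : Fin U₀.card, s.words 20 j = lu j
  card : s.words 21 0 = U₀.card
  block : s.words 22 0 = U₀.card / ρ
  bound : ∀ e ∈ G.neg, 0 ≤ s.reals 2 0 + G.wt e

theorem Ready.congr {n m : ℕ} {G : HopGraph n m} {U₀ : Finset (Fin n)} {ρ : ℕ}
    {lu : Fin U₀.card → Fin n} {s s' : Store} (h : Ready G U₀ ρ lu s)
    (hw : ∀ a ∈ [0, 1, 2, 3, 4, 20, 21, 22], s'.words a = s.words a)
    (hr : ∀ a ∈ [0, 2], s'.reals a = s.reals a) : Ready G U₀ ρ lu s' := by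
  simp only [List.forall_mem_cons, List.not_mem_nil, false_implies, implies_true, and_true]
    at hw hr
  obtain ⟨h0, h1, h2, h3, h4, h20, h21, h22⟩ := hw
  obtain ⟨k0, k2⟩ := hr
  exact ⟨h0 ▸ h.n_eq, h0 ▸ h.m_eq, h0 ▸ h.rho, h1 ▸ h.src, h2 ▸ h.tgt, h3 ▸ h.neg, h4 ▸ h.mem,
    k0 ▸ h.wt, h20 ▸ h.list, h21 ▸ h.card, h22 ▸ h.block, k2 ▸ h.bound⟩

theorem Ready.of_frame {n m b : ℕ} {G : HopGraph n m} {U₀ : Finset (Fin n)} {ρ : ℕ}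
    {lu : Fin U₀.card → Fin n} {s s' : Store} {p : Prog} (h : Ready G U₀ ρ lu s)
    (hf : p.Frame b s s') (hw : ∀ a ∈ [0, 1, 2, 3, 4, 20, 21, 22], a ∉ p.wmods)
    (hr : ∀ a ∈ [0, 2], a ∉ p.rmods) : Ready G U₀ ρ lu s' :=
  h.congr (fun a ha => hf.words a (hw a ha)) fun a ha => hf.reals a (hr a ha)

/-- Take the tails and heads of the edges from the word arrays `a` and `c`. -/
def copyEdges (a c : ℕ) : Prog :=
  .forLoop 13 0 1 (.seq (.wset 10 (.var 13) (.get a (.var 13)))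
    (.wset 11 (.var 13) (.get c (.var 13))))

/-- Swapping the roles of `a` and `c` lets the same one-hop code run on `G` and on `G.rev`. -/
theorem ends_copyEdges {b m a c : ℕ} {s₀ : Store} (hs : s₀.Bounded b) (hm : s₀.words 0 1 = m)
    (hb : m + 2 < 2 ^ b) (ha : a ∉ (copyEdges a c).wmods) (hc : c ∉ (copyEdges a c).wmods) :
    Ends b (copyEdges a c) s₀ (7 * m + 3) fun s' => ∀ e < m,
      s'.words 10 e = s₀.words a e ∧ s'.words 11 e = s₀.words c e := by
  have hc10 : c ≠ 10 := by rintro rfl; simp [copyEdges, Prog.forLoop, Prog.wmods] at hc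
  refine Ends.forLoop (T := 3) (N := m) (fun i s => ∀ e < i,
    s.words 10 e = s₀.words a e ∧ s.words 11 e = s₀.words c e) (by simp [Prog.forLoop, Prog.wmods])
    (by simp [Prog.wmods]) (by omega) hm (by omega) (by simp) ?_
  intro i s hi hf h13 hI
  have hsb := hf.bounded hs
  have hm : ∀ a i, s.words a i % 2 ^ b = s.words a i := fun a i => Nat.mod_eq_of_lt (hsb a i)
  refine Ends.straight rfl le_rfl ?_
  simp (disch := omega) only [Prog.effect, WExp.eval, hm, h13, Nat.mod_eq_of_lt,
    Store.setWord_words, if_true, if_false, Function.update_self, Nat.reduceEqDiff, hc10,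
    hf.words a ha, hf.words c hc]
  intro v hv
  have hma : s₀.words a i % 2 ^ b = s₀.words a i := Nat.mod_eq_of_lt (hs a i)
  have hmc : s₀.words c i % 2 ^ b = s₀.words c i := Nat.mod_eq_of_lt (hs c i)
  by_cases hvi : v = i
  · subst hvi; simp [hma, hmc]
  · simpa [hvi] using hI v (by omega)

/-- Clear the source set. -/
def clearSources : Prog := .forLoop 13 0 0 (.wset 7 (.var 13) (.const 0))

theorem ends_clearSources {b n : ℕ} {s₀ : Store} (hn : s₀.words 0 0 = n)
    (hb : n + 2 < 2 ^ b) :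
    Ends b clearSources s₀ (5 * n + 3) fun s' => ∀ v < n, s'.words 7 v = 0 := by
  refine Ends.forLoop (T := 1) (N := n) (fun i s => ∀ v < i, s.words 7 v = 0) (by decide)
    (by decide) (by omega) hn (by omega) (by simp) ?_
  intro i s hi hf h13 hI
  refine Ends.straight rfl le_rfl ?_
  simp (disch := omega) only [Prog.effect, WExp.eval, h13, Nat.mod_eq_of_lt,
    Store.setWord_words, if_true, if_false, Function.update_self, Nat.reduceEqDiff]
  intro v hv
  by_cases hvi : v = i
  · subst hvi; simp
  · simpa [hvi] using hI v (by omega)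

/-- Return the set of vertices that satisfy the condition, and count them in word array `25`. -/
def collect (c : BExp) : Prog :=
  .seq (.wset 25 (.const 0) (.const 0))
    (.forLoop 13 0 0 (.cond c
      (.seq (.wset 6 (.var 13) (.const 1)) (.wset 25 (.const 0) (.add (.var 25) (.const 1))))
      (.wset 6 (.var 13) (.const 0))))

/-- Hypothesis `hc` asks that the test be insensitive to the arrays that the loop itself changes,
apart from reading the counter. -/
theorem ends_collect {b n : ℕ} {s₀ : Store} (hs : s₀.Bounded b) (hn : s₀.words 0 0 = n)
    (hb : n + 2 < 2 ^ b) {c : BExp} {P : Fin n → Prop}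
    (hc : ∀ s, s.Bounded b → (∀ a ∉ [6, 13, 25], s.words a = s₀.words a) → s.reals = s₀.reals →
      ∀ v : Fin n, s.words 13 0 = (v : ℕ) → (c.Holds b s ↔ P v)) :
    Ends b (collect c) s₀ (8 * n + 5) fun s' =>
      (∀ v, v ∈ s'.answerSet n ↔ P v) ∧ s'.words 25 0 = (s'.answerSet n).card := by
  classical
  refine (Ends.seq (T₁ := 1) (T₂ := 8 * n + 3) (Ends.straight rfl le_rfl ?_)).le (by omega)
  simp only [Prog.effect, WExp.eval, Nat.zero_mod]
  set s₁ := s₀.setWord 25 0 0 with hs₁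
  have hs₁b : s₁.Bounded b := hs.setWord _ _ (by omega)
  refine (Ends.forLoop (T := 4) (N := n) (fun i s =>
    (∀ v : Fin n, (v : ℕ) < i → s.words 6 v = if P v then 1 else 0) ∧
      s.words 25 0 = (Finset.univ.filter fun v : Fin n => (v : ℕ) < i ∧ P v).card)
    (by simp [Prog.forLoop, Prog.wmods]) (by simp [Prog.wmods]) (by omega) (by simp [hs₁, hn])
    (by omega) (by simp [hs₁]) ?_).imp fun s' _ h => ?_
  · rintro i s hi hf h13 ⟨hI1, hI2⟩
    have hsb := hf.bounded hs₁b
    obtain ⟨x, rfl⟩ : ∃ x : Fin n, (x : ℕ) = i := ⟨⟨i, hi⟩, rfl⟩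
    have hcx := hc s hsb (fun a ha => by
      simp only [List.mem_cons, List.not_mem_nil, not_or] at ha
      rw [hf.words a (by simp [Prog.forLoop, Prog.wmods]; tauto)]
      simp [hs₁, ha.2.2.1]) (by
      funext a
      rw [hf.reals a (by simp [Prog.forLoop, Prog.rmods])]
      simp [hs₁]) x h13
    have hlt : (Finset.univ.filter fun v : Fin n => (v : ℕ) < x ∧ P v).card ≤ n :=
      (Finset.card_le_univ _).trans (by simp)
    have hsucc : (Finset.univ.filter fun v : Fin n => (v : ℕ) < x + 1 ∧ P v).card =
        (Finset.univ.filter fun v : Fin n => (v : ℕ) < x ∧ P v).card + if P x then 1 else 0 := by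
      by_cases hx : P x
      · rw [if_pos hx, ← Finset.card_insert_of_notMem (a := x) (by simp)]
        congr 1
        ext v
        simp only [Finset.mem_filter, Finset.mem_univ, true_and, Finset.mem_insert]
        constructor
        · rintro ⟨h1, h2⟩
          by_cases hv : v = x
          · exact Or.inl hv
          · exact Or.inr ⟨by have := fun h => hv (Fin.ext h); omega, h2⟩
        · rintro (rfl | ⟨h1, h2⟩)
          · exact ⟨by omega, hx⟩
          · exact ⟨by omega, h2⟩
      · rw [if_neg hx, add_zero]
        congr 1
        ext v
        simp only [Finset.mem_filter, Finset.mem_univ, true_and]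
        refine and_congr_left fun hv => ?_
        have : v ≠ x := by rintro rfl; exact hx hv
        have := fun h => this (Fin.ext h)
        omega
    refine Ends.straight rfl le_rfl ?_
    by_cases hx : P x
    · simp (disch := omega) only [Prog.effect, WExp.eval, h13, Nat.mod_eq_of_lt, hcx, hx, hI2,
        Store.setWord_words, if_true, if_false, Function.update_self, Nat.reduceEqDiff]
      refine ⟨fun v hv => ?_, by rw [hsucc]; simp [hx, hI2]⟩
      by_cases hvx : v = x
      · simp [hvx, hx]
      · have : (v : ℕ) ≠ x := fun h => hvx (Fin.ext h)
        rw [Function.update_of_ne this]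
        exact hI1 v (by omega)
    · simp (disch := omega) only [Prog.effect, WExp.eval, h13, Nat.mod_eq_of_lt, hcx, hx, hI2,
        Store.setWord_words, if_true, if_false, Function.update_self, Nat.reduceEqDiff]
      refine ⟨fun v hv => ?_, by rw [hsucc]; simp [hx, hI2]⟩
      by_cases hvx : v = x
      · simp [hvx, hx]
      · have : (v : ℕ) ≠ x := fun h => hvx (Fin.ext h)
        rw [Function.update_of_ne this]
        exact hI1 v (by omega)
  · have hmem : ∀ v, v ∈ s'.answerSet n ↔ P v := fun v => by
      simp only [Store.answerSet, Finset.mem_filter, Finset.mem_univ, true_and, h.1 v v.2]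
      split_ifs with hv <;> simp [hv]
    refine ⟨hmem, ?_⟩
    rw [h.2]
    congr 1
    ext v
    simp [hmem]

/-- The real number zero. -/
abbrev RExp.zero : RExp := .sub (.get 2 (.const 0)) (.get 2 (.const 0))

/-- Find the members of `U₀` at negative one-hop distance to the vertex drawn (word array `24`). -/
def inNeighbors : Prog :=
  .seq (.wset 24 (.const 0) (.get 20 (.var 24))) (.seq (copyEdges 2 1) (.seq clearSources
    (.seq (.wset 7 (.var 24) (.const 1)) (.seq oneHop
      (collect (.and (.weq (.get 4 (.var 13)) (.const 1))
        (.rlt (.get 1 (.add (.get 0 (.const 0)) (.var 13))) .zero)))))))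

section Round

variable {n m b ρ : ℕ} {G : HopGraph n m} {U₀ : Finset (Fin n)} {lu : Fin U₀.card → Fin n}
  {s₀ : Store}

theorem ends_inNeighbors (hs : s₀.Bounded b) (h : Ready G U₀ ρ lu s₀)
    (hpos : ∀ e, e ∉ G.neg → 0 ≤ G.wt e) (hb : 4 * (n + m) + 16 < 2 ^ b) (hn : 1 ≤ n)
    {j : Fin U₀.card} (hj : s₀.words 24 0 = j) :
    Ends b inNeighbors s₀ ((14 * Nat.log 2 n + 160) * (n + m)) fun s' =>
      s'.words 24 0 = lu j ∧ (∀ v : Fin n, s'.reals 1 (n + v) < 0 ↔ G.hopDist 1 v (lu j) < 0) ∧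
      (∀ v, v ∈ s'.answerSet n ↔ v ∈ U₀ ∧ G.hopDist 1 v (lu j) < 0) ∧
      s'.words 25 0 = (s'.answerSet n).card := by
  have hnm : 1 ≤ n + m := by omega
  have hk : U₀.card ≤ n := (Finset.card_le_univ _).trans (by simp)
  refine (Ends.seq (T₁ := 1) (T₂ := 7 * m + 3 + (5 * n + 3 + (1 + ((14 * Nat.log 2 n + 110) *
    (n + m) + (8 * n + 5) + 1) + 1) + 1) + 1) (Ends.straight rfl le_rfl ?_)).le ?_
  swap
  · have : (14 * Nat.log 2 n + 160) * (n + m) =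
      (14 * Nat.log 2 n + 110) * (n + m) + 50 * n + 50 * m := by ring
    omega
  simp (disch := omega) only [Prog.effect, WExp.eval, hj, h.list, Nat.mod_eq_of_lt]
  set s₁ := s₀.setWord 24 0 (lu j) with hs₁
  have hs₁b : s₁.Bounded b := hs.setWord _ _ (by omega)
  have h₁ : Ready G U₀ ρ lu s₁ := h.congr (by simp [hs₁]) (by simp [hs₁])
  have hy₁ : s₁.words 24 0 = lu j := by simp [hs₁]
  refine Ends.seq ((ends_copyEdges hs₁b h₁.m_eq (by omega) (by decide) (by decide)).imp
    fun s₂ hf₂ h₂' => ?_)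
  have hs₂ := hf₂.bounded hs₁b
  have h₂ : Ready G U₀ ρ lu s₂ := h₁.of_frame hf₂ (by decide) (by decide)
  -- Distances to the pivot in `G` are distances from the pivot in the reversed graph.
  have hG₂ : GraphIn G.rev s₂ := ⟨h₂.n_eq, h₂.m_eq,
    fun e => by rw [(h₂' e e.2).1, h₁.tgt]; rfl, fun e => by rw [(h₂' e e.2).2, h₁.src]; rfl,
    h₂.neg, h₂.wt⟩
  refine Ends.seq ((ends_clearSources h₂.n_eq (by omega)).imp fun s₃ hf₃ h₃' => ?_)
  have hs₃ := hf₃.bounded hs₂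
  have h₃ : Ready G U₀ ρ lu s₃ := h₂.of_frame hf₃ (by decide) (by decide)
  have hG₃ : GraphIn G.rev s₃ := hG₂.of_frame hf₃ (by decide) (by decide)
  have hy₃ : s₃.words 24 0 = lu j := by
    rw [hf₃.words 24 (by decide), hf₂.words 24 (by decide), hy₁]
  refine Ends.seq (T₁ := 1) ?_
  have hmark : Ends b (.wset 7 (.var 24) (.const 1)) s₃ 1 fun s' =>
      s'.words 7 = Function.update (s₃.words 7) (lu j) 1 := by
    refine Ends.straight rfl le_rfl ?_
    simp (disch := omega) [Prog.effect, WExp.eval, hy₃, Nat.mod_eq_of_lt]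
  refine hmark.imp fun s₄ hf₄ h₄' => ?_
  have hs₄ := hf₄.bounded hs₃
  have h₄ : Ready G U₀ ρ lu s₄ := h₃.of_frame hf₄ (by decide) (by decide)
  have hG₄ : GraphIn G.rev s₄ := hG₃.of_frame hf₄ (by decide) (by decide)
  refine Ends.seq ((ends_oneHop hs₄ hG₄ hpos hb hn h₄.bound).imp fun s₅ hf₅ h₅' => ?_)
  have hs₅ := hf₅.bounded hs₄
  have h₅ : Ready G U₀ ρ lu s₅ := h₄.of_frame hf₅ (by decide) (by decide)
  have hsign : ∀ v : Fin n, s₅.reals 1 (n + v) < 0 ↔ G.hopDist 1 v (lu j) < 0 := fun v => by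
    rw [h₅' v]
    constructor
    · rintro ⟨u, hu, hd⟩
      rw [h₄'] at hu
      have : u = lu j := by
        by_contra hne
        have hne' : (u : ℕ) ≠ lu j := fun h => hne (Fin.ext h)
        rw [Function.update_of_ne hne', h₃' u u.2] at hu
        exact absurd hu (by norm_num)
      rw [this] at hd
      exact G.hopDist_rev_neg_iff.1 hd
    · intro hd
      exact ⟨lu j, by simp [h₄'], G.hopDist_rev_neg_iff.2 hd⟩
  refine (ends_collect hs₅ h₅.n_eq (by omega) (P := fun v => v ∈ U₀ ∧ G.hopDist 1 v (lu j) < 0)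
    fun s hsb hw hr v hv => ?_).imp fun s₆ hf₆ h₆' => ?_
  · have hm : ∀ a i, s.words a i % 2 ^ b = s.words a i := fun a i => Nat.mod_eq_of_lt (hsb a i)
    simp (disch := omega) only [BExp.Holds, WExp.eval, RExp.eval, hm, Nat.mod_eq_of_lt, hv,
      hw 4 (by decide), hw 0 (by decide), hr, h₅.mem, h₅.n_eq, sub_self, hsign]
    by_cases hvU : v ∈ U₀ <;> simp (disch := omega) [hvU, Nat.mod_eq_of_lt]
  · refine ⟨?_, fun v => ?_, h₆'⟩
    · rw [hf₆.words 24 (by decide), hf₅.words 24 (by decide), hf₄.words 24 (by decide), hy₃]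
    · rw [hf₆.reals 1 (by decide)]; exact hsign v

end Round

end RealRAM

/-! ### Sampling one vertex per block, and correctness of a round -/

namespace RealRAM

/-- The `a`-th element of the `i`-th of `ρ` blocks of equal size. -/
def blockElem {k ρ : ℕ} (i : Fin ρ) (a : Fin (k / ρ)) : Fin k :=
  ⟨i * (k / ρ) + a, by
    have h1 : (i + 1 : ℕ) * (k / ρ) ≤ ρ * (k / ρ) := Nat.mul_le_mul_right _ i.2
    have h2 := Nat.mul_div_le k ρ
    have h3 := a.2
    have h4 : (i + 1 : ℕ) * (k / ρ) = i * (k / ρ) + k / ρ := by ring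
    omega⟩

theorem blockElem_inj {k ρ : ℕ} (i : Fin ρ) (a : Fin (k / ρ)) (j : Fin ρ) (c : Fin (k / ρ))
    (h : blockElem i a = blockElem j c) : i = j ∧ a = c := by
  have h1 : (i : ℕ) * (k / ρ) + a = j * (k / ρ) + c := congrArg Fin.val h
  have hq : 0 < k / ρ := a.pos
  have h2 : (i : ℕ) = j := by
    have e : ∀ (i : Fin ρ) (a : Fin (k / ρ)), (i * (k / ρ) + a) / (k / ρ) = (i : ℕ) := fun i a => by
      rw [mul_comm, Nat.mul_add_div hq, Nat.div_eq_of_lt a.2, add_zero]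
    rw [← e i a, ← e j c, h1]
  refine ⟨Fin.ext h2, Fin.ext ?_⟩
  rw [h2] at h1
  omega

/-- Put the sampled vertices, one from each block, into the source set. -/
def markSample : Prog :=
  .forLoop 13 0 2 (.wset 7 (.get 20 (.add (.mul (.var 13) (.var 22)) (.get 23 (.var 13))))
    (.const 1))

/-- Find the sampled vertices at nonnegative one-hop distances from all sampled vertices. -/
def independentSample : Prog :=
  .seq (copyEdges 1 2) (.seq clearSources (.seq markSample (.seq oneHop
    (collect (.and (.weq (.get 7 (.var 13)) (.const 1))
      (.not (.rlt (.get 1 (.add (.get 0 (.const 0)) (.var 13))) .zero)))))))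

/-- One round, for given outcomes of the random choices. -/
def round : Prog :=
  .seq inNeighbors
    (.cond (.rlt (.get 1 (.add (.get 0 (.const 0)) (.var 24))) .zero)
      (.wset 5 (.const 0) (.const 1))
      (.cond (.not (.wlt (.mul (.mul (.const 16) (.get 0 (.const 2))) (.var 25)) (.var 21)))
        (.seq (.wset 5 (.const 1) (.var 24)) (.wset 5 (.const 0) (.const 2)))
        (.seq independentSample
          (.cond (.not (.wlt (.mul (.const 2) (.var 25)) (.get 0 (.const 2))))
            (.wset 5 (.const 0) (.const 3)) .skip))))

/-- The answer in the memory is correct. -/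
def Correct {n m : ℕ} (G : HopGraph n m) (U₀ : Finset (Fin n)) (ρ : ℕ) (s : Store) : Prop :=
  (s.answerKind = 1 ∧ G.HasNegCycle) ∨
  (s.answerKind = 2 ∧ s.answerSet n ⊆ U₀ ∧
    1 / 16 * ((U₀.card : ℝ) / (ρ : ℝ)) ≤ ((s.answerSet n).card : ℝ) ∧
    ∃ y : Fin n, (y : ℕ) = s.answerVertex ∧ ∀ u ∈ s.answerSet n, G.hopDist 1 u y < 0) ∨
  (s.answerKind = 3 ∧ G.IsOneHopIndep (s.answerSet n) ∧
    1 / 16 * (ρ : ℝ) ≤ ((s.answerSet n).card : ℝ))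

section

variable {n m b ρ : ℕ} {G : HopGraph n m} {U₀ : Finset (Fin n)} {lu : Fin U₀.card → Fin n}
  {s₀ : Store} {R : Fin ρ → Fin (U₀.card / ρ)}

theorem ends_markSample (hs : s₀.Bounded b) (h : Ready G U₀ ρ lu s₀)
    (hb : 4 * (n + m) + 16 < 2 ^ b) (hρ : ρ ≤ U₀.card)
    (hR : ∀ i : Fin ρ, s₀.words 23 i = R i) (h0 : ∀ v < n, s₀.words 7 v = 0) :
    Ends b markSample s₀ (5 * ρ + 3) fun s' => ∀ v : Fin n,
      s'.words 7 v = 1 ↔ ∃ i, v = lu (blockElem i (R i)) := by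
  have hk : U₀.card ≤ n := (Finset.card_le_univ _).trans (by simp)
  refine (Ends.forLoop (T := 1) (N := ρ) (fun i s => ∀ v : Fin n,
      s.words 7 v = 1 ↔ ∃ j : Fin ρ, (j : ℕ) < i ∧ v = lu (blockElem j (R j)))
    (by decide) (by decide) (by omega) h.rho (by omega) ?_ ?_).imp fun s' _ h v => ?_
  · intro v
    simp [h0 v v.2]
  · intro i s hi hf h13 hI
    have hsb := hf.bounded hs
    have h' : Ready G U₀ ρ lu s := h.of_frame hf (by decide) (by decide)
    have h23 : s.words 23 = s₀.words 23 := hf.words 23 (by decide)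
    obtain ⟨j, rfl⟩ : ∃ j : Fin ρ, (j : ℕ) = i := ⟨⟨i, hi⟩, rfl⟩
    have hidx : (j : ℕ) * (U₀.card / ρ) + R j = blockElem j (R j) := rfl
    have hlt := (blockElem j (R j)).2
    have hq : U₀.card / ρ % 2 ^ b = U₀.card / ρ :=
      Nat.mod_eq_of_lt ((Nat.div_le_self _ _).trans_lt (by omega))
    have hmul : (j : ℕ) * (U₀.card / ρ) % 2 ^ b = j * (U₀.card / ρ) :=
      Nat.mod_eq_of_lt (by omega)
    refine Ends.straight rfl le_rfl ?_
    simp (disch := omega) only [Prog.effect, WExp.eval, h13, Nat.mod_eq_of_lt, h'.block, h23, hR,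
      hq, hmul, hidx, h'.list, Store.setWord_words, if_true, if_false, Function.update_self,
      Nat.reduceEqDiff]
    intro v
    by_cases hv : v = lu (blockElem j (R j))
    · rw [hv, Function.update_self]
      simp only [true_iff]
      exact ⟨j, by omega, rfl⟩
    · have hv' : (v : ℕ) ≠ lu (blockElem j (R j)) := fun h => hv (Fin.ext h)
      rw [Function.update_of_ne hv', hI v]
      constructor
      · rintro ⟨i', h1, h2⟩; exact ⟨i', by omega, h2⟩
      · rintro ⟨i', h1, h2⟩
        refine ⟨i', ?_, h2⟩
        have : i' ≠ j := by rintro rfl; exact hv h2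
        have := fun h => this (Fin.ext h)
        omega
  · rw [h v]
    exact exists_congr fun i => and_iff_right i.2

/-- One computation with the whole sample as source set decides for all vertices at once whether
some sampled vertex reaches them negatively. -/
theorem ends_independentSample (hs : s₀.Bounded b) (h : Ready G U₀ ρ lu s₀)
    (hpos : ∀ e, e ∉ G.neg → 0 ≤ G.wt e) (hb : 4 * (n + m) + 16 < 2 ^ b) (hn : 1 ≤ n)
    (hρ : ρ ≤ U₀.card) (hR : ∀ i : Fin ρ, s₀.words 23 i = R i) :
    Ends b independentSample s₀ ((14 * Nat.log 2 n + 160) * (n + m)) fun s' =>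
      (∀ v, v ∈ s'.answerSet n ↔ (∃ i, v = lu (blockElem i (R i))) ∧
        ∀ i, ¬ G.hopDist 1 (lu (blockElem i (R i))) v < 0) ∧
      s'.words 25 0 = (s'.answerSet n).card := by
  have hnm : 1 ≤ n + m := by omega
  have hk : U₀.card ≤ n := (Finset.card_le_univ _).trans (by simp)
  refine (Ends.seq (T₂ := 5 * n + 3 + (5 * ρ + 3 + ((14 * Nat.log 2 n + 110) *
    (n + m) + (8 * n + 5) + 1) + 1) + 1) ((ends_copyEdges hs h.m_eq (by omega) (by decide)
      (by decide)).imp fun s₂ hf₂ h₂' => ?_)).le ?_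
  swap
  · have : (14 * Nat.log 2 n + 160) * (n + m) =
      (14 * Nat.log 2 n + 110) * (n + m) + 50 * n + 50 * m := by ring
    omega
  have hs₂ := hf₂.bounded hs
  have h₂ : Ready G U₀ ρ lu s₂ := h.of_frame hf₂ (by decide) (by decide)
  have hG₂ : GraphIn G s₂ := ⟨h₂.n_eq, h₂.m_eq,
    fun e => by rw [(h₂' e e.2).1, h.src], fun e => by rw [(h₂' e e.2).2, h.tgt],
    h₂.neg, h₂.wt⟩
  refine Ends.seq ((ends_clearSources h₂.n_eq (by omega)).imp fun s₃ hf₃ h₃' => ?_)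
  have hs₃ := hf₃.bounded hs₂
  have h₃ : Ready G U₀ ρ lu s₃ := h₂.of_frame hf₃ (by decide) (by decide)
  have hG₃ : GraphIn G s₃ := hG₂.of_frame hf₃ (by decide) (by decide)
  refine Ends.seq ((ends_markSample (R := R) hs₃ h₃ hb hρ (fun i => ?_) h₃').imp
    fun s₄ hf₄ h₄' => ?_)
  · rw [hf₃.words 23 (by decide), hf₂.words 23 (by decide), hR]
  have hs₄ := hf₄.bounded hs₃
  have h₄ : Ready G U₀ ρ lu s₄ := h₃.of_frame hf₄ (by decide) (by decide)
  have hG₄ : GraphIn G s₄ := hG₃.of_frame hf₄ (by decide) (by decide)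
  refine Ends.seq ((ends_oneHop hs₄ hG₄ hpos hb hn h₄.bound).imp fun s₅ hf₅ h₅' => ?_)
  have hs₅ := hf₅.bounded hs₄
  have h₅ : Ready G U₀ ρ lu s₅ := h₄.of_frame hf₅ (by decide) (by decide)
  have h7 : s₅.words 7 = s₄.words 7 := hf₅.words 7 (by decide)
  have hsign : ∀ v : Fin n, s₅.reals 1 (n + v) < 0 ↔
      ∃ i, G.hopDist 1 (lu (blockElem i (R i))) v < 0 := fun v => by
    rw [h₅' v]
    constructor
    · rintro ⟨u, hu, hd⟩
      obtain ⟨i, rfl⟩ := (h₄' u).1 hu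
      exact ⟨i, hd⟩
    · rintro ⟨i, hd⟩
      exact ⟨_, (h₄' _).2 ⟨i, rfl⟩, hd⟩
  refine (ends_collect hs₅ h₅.n_eq (by omega) fun s hsb hw hr v hv => ?_)
  have hm : ∀ a i, s.words a i % 2 ^ b = s.words a i := fun a i => Nat.mod_eq_of_lt (hsb a i)
  have hm' : ∀ a i, s₄.words a i % 2 ^ b = s₄.words a i := fun a i => Nat.mod_eq_of_lt (hs₄ a i)
  simp (disch := omega) only [BExp.Holds, WExp.eval, RExp.eval, hm, hm', Nat.mod_eq_of_lt, hv,
    hw 7 (by decide), hw 0 (by decide), hr, h₅.n_eq, sub_self, hsign, h7, h₄', not_exists]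

-- The random outcomes `j` and `R` are fixed here. The second conclusion lists the events that force
-- an answer; their joint negation is what `sixteen_mul_card_failures_le` counts.
open Classical in
theorem ends_round (hs : s₀.Bounded b) (h : Ready G U₀ ρ lu s₀)
    (hpos : ∀ e, e ∉ G.neg → 0 ≤ G.wt e) (hU₀ : ∀ u ∈ U₀, G.IsNegVertex u)
    (hb : 4 * (n + m) + 16 < 2 ^ b) (hb' : 16 * n * n < 2 ^ b) (hn : 1 ≤ n)
    (hρ0 : 0 < ρ) (hρ : ρ ≤ U₀.card) (hlu : Function.Injective lu)
    (hluU : ∀ u, u ∈ U₀ ↔ ∃ j, lu j = u) {j : Fin U₀.card} (hj : s₀.words 24 0 = j)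
    (hR : ∀ i : Fin ρ, s₀.words 23 i = R i)
    (h5 : s₀.words 5 0 = 0) :
    Ends b round s₀ ((28 * Nat.log 2 n + 330) * (n + m)) fun s' =>
      (s'.words 5 0 = 0 ∨ Correct G U₀ ρ s') ∧
      ((G.hopDist 1 (lu j) (lu j) < 0 ∨
        U₀.card ≤ 16 * ρ * (Finset.univ.filter fun i => G.hopDist 1 (lu i) (lu j) < 0).card ∨
        ρ ≤ 2 * (Finset.univ.filter fun i => ∀ i',
          ¬ G.hopDist 1 (lu (blockElem i' (R i'))) (lu (blockElem i (R i))) < 0).card) →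
        s'.words 5 0 ≠ 0) := by
  have hnm : 1 ≤ n + m := by omega
  have hk : U₀.card ≤ n := (Finset.card_le_univ _).trans (by simp)
  refine (Ends.seq (T₂ := (14 * Nat.log 2 n + 160) * (n + m) + (1 + 1) + 1 + 1 + 1)
    ((ends_inNeighbors hs h hpos hb hn hj).imp fun s₁ hf₁ h₁' => ?_)).le ?_
  swap
  · have : (28 * Nat.log 2 n + 330) * (n + m) =
      2 * ((14 * Nat.log 2 n + 160) * (n + m)) + 10 * n + 10 * m := by ring
    omega
  have hs₁ := hf₁.bounded hs
  have h₁ : Ready G U₀ ρ lu s₁ := h.of_frame hf₁ (by decide) (by decide)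
  obtain ⟨h24, hsign, hset, hcount⟩ := h₁'
  have h5₁ : s₁.words 5 0 = 0 := by rw [hf₁.words 5 (by decide), h5]
  have hm : ∀ a i, s₁.words a i % 2 ^ b = s₁.words a i := fun a i => Nat.mod_eq_of_lt (hs₁ a i)
  have hb0 : b ≠ 0 := by rintro rfl; omega
  have hcn : (s₁.answerSet n).card ≤ n := (Finset.card_le_univ _).trans (by simp)
  -- Both `ρ` and the set size are at most `n`, so the product in the threshold test does not
  -- overflow.
  have hprod : 16 * ρ * (s₁.answerSet n).card < 2 ^ b :=
    lt_of_le_of_lt (Nat.mul_le_mul (Nat.mul_le_mul_left _ (hρ.trans hk)) hcn) hb'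
  have h16ρ : 16 * ρ < 2 ^ b := by
    refine lt_of_le_of_lt ?_ hb'
    rw [mul_assoc]
    exact Nat.mul_le_mul_left _ ((hρ.trans hk).trans (Nat.le_mul_of_pos_left _ hn))
  have hcard : (Finset.univ.filter fun i => G.hopDist 1 (lu i) (lu j) < 0).card =
      (s₁.answerSet n).card := by
    rw [← Finset.card_image_of_injective _ hlu]
    congr 1
    ext v
    simp only [Finset.mem_image, Finset.mem_filter, Finset.mem_univ, true_and, hset, hluU]
    constructor
    · rintro ⟨i, hi, rfl⟩; exact ⟨⟨i, rfl⟩, hi⟩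
    · rintro ⟨⟨i, rfl⟩, hi⟩; exact ⟨i, hi, rfl⟩
  rw [hcard]
  refine Ends.cond (fun hc => ?_) fun hc => ?_
  all_goals
    simp (disch := omega) only [BExp.Holds, WExp.eval, RExp.eval, hm, Nat.mod_eq_of_lt, h24,
      h₁.n_eq, sub_self, hsign] at hc
  · refine Ends.straight rfl (Nat.le_add_left _ _) ?_
    simp (disch := omega) only [Prog.effect, WExp.eval, Nat.mod_eq_of_lt]
    refine ⟨Or.inr (Or.inl ⟨by simp [Store.answerKind], ?_⟩), by simp⟩
    obtain ⟨p, hp, -, hw⟩ := G.hopDist_neg_iff.1 hc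
    exact ⟨_, p, hp, hw⟩
  refine Ends.cond (fun hc2 => ?_) fun hc2 => ?_
  all_goals
    simp (disch := omega) only [BExp.Holds, WExp.eval, hm, Nat.mod_eq_of_lt,
      h₁.rho, h₁.card, hcount, not_lt, Nat.mod_eq_of_lt hprod] at hc2
  · refine Ends.straight rfl (by simp [Prog.cost]) ?_
    simp (disch := omega) only [Prog.effect, WExp.eval, Nat.mod_eq_of_lt, h24]
    refine ⟨Or.inr (Or.inr (Or.inl ⟨by simp [Store.answerKind], ?_⟩)), by simp⟩
    have hset' : ∀ x y z, ((s₁.setWord 5 1 x).setWord 5 y z).answerSet n = s₁.answerSet n :=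
      fun _ _ _ => by simp [Store.answerSet]
    rw [hset']
    refine ⟨fun u hu => ((hset u).1 hu).1, ?_, lu j, by simp [Store.answerVertex],
      fun u hu => ((hset u).1 hu).2⟩
    rw [← mul_div_assoc, div_le_iff₀ (by exact_mod_cast hρ0)]
    have : (U₀.card : ℝ) ≤ 16 * ρ * (s₁.answerSet n).card := by exact_mod_cast hc2
    linarith
  refine Ends.seq ((ends_independentSample (R := R) hs₁ h₁ hpos hb hn hρ fun i => ?_).imp
    fun s₂ hf₂ h₂' => ?_)
  · rw [hf₁.words 23 (by decide), hR]
  have hs₂ := hf₂.bounded hs₁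
  have h₂ : Ready G U₀ ρ lu s₂ := h₁.of_frame hf₂ (by decide) (by decide)
  obtain ⟨hset₂, hcount₂⟩ := h₂'
  have h5₂ : s₂.words 5 0 = 0 := by rw [hf₂.words 5 (by decide), h5₁]
  have hcn₂ : (s₂.answerSet n).card ≤ n := (Finset.card_le_univ _).trans (by simp)
  have hcard₂ : (Finset.univ.filter fun i => ∀ i',
      ¬ G.hopDist 1 (lu (blockElem i' (R i'))) (lu (blockElem i (R i))) < 0).card ≤
      (s₂.answerSet n).card := by
    have hinj : Function.Injective fun i => lu (blockElem i (R i)) := fun i i' h =>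
      (blockElem_inj _ _ _ _ (hlu h)).1
    rw [← Finset.card_image_of_injective _ hinj]
    refine Finset.card_le_card fun v hv => ?_
    simp only [Finset.mem_image, Finset.mem_filter, Finset.mem_univ, true_and] at hv
    obtain ⟨i, hi, rfl⟩ := hv
    exact (hset₂ _).2 ⟨⟨i, rfl⟩, hi⟩
  have hm₂ : ∀ a i, s₂.words a i % 2 ^ b = s₂.words a i := fun a i => Nat.mod_eq_of_lt (hs₂ a i)
  refine Ends.cond (fun hc3 => ?_) fun hc3 => ?_
  all_goals
    simp (disch := omega) only [BExp.Holds, WExp.eval, hm₂, Nat.mod_eq_of_lt,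
      h₂.rho, hcount₂, not_lt, not_le] at hc3
  · refine Ends.straight rfl le_rfl ?_
    simp (disch := omega) only [Prog.effect, WExp.eval, Nat.mod_eq_of_lt]
    refine ⟨Or.inr (Or.inr (Or.inr ⟨by simp [Store.answerKind], ?_⟩)), by simp⟩
    have hset' : ∀ x y, (s₂.setWord 5 x y).answerSet n = s₂.answerSet n :=
      fun _ _ => by simp [Store.answerSet]
    rw [hset']
    refine ⟨⟨fun x hx => ?_, fun x hx y hy => ?_⟩, ?_⟩
    · obtain ⟨⟨i, rfl⟩, -⟩ := (hset₂ x).1 hx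
      exact hU₀ _ ((hluU _).2 ⟨_, rfl⟩)
    · obtain ⟨⟨i, rfl⟩, hi⟩ := (hset₂ x).1 hx
      obtain ⟨⟨i', rfl⟩, hi'⟩ := (hset₂ y).1 hy
      -- Each kept vertex is safe from the whole sample, which excludes both directions of the
      -- relation.
      exact fun h => h.elim (hi' i) (hi i')
    · have : (ρ : ℝ) ≤ 2 * (s₂.answerSet n).card := by exact_mod_cast hc3
      linarith [Nat.cast_nonneg (α := ℝ) ρ]
  · refine Ends.straight rfl le_rfl ?_
    simp only [Prog.effect]
    refine ⟨Or.inl h5₂, fun h => ?_⟩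
    rcases h with h | h | h
    · exact absurd h hc
    · omega
    · omega

end

end RealRAM

/-! ## The main loop -/

namespace RealRAM

theorem Prog.Frame.of_setWord {b : ℕ} {p : Prog} {a : ℕ} (ha : a ∈ p.wmods) (s : Store) (i : ℕ)
    {x : ℕ} (hx : x < 2 ^ b) : p.Frame b s (s.setWord a i x) := by
  refine ⟨fun c hc => ?_, fun _ _ => rfl, fun h => h.setWord _ _ hx⟩
  have : c ≠ a := by rintro rfl; exact hc ha
  simp [this]

/-- Draw an offset for each block. -/
def drawOffsets : Prog := .forLoop 13 0 2 (.rand 23 (.var 13) (.var 22))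

def drawOffsetsLoop : Prog :=
  .loop (.wlt (.var 13) (.get 0 (.const 2))) (.seq (.rand 23 (.var 13) (.var 22))
    (.wset 13 (.const 0) (.add (.var 13) (.const 1))))

section

variable {b q ρ : ℕ} {Q : Store → Prop}

/-- Induction on the number `l` of offsets still to be drawn: a function on `Fin (l + 1)` splits
into the next draw and the remaining ones. The bound `g` may depend on all outcomes. -/
theorem failProb_drawOffsetsLoop (hb : ρ + 2 < 2 ^ b) (hq : 0 < q) (hqb : q < 2 ^ b)
    (k : List Prog) (t l i : ℕ) (hil : i + l = ρ) {s : Store} (hs : s.Bounded b)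
    (h13 : s.words 13 0 = i) (h22 : s.words 22 0 = q) (h02 : s.words 0 2 = ρ)
    (g : (Fin l → Fin q) → ENNReal)
    (hg : ∀ R s', drawOffsets.Frame b s s' → (∀ j < i, s'.words 23 j = s.words 23 j) →
      (∀ j : Fin l, s'.words 23 (i + j) = R j) → failProb b Q t ⟨k, s'⟩ ≤ g R) :
    (q : ENNReal) ^ l * failProb b Q (t + 4 * l + 1) ⟨drawOffsetsLoop :: k, s⟩ ≤ ∑ R, g R := by
  have hm2 : 2 < 2 ^ b := by omega
  induction l generalizing i s with
  | zero =>
    have hc : ¬ (BExp.wlt (.var 13) (.get 0 (.const 2))).Holds b s := by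
      simp (disch := omega) only [BExp.Holds, WExp.eval, Nat.mod_eq_of_lt, h13, h02]
      omega
    have e := (Exec.loopF (b := b) (p := .seq (.rand 23 (.var 13) (.var 22))
      (.wset 13 (.const 0) (.add (.var 13) (.const 1)))) hc).failProb_eq (Q := Q) k t
    rw [pow_zero, one_mul, Fintype.sum_unique, mul_zero, add_zero, add_comm]
    refine e.trans_le (hg _ _ (.refl _ _ _) (fun _ _ => rfl) fun j => j.elim0)
  | succ l ih =>
    have hc : (BExp.wlt (.var 13) (.get 0 (.const 2))).Holds b s := by
      simp (disch := omega) only [BExp.Holds, WExp.eval, Nat.mod_eq_of_lt, h13, h02]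
      omega
    have e : (q : ENNReal) *
        failProb b Q (t + 4 * (l + 1) + 1) ⟨drawOffsetsLoop :: k, s⟩ =
        ∑ r : Fin q, failProb b Q (t + 4 * l + 1)
          ⟨drawOffsetsLoop :: k, (s.setWord 23 i r).setWord 13 0 (i + 1)⟩ := by
      -- Each draw takes four steps: loop test, sequencing, random write, counter increment.
      rw [show t + 4 * (l + 1) + 1 = (t + 4 * l + 1) + 1 + 1 + 1 + 1 by ring, drawOffsetsLoop,
        failProb_loop _ _ _ hc, failProb_seq,
        failProb_rand (N := q) (j := i) _ _ (by simp (disch := omega) [WExp.eval, h22,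
          Nat.mod_eq_of_lt]) (by simp (disch := omega) [WExp.eval, h13, Nat.mod_eq_of_lt]) hq]
      refine Finset.sum_congr rfl fun r _ => ?_
      have e' := (Exec.wset (b := b) 13 (.const 0) (.add (.var 13) (.const 1))
        (s.setWord 23 i r)).failProb_eq (Q := Q) (drawOffsetsLoop :: k) (t + 4 * l + 1)
      rw [add_comm 1] at e'
      refine e'.trans ?_
      simp (disch := omega) [WExp.eval, h13, Nat.mod_eq_of_lt]
      rfl
    rw [pow_succ, mul_assoc, e, Finset.mul_sum]
    have hsum : ∑ R, g R = ∑ r : Fin q, ∑ R' : Fin l → Fin q, g (Fin.cons r R') := by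
      rw [← Fintype.sum_prod_type' fun (r : Fin q) (R' : Fin l → Fin q) =>
        g (Fin.cons r R' : Fin (l + 1) → Fin q)]
      exact (Fintype.sum_equiv (Fin.consEquiv fun _ => Fin q) _ _ fun _ => rfl).symm
    rw [hsum]
    refine Finset.sum_le_sum fun r _ => ?_
    have hf : drawOffsets.Frame b s ((s.setWord 23 i r).setWord 13 0 (i + 1)) :=
      (Prog.Frame.of_setWord (by decide) _ _ (by omega)).trans
        (Prog.Frame.of_setWord (by decide) _ _ (by omega))
    refine ih (i + 1) (by omega) (hf.bounded hs) (by simp)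
      (by rw [hf.words 22 (by decide), h22]) (by rw [hf.words 0 (by decide), h02]) _
      fun R' s' hf' h1 h2 => ?_
    refine hg _ s' (hf.trans hf') (fun j hj => ?_) fun j => ?_
    · rw [h1 j (by omega)]
      simp [show j ≠ i by omega]
    · refine Fin.cases ?_ (fun j => ?_) j
      · rw [Fin.val_zero, add_zero, h1 i (by omega)]; simp
      · rw [Fin.val_succ, show i + (j + 1 : ℕ) = i + 1 + j by ring, h2]; simp

theorem failProb_drawOffsets (hb : ρ + 2 < 2 ^ b) (hq : 0 < q) (hqb : q < 2 ^ b)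
    (k : List Prog) (t : ℕ) {s : Store} (hs : s.Bounded b)
    (h22 : s.words 22 0 = q) (h02 : s.words 0 2 = ρ) (g : (Fin ρ → Fin q) → ENNReal)
    (hg : ∀ R s', drawOffsets.Frame b s s' → (∀ j : Fin ρ, s'.words 23 j = R j) →
      failProb b Q t ⟨k, s'⟩ ≤ g R) :
    (q : ENNReal) ^ ρ * failProb b Q (t + 4 * ρ + 3) ⟨drawOffsets :: k, s⟩ ≤ ∑ R, g R := by
  have hf : drawOffsets.Frame b s (s.setWord 13 0 0) :=
    Prog.Frame.of_setWord (by decide) _ _ (by omega)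
  have e : failProb b Q (t + 4 * ρ + 3) ⟨drawOffsets :: k, s⟩ =
      failProb b Q (t + 4 * ρ + 1) ⟨drawOffsetsLoop :: k, s.setWord 13 0 0⟩ := by
    rw [drawOffsets, Prog.forLoop, failProb_seq]
    have e' := (Exec.wset (b := b) 13 (.const 0) (.const 0) s).failProb_eq (Q := Q)
      (drawOffsetsLoop :: k) (t + 4 * ρ + 1)
    rw [add_comm 1] at e'
    refine e'.trans ?_
    simp [WExp.eval]
  rw [e]
  refine failProb_drawOffsetsLoop hb hq hqb k t ρ 0 (by omega) (hf.bounded hs) (by simp)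
    (by rw [hf.words 22 (by decide), h22]) (by rw [hf.words 0 (by decide), h02]) g
    fun R s' hf' _ h => hg R s' (hf.trans hf') fun j => ?_
  rw [← h j, zero_add]

end

/-- Repeat rounds with fresh random choices until there is an answer. -/
def mainLoop : Prog :=
  .loop (.weq (.var 5) (.const 0))
    (.seq (.rand 24 (.const 0) (.var 21)) (.seq drawOffsets round))

section

variable {n m b ρ : ℕ} {G : HopGraph n m} {U₀ : Finset (Fin n)} {lu : Fin U₀.card → Fin n}

/-- Induction on the number of rounds. A round with outcome outside `bad` ends in a correct answer,
a bad one restarts from a memory satisfying the same hypotheses, and at most `15/16` of the outcomes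
are bad. -/
theorem failProb_mainLoop (hpos : ∀ e, e ∉ G.neg → 0 ≤ G.wt e)
    (hU₀ : ∀ u ∈ U₀, G.IsNegVertex u) (hb : 4 * (n + m) + 16 < 2 ^ b) (hb' : 16 * n * n < 2 ^ b)
    (hρ0 : 0 < ρ) (hρ : ρ ≤ U₀.card) (hlu : Function.Injective lu)
    (hluU : ∀ u, u ∈ U₀ ↔ ∃ j, lu j = u) (r : ℕ) {s : Store} (hs : s.Bounded b)
    (h : Ready G U₀ ρ lu s) (h5 : s.words 5 0 = 0 ∨ Correct G U₀ ρ s) :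
    failProb b (Correct G U₀ ρ) (r * ((28 * Nat.log 2 n + 345) * (n + m)) + 1)
      ⟨[mainLoop], s⟩ ≤ (15 / 16) ^ r := by
  classical
  induction r generalizing s with
  | zero => rw [pow_zero]; exact failProb_le_one _ _
  | succ r ih =>
    have hk : U₀.card ≤ n := (Finset.card_le_univ _).trans (by simp)
    have hm : s.words 5 0 % 2 ^ b = s.words 5 0 := Nat.mod_eq_of_lt (hs 5 0)
    by_cases h50 : s.words 5 0 = 0
    swap
    · have hc : ¬ (BExp.weq (.var 5) (.const 0)).Holds b s := by
        simpa [BExp.Holds, WExp.eval, hm] using h50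
      have e := (Exec.loopF (b := b)
        (p := .seq (.rand 24 (.const 0) (.var 21)) (.seq drawOffsets round)) hc).failProb_eq
          (Q := Correct G U₀ ρ) [] ((r + 1) * ((28 * Nat.log 2 n + 345) * (n + m)))
      rw [add_comm, mainLoop, e, failProb_halted _ (h5.resolve_left h50)]
      exact zero_le
    have hc : (BExp.weq (.var 5) (.const 0)).Holds b s := by
      simpa [BExp.Holds, WExp.eval, hm] using h50
    set q := U₀.card / ρ with hqdef
    have hq : 0 < q := Nat.div_pos hρ hρ0
    have hqk : q ≤ U₀.card := Nat.div_le_self _ _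
    set X : ENNReal := (15 / 16) ^ r with hX
    set A : Fin U₀.card → Fin U₀.card → Prop := fun u y => G.hopDist 1 (lu u) (lu y) < 0 with hA
    set good : Fin U₀.card → Prop := fun y => A y y ∨
      U₀.card ≤ 16 * ρ * (Finset.univ.filter fun u => A u y).card with hgood
    set bad : Fin U₀.card × (Fin ρ → Fin q) → Prop := fun p => ¬ good p.1 ∧
      2 * (Finset.univ.filter fun i => ∀ j, ¬ A (blockElem j (p.2 j))
        (blockElem i (p.2 i))).card < ρ with hbad
    set T := (28 * Nat.log 2 n + 330) * (n + m) with hT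
    set t := r * ((28 * Nat.log 2 n + 345) * (n + m)) + 1 with ht
    have hround : ∀ (y : Fin U₀.card) (R : Fin ρ → Fin q) (s' : Store), s'.Bounded b →
        Ready G U₀ ρ lu s' → s'.words 24 0 = y → (∀ j : Fin ρ, s'.words 23 j = R j) →
        s'.words 5 0 = 0 → failProb b (Correct G U₀ ρ) (T + t) ⟨round :: [mainLoop], s'⟩ ≤
          if bad (y, R) then X else 0 := by
      intro y R s' hs' h' h24 h23 h5'
      refine (ends_round hs' h' hpos hU₀ hb hb' (by omega) hρ0 hρ hlu hluU h24 h23 h5').failProb_le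
        [mainLoop] t fun s'' hf hs'' => ?_
      have hb'' := hf.bounded hs'
      by_cases hbd : bad (y, R)
      · rw [if_pos hbd]
        exact ih hb'' (h'.of_frame hf (by decide) (by decide)) hs''.1
      · rw [if_neg hbd]
        have h5'' : s''.words 5 0 ≠ 0 := by
          apply hs''.2
          simp only [hbad, hgood, not_and_or, not_not, not_lt] at hbd
          rcases hbd with (hbd | hbd) | hbd
          · exact Or.inl hbd
          · exact Or.inr (Or.inl hbd)
          · exact Or.inr (Or.inr hbd)
        have hc'' : ¬ (BExp.weq (.var 5) (.const 0)).Holds b s'' := by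
          simpa [BExp.Holds, WExp.eval, Nat.mod_eq_of_lt (hb'' 5 0)] using h5''
        have e := (Exec.loopF (b := b)
          (p := .seq (.rand 24 (.const 0) (.var 21)) (.seq drawOffsets round)) hc'').failProb_eq
            (Q := Correct G U₀ ρ) [] (r * ((28 * Nat.log 2 n + 345) * (n + m)))
        rw [ht, add_comm, mainLoop, e, failProb_halted _ (hs''.1.resolve_left h5'')]
    have hdraw : ∀ y : Fin U₀.card, (q : ENNReal) ^ ρ *
        failProb b (Correct G U₀ ρ) (T + t + 4 * ρ + 3)
          ⟨drawOffsets :: round :: [mainLoop], s.setWord 24 0 y⟩ ≤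
        ∑ R, if bad (y, R) then X else 0 := by
      intro y
      have hs' : (s.setWord 24 0 y).Bounded b := hs.setWord _ _ (by omega)
      have h' : Ready G U₀ ρ lu (s.setWord 24 0 y) := h.congr (by simp) (by simp)
      refine failProb_drawOffsets (by omega) hq (by omega) _ _ hs' h'.block h'.rho _
        fun R s' hf hR => hround y R s' (hf.bounded hs')
          (h'.of_frame hf (by decide) (by decide)) ?_ hR ?_
      · rw [hf.words 24 (by decide)]; simp
      · rw [hf.words 5 (by decide)]; simpa using h50
    have htime : T + t + 4 * ρ + 3 + 1 + 1 + 1 + 1 ≤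
        (r + 1) * ((28 * Nat.log 2 n + 345) * (n + m)) + 1 := by
      have : (28 * Nat.log 2 n + 345) * (n + m) = T + 15 * n + 15 * m := by rw [hT]; ring
      rw [ht, Nat.add_mul r 1, Nat.one_mul]
      omega
    have hstep : (U₀.card : ENNReal) * failProb b (Correct G U₀ ρ)
        (T + t + 4 * ρ + 3 + 1 + 1 + 1 + 1) ⟨[mainLoop], s⟩ =
        ∑ y : Fin U₀.card, failProb b (Correct G U₀ ρ) (T + t + 4 * ρ + 3)
          ⟨drawOffsets :: round :: [mainLoop], s.setWord 24 0 y⟩ := by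
      rw [mainLoop, failProb_loop _ _ _ hc, failProb_seq,
        failProb_rand (N := U₀.card) (j := 0) _ _ (by simp (disch := omega) [WExp.eval, h.card,
          Nat.mod_eq_of_lt]) (by simp [WExp.eval]) (by omega)]
      exact Finset.sum_congr rfl fun y _ => failProb_seq _ _ _ _ _
    have hbadcard : 16 * (Finset.univ.filter bad).card ≤ 15 * (U₀.card * q ^ ρ) := by
      convert sixteen_mul_card_failures_le hρ0 hq ?_ blockElem_inj A good fun y hy => ?_
      -- The blocks omit a remainder of fewer than `ρ` vertices: `k < ρ(q + 1) ≤ 2ρq` because `q ≥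
      -- 1`.
      · have h1 := Nat.lt_mul_div_succ U₀.card hρ0
        have h2 : ρ * 1 ≤ ρ * q := Nat.mul_le_mul_left _ hq
        rw [← hqdef, Nat.mul_add] at h1
        omega
      · simp only [hgood, not_or, not_le] at hy
        refine ⟨hy.1, le_of_eq_of_le ?_ hy.2.le⟩
        congr!
    refine (failProb_antitone _ htime).trans ?_
    set F := failProb b (Correct G U₀ ρ) (T + t + 4 * ρ + 3 + 1 + 1 + 1 + 1) ⟨[mainLoop], s⟩
      with hF
    -- Summing over pivots and offsets, only bad outcomes contribute, each at most the failure
    -- probability `X` of the remaining `r` rounds.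
    have hmain : (q : ENNReal) ^ ρ * (U₀.card * F) ≤ (Finset.univ.filter bad).card * X := by
      rw [hF, hstep, Finset.mul_sum]
      refine (Finset.sum_le_sum fun y _ => hdraw y).trans ?_
      rw [← Fintype.sum_prod_type' fun (y : Fin U₀.card) (R : Fin ρ → Fin q) =>
        if bad (y, R) then X else 0]
      rw [← Finset.sum_filter, Finset.sum_const, nsmul_eq_mul]
    have hmain' : ((U₀.card * q ^ ρ : ℕ) : ENNReal) * (16 * F) ≤
        ((U₀.card * q ^ ρ : ℕ) : ENNReal) * (15 * X) := by
      calc ((U₀.card * q ^ ρ : ℕ) : ENNReal) * (16 * F)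
          = 16 * ((q : ENNReal) ^ ρ * (U₀.card * F)) := by push_cast; ring
        _ ≤ 16 * ((Finset.univ.filter bad).card * X) := by gcongr
        _ = ((16 * (Finset.univ.filter bad).card : ℕ) : ENNReal) * X := by push_cast; ring
        _ ≤ ((15 * (U₀.card * q ^ ρ) : ℕ) : ENNReal) * X := by gcongr
        _ = _ := by push_cast; ring
    have hne : ((U₀.card * q ^ ρ : ℕ) : ENNReal) ≠ 0 := by
      rw [Nat.cast_ne_zero]
      have : 0 < q ^ ρ := pow_pos hq _
      exact (Nat.mul_pos (by omega) this).ne'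
    rw [ENNReal.mul_le_mul_iff_right hne (ENNReal.natCast_ne_top _)] at hmain'
    rw [pow_succ, ← hX, ← mul_div_assoc, ENNReal.le_div_iff_mul_le (by simp) (by simp), mul_comm F,
      mul_comm X]
    exact hmain'

end

end RealRAM

/-! ## The algorithm -/

namespace RealRAM

/-- List the vertices of `U₀`. -/
def listSources : Prog :=
  .forLoop 13 0 0 (.cond (.weq (.get 4 (.var 13)) (.const 1))
    (.seq (.wset 20 (.var 21) (.var 13)) (.wset 21 (.const 0) (.add (.var 21) (.const 1)))) .skip)

/-- Sum up the absolute values of the weights. -/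
def sumWeights : Prog :=
  .forLoop 13 0 1 (.cond (.rlt (.get 0 (.var 13)) .zero)
    (.rset 2 (.const 0) (.sub (.get 2 (.const 0)) (.get 0 (.var 13))))
    (.rset 2 (.const 0) (.add (.get 2 (.const 0)) (.get 0 (.var 13)))))

def preprocess : Prog :=
  .seq listSources (.seq sumWeights (.wset 22 (.const 0) (.div (.var 21) (.get 0 (.const 2)))))

def algorithm : Prog := .seq preprocess mainLoop

section

variable {n m b ρ : ℕ} {G : HopGraph n m} {U₀ : Finset (Fin n)} {s₀ : Store}

theorem ends_listSources (hs : s₀.Bounded b) (hb : 4 * (n + m) + 16 < 2 ^ b)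
    (hn : s₀.words 0 0 = n) (hU : ∀ v : Fin n, s₀.words 4 v = if v ∈ U₀ then 1 else 0)
    (hk : s₀.words 21 0 = 0) :
    Ends b listSources s₀ (8 * n + 3) fun s' => s'.words 21 0 = U₀.card ∧
      ∃ lu : Fin U₀.card → Fin n, Function.Injective lu ∧ (∀ u, u ∈ U₀ ↔ ∃ j, lu j = u) ∧
        ∀ j : Fin U₀.card, s'.words 20 j = lu j := by
  have hb0 : b ≠ 0 := by rintro rfl; omega
  refine (Ends.forLoop (T := 4) (N := n) (fun i s => ∃ L : List (Fin n), L.Nodup ∧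
      (∀ u, u ∈ L ↔ u ∈ U₀ ∧ (u : ℕ) < i) ∧ s.words 21 0 = L.length ∧
      ∀ (t : ℕ) (ht : t < L.length), s.words 20 t = L[t])
    (by decide) (by decide) (by omega) hn (by omega) ?_ ?_).imp fun s' _ h => ?_
  · exact ⟨[], by simp, by simp, by simp [hk], by simp⟩
  · rintro i s hi hf h13 ⟨L, h1, h2, h3, h4⟩
    obtain ⟨v, rfl⟩ : ∃ v : Fin n, (v : ℕ) = i := ⟨⟨i, hi⟩, rfl⟩
    have hsb := hf.bounded hs
    have hm : ∀ a i, s.words a i % 2 ^ b = s.words a i := fun a i => Nat.mod_eq_of_lt (hsb a i)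
    have hU' : s.words 4 v = if v ∈ U₀ then 1 else 0 := by rw [hf.words 4 (by decide), hU]
    have hlen : L.length ≤ n := by simpa using h1.length_le_card
    refine Ends.straight rfl le_rfl ?_
    by_cases hv : v ∈ U₀
    · simp (disch := omega) only [Prog.effect, BExp.Holds, WExp.eval, hm, h13, Nat.mod_eq_of_lt,
        hU', hv, if_true, h3, Store.setWord_words, if_false, Nat.reduceEqDiff]
      refine ⟨L ++ [v], ?_, fun u => ?_, by simp, fun t ht => ?_⟩
      · refine h1.append (List.nodup_singleton v) ?_
        rw [List.disjoint_singleton, h2]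
        simp
      · rw [List.mem_append, h2, List.mem_singleton]
        constructor
        · rintro (h | rfl)
          · exact ⟨h.1, by omega⟩
          · exact ⟨hv, by omega⟩
        · rintro ⟨h5, h6⟩
          by_cases huv : u = v
          · exact Or.inr huv
          · have := fun h => huv (Fin.ext h)
            exact Or.inl ⟨h5, by omega⟩
      · rw [List.length_append, List.length_singleton] at ht
        by_cases htL : t = L.length
        · subst htL; simp
        · rw [Function.update_of_ne htL, List.getElem_append_left (by omega)]
          exact h4 t (by omega)
    · simp (disch := omega) only [Prog.effect, BExp.Holds, WExp.eval, hm, h13, Nat.mod_eq_of_lt,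
        hU', hv, if_false, zero_ne_one, Store.setWord_words, Nat.reduceEqDiff]
      refine ⟨L, h1, fun u => ?_, h3, h4⟩
      rw [h2]
      refine and_congr_right fun hu => ?_
      have : u ≠ v := by rintro rfl; exact hv hu
      have := fun h => this (Fin.ext h)
      omega
  · obtain ⟨L, h1, h2, h3, h4⟩ := h
    have hL : L.toFinset = U₀ := by
      ext u
      rw [List.mem_toFinset, h2]
      exact and_iff_left u.2
    have hlen : L.length = U₀.card := by rw [← hL, List.toFinset_card_of_nodup h1]
    refine ⟨by rw [h3, hlen], fun j => L[(j : ℕ)], fun i j hij => ?_, fun u => ?_,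
      fun j => h4 j (by omega)⟩
    · exact Fin.ext ((h1.getElem_inj_iff).1 hij)
    · have hmemL : u ∈ U₀ ↔ u ∈ L := by rw [h2]; exact (and_iff_left u.2).symm
      rw [hmemL, List.mem_iff_getElem]
      constructor
      · rintro ⟨t, ht, rfl⟩; exact ⟨⟨t, by omega⟩, rfl⟩
      · rintro ⟨j, rfl⟩; exact ⟨j, by omega, rfl⟩

/-- The accumulated sum only grows, so once it compensates the weight of an edge it keeps doing so.
It serves as the stand-in `M` for infinity. -/
theorem ends_sumWeights (hb : 4 * (n + m) + 16 < 2 ^ b)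
    (hm : s₀.words 0 1 = m) (hwt : ∀ e : Fin m, s₀.reals 0 e = G.wt e) (h0 : s₀.reals 2 0 = 0) :
    Ends b sumWeights s₀ (6 * m + 3) fun s' => ∀ e, 0 ≤ s'.reals 2 0 + G.wt e := by
  refine (Ends.forLoop (T := 2) (N := m) (fun i s => 0 ≤ s.reals 2 0 ∧
      ∀ e : Fin m, (e : ℕ) < i → 0 ≤ s.reals 2 0 + G.wt e)
    (by decide) (by decide) (by omega) hm (by omega) ?_ ?_).imp fun s' _ h e => h.2 e e.2
  · simp [h0]
  · rintro i s hi hf h13 ⟨h1, h2⟩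
    obtain ⟨e, rfl⟩ : ∃ e : Fin m, (e : ℕ) = i := ⟨⟨i, hi⟩, rfl⟩
    have hw : s.reals 0 e = G.wt e := by rw [hf.reals 0 (by decide), hwt]
    refine Ends.straight rfl le_rfl ?_
    simp (disch := omega) only [Prog.effect, BExp.Holds, WExp.eval, RExp.eval, h13,
      Nat.mod_eq_of_lt, Nat.zero_mod, hw, sub_self]
    have key : ∀ x : ℝ, s.reals 2 0 ≤ x → 0 ≤ x + G.wt e → 0 ≤ x ∧
        ∀ e' : Fin m, (e' : ℕ) < e + 1 → 0 ≤ x + G.wt e' := fun x hx hxe => by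
      refine ⟨h1.trans hx, fun e' he' => ?_⟩
      by_cases hee : e' = e
      · rw [hee]; exact hxe
      · have := h2 e' (by have := fun h => hee (Fin.ext h); omega)
        linarith
    split_ifs with hlt
    · simpa using key (s.reals 2 0 - G.wt e) (by linarith) (by linarith)
    · simpa using key (s.reals 2 0 + G.wt e) (by linarith) (by linarith)

theorem inputStore_bounded (hb : 4 * (n + m) + 16 < 2 ^ b) (hρ : ρ ≤ n) :
    (inputStore G U₀ ρ).Bounded b := by
  have hcells : ∀ {l : ℕ} (f : Fin l → ℕ), (∀ i, f i < 2 ^ b) → ∀ i, cells f i < 2 ^ b := by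
    intro l f hf i
    unfold cells
    split_ifs
    · exact hf _
    · exact Nat.two_pow_pos _
  intro a i
  simp only [inputStore]
  split
  · refine hcells _ (fun i => ?_) i
    fin_cases i <;> simp <;> omega
  · exact hcells _ (fun i => by omega) i
  · exact hcells _ (fun i => by omega) i
  · exact hcells _ (fun i => by split_ifs <;> omega) i
  · exact hcells _ (fun i => by split_ifs <;> omega) i
  · exact Nat.two_pow_pos _

theorem ends_preprocess (hb : 4 * (n + m) + 16 < 2 ^ b) (hρ : ρ ≤ U₀.card) :
    Ends b preprocess (inputStore G U₀ ρ) (14 * (n + m) + 9) fun s' =>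
      s'.Bounded b ∧ s'.words 5 0 = 0 ∧ ∃ lu : Fin U₀.card → Fin n, Function.Injective lu ∧
        (∀ u, u ∈ U₀ ↔ ∃ j, lu j = u) ∧ Ready G U₀ ρ lu s' := by
  have hk : U₀.card ≤ n := (Finset.card_le_univ _).trans (by simp)
  set s₀ := inputStore G U₀ ρ with hs₀
  have hs : s₀.Bounded b := inputStore_bounded hb (hρ.trans hk)
  have e0 : s₀.words 0 0 = n := by simp [hs₀, inputStore, cells]
  have e1 : s₀.words 0 1 = m := by simp [hs₀, inputStore, cells]
  have e2 : s₀.words 0 2 = ρ := by simp [hs₀, inputStore, cells]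
  have hsrc : ∀ e : Fin m, s₀.words 1 e = G.src e := fun e => by simp [hs₀, inputStore, cells]
  have htgt : ∀ e : Fin m, s₀.words 2 e = G.tgt e := fun e => by simp [hs₀, inputStore, cells]
  have hneg : ∀ e : Fin m, s₀.words 3 e = if e ∈ G.neg then 1 else 0 := fun e => by
    simp [hs₀, inputStore, cells]
  have hmem : ∀ v : Fin n, s₀.words 4 v = if v ∈ U₀ then 1 else 0 := fun v => by
    simp [hs₀, inputStore, cells]
  have hwt : ∀ e : Fin m, s₀.reals 0 e = G.wt e := fun e => by simp [hs₀, inputStore, cells]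
  have h21 : s₀.words 21 0 = 0 := by simp [hs₀, inputStore]
  have h5 : s₀.words 5 0 = 0 := by simp [hs₀, inputStore]
  have hr2 : s₀.reals 2 0 = 0 := by simp [hs₀, inputStore]
  refine (Ends.seq (T₂ := 6 * m + 3 + 1 + 1) ((ends_listSources hs hb e0 hmem h21).imp
    fun s₁ hf₁ h₁ => ?_)).le (by omega)
  obtain ⟨hcard, lu, hlu, hluU, hlist⟩ := h₁
  refine Ends.seq (T₁ := 6 * m + 3) (T₂ := 1) ((ends_sumWeights (G := G) hb
    (by rw [hf₁.words 0 (by decide), e1])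
    (by rw [hf₁.reals 0 (by decide)]; exact hwt) (by rw [hf₁.reals 2 (by decide), hr2])).imp
    fun s₂ hf₂ h₂ => ?_)
  have hs₂ := hf₂.bounded (hf₁.bounded hs)
  have hm : ∀ a i, s₂.words a i % 2 ^ b = s₂.words a i := fun a i => Nat.mod_eq_of_lt (hs₂ a i)
  have hw : ∀ a, a ∉ [13, 20, 21] → s₂.words a = s₀.words a := fun a ha => by
    simp only [List.mem_cons, List.not_mem_nil, not_or] at ha
    rw [hf₂.words a (by simp [sumWeights, Prog.forLoop, Prog.wmods]; tauto),
      hf₁.words a (by simp [listSources, Prog.forLoop, Prog.wmods]; tauto)]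
  have h21' : s₂.words 21 0 = U₀.card := by rw [hf₂.words 21 (by decide), hcard]
  have hb2 : 2 < 2 ^ b := by omega
  have hqb : U₀.card / ρ < 2 ^ b := (Nat.div_le_self _ _).trans_lt (by omega)
  have hk' : U₀.card % 2 ^ b = U₀.card := Nat.mod_eq_of_lt (by omega)
  have hρ' : ρ % 2 ^ b = ρ := Nat.mod_eq_of_lt (by omega)
  refine Ends.straight rfl le_rfl ?_
  simp only [Prog.effect, WExp.eval, hm, h21', Nat.zero_mod, Nat.mod_eq_of_lt hb2,
    hw 0 (by decide), e2, hk', hρ']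
  refine ⟨hs₂.setWord _ _ hqb, by simp [hw 5 (by decide), h5], lu, hlu, hluU, ?_⟩
  constructor
  · simp [hw 0 (by decide), e0]
  · simp [hw 0 (by decide), e1]
  · simp [hw 0 (by decide), e2]
  · simpa [hw 1 (by decide)] using hsrc
  · simpa [hw 2 (by decide)] using htgt
  · simpa [hw 3 (by decide)] using hneg
  · simpa [hw 4 (by decide)] using hmem
  · intro e
    rw [Store.setWord_reals, hf₂.reals 0 (by decide), hf₁.reals 0 (by decide), hwt]
  · intro j
    simp [hf₂.words 20 (by decide), hlist]
  · simp [h21']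
  · simp
  · exact fun e _ => h₂ e

theorem failProb_algorithm (hpos : ∀ e, e ∉ G.neg → 0 ≤ G.wt e)
    (hU₀ : ∀ u ∈ U₀, G.IsNegVertex u) (hb : 4 * (n + m) + 16 < 2 ^ b) (hb' : 16 * n * n < 2 ^ b)
    (hρ0 : 0 < ρ) (hρ : ρ ≤ U₀.card) (r : ℕ) :
    failProb b (Correct G U₀ ρ)
      (14 * (n + m) + 11 + r * ((28 * Nat.log 2 n + 345) * (n + m)))
      ⟨[algorithm], inputStore G U₀ ρ⟩ ≤ (15 / 16) ^ r := by
  rw [show 14 * (n + m) + 11 + r * ((28 * Nat.log 2 n + 345) * (n + m)) =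
    14 * (n + m) + 9 + (r * ((28 * Nat.log 2 n + 345) * (n + m)) + 1) + 1 by ring, algorithm,
    failProb_seq]
  refine (ends_preprocess hb hρ).failProb_le _ _ fun s' _ h => ?_
  obtain ⟨hs', h5, lu, hlu, hluU, hready⟩ := h
  exact failProb_mainLoop hpos hU₀ hb hb' hρ0 hρ hlu hluU r hs' hready (Or.inl h5)

end

/-! ### Word length, running time and tail estimates -/

theorem lt_two_pow_wordLength (N : ℕ) (hN : 2 ≤ N) :
    4 * N + 16 < 2 ^ wordLength 8 N ∧ 16 * N * N < 2 ^ wordLength 8 N := by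
  have h : N + 1 ≤ 2 ^ (Nat.log 2 N + 1) := Nat.lt_pow_succ_log_self (by norm_num) N
  have h8 : (N + 1) ^ 8 ≤ 2 ^ wordLength 8 N := by
    rw [wordLength, mul_comm, pow_mul]
    exact Nat.pow_le_pow_left h 8
  have h6 : 729 ≤ (N + 1) ^ 6 :=
    le_trans (by norm_num) (Nat.pow_le_pow_left (show 3 ≤ N + 1 by omega) 6)
  have h9 : 729 * (N + 1) ^ 2 ≤ (N + 1) ^ 8 := by
    rw [show (N + 1) ^ 8 = (N + 1) ^ 6 * (N + 1) ^ 2 by ring]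
    exact Nat.mul_le_mul_right _ h6
  constructor <;> nlinarith

/-- Edges are distinct pairs, so `2n ≤ m ≤ n²`. This makes `log n` bounded below, which absorbs
additive constants in the time bound. -/
theorem two_le_of_edges {n m : ℕ} (G : HopGraph n m) (hm : 2 * n ≤ m) (hn : 1 ≤ n) : 2 ≤ n := by
  have h := Fintype.card_le_of_injective _ G.edge_inj
  simp only [Fintype.card_fin, Fintype.card_prod] at h
  nlinarith

theorem natLog_le_two_mul_log {n : ℕ} (hn : 2 ≤ n) : (Nat.log 2 n : ℝ) ≤ 2 * Real.log n := by
  have h1 : ((2 ^ Nat.log 2 n : ℕ) : ℝ) ≤ n := by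
    exact_mod_cast Nat.pow_log_le_self 2 (by omega)
  have h2 := Real.log_le_log (by positivity) h1
  rw [Nat.cast_pow, Real.log_pow] at h2
  have h3 := Real.log_two_gt_d9
  have h4 : (0 : ℝ) ≤ Nat.log 2 n := Nat.cast_nonneg _
  push_cast at h2
  nlinarith

section

variable {n m b ρ : ℕ} {G : HopGraph n m} {U₀ : Finset (Fin n)}

theorem tendsto_failProb_algorithm (hpos : ∀ e, e ∉ G.neg → 0 ≤ G.wt e)
    (hU₀ : ∀ u ∈ U₀, G.IsNegVertex u) (hb : 4 * (n + m) + 16 < 2 ^ b) (hb' : 16 * n * n < 2 ^ b)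
    (hρ0 : 0 < ρ) (hρ : ρ ≤ U₀.card) :
    Filter.Tendsto (fun t => failProb b (Correct G U₀ ρ) t ⟨[algorithm], inputStore G U₀ ρ⟩)
      Filter.atTop (nhds 0) := by
  have hlt : (15 / 16 : ENNReal) < 1 := by
    rw [ENNReal.div_lt_iff (by simp) (by simp)]; norm_num
  rw [ENNReal.tendsto_atTop_zero]
  intro ε hε
  obtain ⟨r, hr⟩ := ((ENNReal.tendsto_pow_atTop_nhds_zero_of_lt_one hlt).eventually
    (gt_mem_nhds hε)).exists
  exact ⟨_, fun t ht => (failProb_antitone _ ht).trans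
    ((failProb_algorithm hpos hU₀ hb hb' hρ0 hρ r).trans hr.le)⟩

theorem failProb_algorithm_le_rpow {α : ℝ} (hα : 0 < α) (hnm : 2 * n ≤ m) (hn : 2 ≤ n)
    (hpos : ∀ e, e ∉ G.neg → 0 ≤ G.wt e)
    (hU₀ : ∀ u ∈ U₀, G.IsNegVertex u) (hb : 4 * (n + m) + 16 < 2 ^ b) (hb' : 16 * n * n < 2 ^ b)
    (hρ0 : 0 < ρ) (hρ : ρ ≤ U₀.card) {t : ℕ}
    (ht : (1500 * (16 * α + 2) + 300) * (m : ℝ) * Real.log n ^ 2 ≤ t) :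
    failProb b (Correct G U₀ ρ) t ⟨[algorithm], inputStore G U₀ ρ⟩ ≤
      ENNReal.ofReal ((n : ℝ) ^ (-α)) := by
  have hlog : (1 : ℝ) ≤ 2 * Real.log n := by
    have := Real.log_le_log (by norm_num) (show (2 : ℝ) ≤ n by exact_mod_cast hn)
    linarith [Real.log_two_gt_d9]
  set r := ⌈16 * α * Real.log n⌉₊ with hr
  -- Since `log (15/16) ≤ -1/16`, this many rounds give `(15/16) ^ r ≤ n ^ (-α)`.
  have hr1 : 16 * α * Real.log n ≤ r := Nat.le_ceil _
  have hr2 : (r : ℝ) ≤ (16 * α + 2) * Real.log n := by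
    have := Nat.ceil_lt_add_one (show 0 ≤ 16 * α * Real.log n by nlinarith)
    linarith
  have htime : 14 * (n + m) + 11 + r * ((28 * Nat.log 2 n + 345) * (n + m)) ≤ t := by
    have hL := natLog_le_two_mul_log hn
    have hnm' : (n : ℝ) + m ≤ 3 / 2 * m := by
      have : (2 : ℝ) * n ≤ m := by exact_mod_cast hnm
      linarith
    have hm4 : (4 : ℝ) ≤ m := by exact_mod_cast (show 4 ≤ m by omega)
    set l := Real.log n with hl
    have h1 : ((28 * Nat.log 2 n + 345 : ℝ) * (n + m)) ≤ 1500 * l * m := by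
      -- Here `746 = 56 + 690`, from `Nat.log 2 n ≤ 2 * l` and `1 ≤ 2 * l`.
      have h11 : (28 * Nat.log 2 n + 345 : ℝ) ≤ 746 * l := by linarith
      calc _ ≤ (746 * l) * (3 / 2 * m) := by gcongr
        _ ≤ _ := by nlinarith
    have h2 : (r : ℝ) * ((28 * Nat.log 2 n + 345 : ℝ) * (n + m)) ≤
        ((16 * α + 2) * l) * (1500 * l * m) := by gcongr
    have h3 : (14 * (n + m) + 11 : ℝ) ≤ 300 * m * l ^ 2 := by
      have h31 : (1 : ℝ) ≤ 4 * l ^ 2 := by nlinarith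
      nlinarith
    have : (14 * (n + m) + 11 + r * ((28 * Nat.log 2 n + 345) * (n + m)) : ℝ) ≤ t := by
      refine le_trans ?_ ht
      calc _ ≤ 300 * m * l ^ 2 + ((16 * α + 2) * l) * (1500 * l * m) := add_le_add h3 h2
        _ = _ := by ring
    exact_mod_cast this
  calc _ ≤ _ := failProb_antitone _ htime
    _ ≤ _ := failProb_algorithm hpos hU₀ hb hb' hρ0 hρ r
    _ = ENNReal.ofReal ((15 / 16) ^ r) := by
        rw [ENNReal.ofReal_pow (by norm_num), ENNReal.ofReal_div_of_pos (by norm_num)]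
        simp
    _ ≤ _ := by
        refine ENNReal.ofReal_le_ofReal ?_
        have hn0 : (0 : ℝ) < n := by positivity
        rw [Real.rpow_def_of_pos hn0, ← Real.exp_log (show (0 : ℝ) < (15 / 16) ^ r by positivity),
          Real.log_pow]
        refine Real.exp_le_exp.2 ?_
        have h1 : Real.log (15 / 16) ≤ -(1 / 16) := by
          have := Real.log_le_sub_one_of_pos (show (0 : ℝ) < 15 / 16 by norm_num)
          linarith
        nlinarith [Nat.cast_nonneg (α := ℝ) r]

end

end RealRAM

theorem mainTheorem6 :
    ∃ (P : RealRAM.Prog) (κ : ℕ) (δ : ℝ), 0 < δ ∧ ∀ α : ℝ, 0 < α → ∃ C : ℝ, 0 < C ∧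
      ∀ (n m : ℕ) (G : HopGraph n m) (U₀ : Finset (Fin n)) (ρ : ℕ),
        2 * n ≤ m →
        (∀ e, e ∉ G.neg → 0 ≤ G.wt e) →
        (∀ u ∈ U₀, G.IsNegVertex u) →
        1 ≤ ρ → ρ ≤ U₀.card →
        let b : ℕ := RealRAM.wordLength κ (n + m)
        let start : RealRAM.Config := ⟨[P], RealRAM.inputStore G U₀ ρ⟩
        -- whenever the algorithm halts, its answer is correct
        (∀ (t : ℕ), ∀ c ∈ (RealRAM.runFor b t start).support, c.Halted →
          (c.store.answerKind = 1 ∧ G.HasNegCycle) ∨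
          (c.store.answerKind = 2 ∧ c.store.answerSet n ⊆ U₀ ∧
            δ * ((U₀.card : ℝ) / (ρ : ℝ)) ≤ ((c.store.answerSet n).card : ℝ) ∧
            ∃ y : Fin n, (y : ℕ) = c.store.answerVertex ∧
              ∀ u ∈ c.store.answerSet n, G.hopDist 1 u y < 0) ∨
          (c.store.answerKind = 3 ∧ G.IsOneHopIndep (c.store.answerSet n) ∧
            δ * (ρ : ℝ) ≤ ((c.store.answerSet n).card : ℝ))) ∧
        -- it halts with probability one
        Filter.Tendsto (fun t => RealRAM.probRunningAfter b t start) Filter.atTop (nhds 0) ∧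
        -- with high probability its running time is at most `C m log² n`
        (∀ t : ℕ, C * (m : ℝ) * Real.log n ^ 2 ≤ (t : ℝ) →
          RealRAM.probRunningAfter b t start ≤ ENNReal.ofReal ((n : ℝ) ^ (-α))) := by
  refine ⟨RealRAM.algorithm, 8, 1 / 16, by norm_num, fun α hα =>
    ⟨1500 * (16 * α + 2) + 300, by positivity, fun n m G U₀ ρ hnm hpos hU₀ hρ0 hρ => ?_⟩⟩
  have hk : U₀.card ≤ n := (Finset.card_le_univ _).trans (by simp)
  have hn : 2 ≤ n := RealRAM.two_le_of_edges G hnm (by omega)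
  obtain ⟨hb, hb''⟩ := RealRAM.lt_two_pow_wordLength (n + m) (by omega)
  intro b start
  have hb' : 16 * n * n < 2 ^ b := lt_of_le_of_lt (by gcongr <;> omega) hb''
  have htend := RealRAM.tendsto_failProb_algorithm hpos hU₀ hb hb' hρ0 hρ
  exact ⟨fun t c hc hh => RealRAM.post_of_failProb_tendsto htend t c hc hh,
    tendsto_of_tendsto_of_tendsto_of_le_of_le tendsto_const_nhds htend (fun _ => zero_le)
      fun t => RealRAM.probRunningAfter_le_failProb t start, fun t ht =>
    (RealRAM.probRunningAfter_le_failProb t start).trans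
      (RealRAM.failProb_algorithm_le_rpow hα hnm hn hpos hU₀ hb hb' hρ0 hρ ht)⟩
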